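/- Let $N,n,m\in\mathbb{Z}^+=\{0,1,2,\dots\}$, $p,q\ge 1$, and consider the $N$ followers $$x_i(t+1)=(A+\delta_iA)x_i(t)+(B+\delta_iB)u_i(t-r_{con})+(E+\delta_iE)v(t),\qquad y_i(t)=(C+\delta_iC)x_i(t),\qquad t\in\mathbb{Z}^+,\ i=1,\dots,N,$$ with $x_i(t)\in\mathbb{R}^n$, $u_i(t)\in\mathbb{R}^m$, $y_i(t)\in\mathbb{R}^p$, and the leader (node $0$) $v(t+1)=Sv(t)$, $v(t)\in\mathbb{R}^q$, $y_0(t)=-Fv(t)$. Here $A,B,E,C,S,F$ are real matrices, $w=(\delta_iA,\delta_iB,\delta_iE,\delta_iC)_{i=1}^N$ is the uncertainty, and $r_{con},r_{com}\in\mathbb{Z}^+$ are the input and communication delays. The regulated outputs are $e_i(t)=y_i(t)-y_0(t)$. Let $\bar{\mathcal G}$ be a digraph on the nodes $0,1,\dots,N$ with weighted adjacency matrix $[a_{ij}]$: $a_{ij}\ge 0$, $a_{ii}=0$, and $a_{ij}>0$ iff there is an edge from $j$ to $i$. Let $(G_1,G_2)$ be any minimal $p$-copy internal model of $S$, i.e.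 $G_1=I_p\otimes\beta$, $G_2=I_p\otimes\sigma$, where $\beta\in\mathbb{R}^{k\times k}$ has characteristic polynomial equal to the minimal polynomial of $S$, $\sigma\in\mathbb{R}^{k}$, and $(\beta,\sigma)$ is controllable; put $n_z=pk$. For gains $K_x\in\mathbb{R}^{m\times n}$, $K_z\in\mathbb{R}^{m\times n_z}$ consider the distributed dynamic state feedback law $$u_i(t)=K_x\sum_{j=0}^{N}a_{ij}\bigl(x_i(t-r_{com})-x_j(t-r_{com})\bigr)+K_z\bar z_i(t-r_{com}),\qquad \bar z_i(t+1)=G_1\bar z_i(t)+G_2\sum_{j=0}^{N}a_{ij}\bigl(y_i(t)-y_j(t)\bigr),$$ $i=1,\dots,N$, with the convention $x_0(t)=0$; the first equation holds for $t\ge -r_{con}$, the second for $t\in\mathbb{Z}^+$, and the initial condition of the closed loop is an arbitrary history of $(x_i,\bar z_i)_{i=1}^N$ on $\{-(r_{con}+r_{com}),\dots,0\}$ together with $v(0)$. The law solves the cooperative robust output regulation problem if 1. the nominal closed-loop system ($w=0$) with $v=0$ is exponentially stable: there are $M>0$ and $\rho\in(0,1)$ such that every trajectory satisfies $\max_i\max(\|x_i(t)\|,\|\bar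 z_i(t)\|)\le M\rho^t\max_i\max_{-(r_{con}+r_{com})\le s\le 0}\max(\|x_i(s)\|,\|\bar z_i(s)\|)$ for all $t\in\mathbb{Z}^+$; and 2. there is an open neighborhood $W$ of $w=0$ such that for every $w\in W$ and all initial conditions, $\lim_{t\to\infty}e_i(t)=0$ for $i=1,\dots,N$. **Theorem.** Assume that $(A,B)$ is stabilizable (some $A+BK$ has all its eigenvalues in the open unit disc), that $$\operatorname{rank}\begin{pmatrix}A-\lambda I_n&B\\ C&0\end{pmatrix}=n+p\quad\text{for every eigenvalue }\lambda\in\mathbb{C}\text{ of }S,$$ that all eigenvalues of $S$ lie on the unit circle, and that $A$ has no eigenvalue of modulus greater than $1$. Then there exist gains $K_x\in\mathbb{R}^{m\times n}$, $K_z\in\mathbb{R}^{m\times n_z}$ for which the above law solves the cooperative robust output regulation problem if and only if $\bar{\mathcal G}$ contains a directed spanning tree with root $0$. -/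

import Mathlib

open scoped Kronecker Topology

namespace CoopReg

noncomputable section

/-! ### Matrix notions -/

/-- The complex spectrum of a real square matrix. -/
def complexSpectrum {n : ℕ} (A : Matrix (Fin n) (Fin n) ℝ) : Set ℂ :=
  spectrum ℂ (A.map Complex.ofReal)

/-- A real square matrix is Schur if all its (complex) eigenvalues have modulus less than `1`. -/
def IsSchur {n : ℕ} (A : Matrix (Fin n) (Fin n) ℝ) : Prop :=
  ∀ μ ∈ complexSpectrum A, ‖μ‖ < 1

/-- `(A, B)` is stabilizable (in discrete time): some `A + B K` is Schur. -/
def IsStabilizable {n m : ℕ} (A : Matrix (Fin n) (Fin n) ℝ) (B : Matrix (Fin n) (Fin m) ℝ) :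
    Prop :=
  ∃ K : Matrix (Fin m) (Fin n) ℝ, IsSchur (A + B * K)

/-- The controllability matrix `[B, A B, …, A^(n-1) B]`; column `(l, j)` is column `j` of
`A ^ l * B`. -/
def controllabilityMatrix {n m : ℕ} (A : Matrix (Fin n) (Fin n) ℝ)
    (B : Matrix (Fin n) (Fin m) ℝ) : Matrix (Fin n) (Fin n × Fin m) ℝ :=
  Matrix.of fun i lj => (A ^ (lj.1 : ℕ) * B) i lj.2

/-- `(A, B)` is controllable. -/
def IsControllable {n m : ℕ} (A : Matrix (Fin n) (Fin n) ℝ) (B : Matrix (Fin n) (Fin m) ℝ) :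
    Prop :=
  (controllabilityMatrix A B).rank = n

/-- The (complex) matrix `[[A - μ I, B], [C, 0]]`. -/
def rosenbrockMatrix {n m p : ℕ} (A : Matrix (Fin n) (Fin n) ℝ) (B : Matrix (Fin n) (Fin m) ℝ)
    (C : Matrix (Fin p) (Fin n) ℝ) (μ : ℂ) : Matrix (Fin n ⊕ Fin p) (Fin n ⊕ Fin m) ℂ :=
  Matrix.fromBlocks (A.map Complex.ofReal - μ • 1) (B.map Complex.ofReal)
    (C.map Complex.ofReal) 0

/-- `(G₁, G₂)` is a minimal `p`-copy internal model of `S`: `G₁ = I_p ⊗ β`, `G₂ = I_p ⊗ σ`, where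
the characteristic polynomial of `β` is the minimal polynomial of `S`, `σ` is a column vector and
`(β, σ)` is controllable.  The columns of `I_p ⊗ σ`, indexed by `Fin p × Fin 1`, are relabelled
by `Fin p`. -/
def IsMinimalPCopyInternalModel {p q k : ℕ} (S : Matrix (Fin q) (Fin q) ℝ)
    (G₁ : Matrix (Fin p × Fin k) (Fin p × Fin k) ℝ) (G₂ : Matrix (Fin p × Fin k) (Fin p) ℝ) :
    Prop :=
  ∃ (β : Matrix (Fin k) (Fin k) ℝ) (σ : Matrix (Fin k) (Fin 1) ℝ),
    β.charpoly = minpoly ℝ S ∧ IsControllable β σ ∧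
    G₁ = (1 : Matrix (Fin p) (Fin p) ℝ) ⊗ₖ β ∧
    G₂ = ((1 : Matrix (Fin p) (Fin p) ℝ) ⊗ₖ σ).submatrix id (fun i => (i, 0))

/-! ### Digraphs -/

/-- `T` is a directed spanning tree of `G` with root `r`: a spanning subgraph in which `r` has no
parent, every other node has exactly one parent, and every node is reachable from `r`. -/
structure IsDirectedSpanningTree {V : Type*} (G T : Digraph V) (r : V) : Prop where
  subgraph : ∀ u v, T.Adj u v → G.Adj u v
  root : ∀ u, ¬ T.Adj u r
  parent : ∀ v, v ≠ r → ∃! u, T.Adj u v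
  reachable : ∀ v, Relation.ReflTransGen T.Adj r v

/-- `G` contains a directed spanning tree with root `r`. -/
def HasDirectedSpanningTree {V : Type*} (G : Digraph V) (r : V) : Prop :=
  ∃ T : Digraph V, IsDirectedSpanningTree G T r

/-- `a = [a_ij]` is a weighted adjacency matrix of `G`: nonnegative, zero on the diagonal, and
`a_ij > 0` exactly when there is an edge from `j` to `i`. -/
structure IsWeightedAdjacency {V : Type*} (G : Digraph V) (a : Matrix V V ℝ) : Prop where
  nonneg : ∀ i j, 0 ≤ a i j
  diag : ∀ i, a i i = 0
  pos_iff : ∀ i j, 0 < a i j ↔ G.Adj j i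

/-! ### The multi-agent system -/

/-- The data of the multi-agent system: nominal follower matrices `A, B, E, C`, the matrices `S`
and `F` of the leader `v(t+1) = S v(t)`, `y₀(t) = - F v(t)`, the input delay `rcon`, the
communication delay `rcom`, and the weights of the communication digraph.  Node `0` is the
leader, node `i.succ` is the follower `i : Fin N`. -/
structure MultiAgentSystem (N n m p q : ℕ) where
  A : Matrix (Fin n) (Fin n) ℝ
  B : Matrix (Fin n) (Fin m) ℝ
  E : Matrix (Fin n) (Fin q) ℝ
  C : Matrix (Fin p) (Fin n) ℝ
  S : Matrix (Fin q) (Fin q) ℝ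
  F : Matrix (Fin p) (Fin q) ℝ
  rcon : ℕ
  rcom : ℕ
  a : Matrix (Fin (N + 1)) (Fin (N + 1)) ℝ

/-- The uncertain parameters `w = (δ_i A, δ_i B, δ_i E, δ_i C)_i`, a finite-dimensional real
space with its usual topology. -/
abbrev Uncertainty (N n m p q : ℕ) : Type :=
  Fin N → Matrix (Fin n) (Fin n) ℝ × Matrix (Fin n) (Fin m) ℝ ×
    Matrix (Fin n) (Fin q) ℝ × Matrix (Fin p) (Fin n) ℝ

namespace MultiAgentSystem

variable {N n m p q k : ℕ}

/-- `A + δ_i A`. -/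
def plantA (P : MultiAgentSystem N n m p q) (w : Uncertainty N n m p q) (i : Fin N) :
    Matrix (Fin n) (Fin n) ℝ := P.A + (w i).1

/-- `B + δ_i B`. -/
def plantB (P : MultiAgentSystem N n m p q) (w : Uncertainty N n m p q) (i : Fin N) :
    Matrix (Fin n) (Fin m) ℝ := P.B + (w i).2.1

/-- `E + δ_i E`. -/
def plantE (P : MultiAgentSystem N n m p q) (w : Uncertainty N n m p q) (i : Fin N) :
    Matrix (Fin n) (Fin q) ℝ := P.E + (w i).2.2.1

/-- `C + δ_i C`. -/
def plantC (P : MultiAgentSystem N n m p q) (w : Uncertainty N n m p q) (i : Fin N) :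
    Matrix (Fin p) (Fin n) ℝ := P.C + (w i).2.2.2

/-- The output of every node: `y₀(t) = - F v(t)` for the leader and
`y_i(t) = (C + δ_i C) x_i(t)` for the followers. -/
def output (P : MultiAgentSystem N n m p q) (w : Uncertainty N n m p q)
    (v : ℤ → Fin q → ℝ) (x : Fin N → ℤ → Fin n → ℝ) (t : ℤ) : Fin (N + 1) → Fin p → ℝ :=
  Fin.cons (-(P.F.mulVec (v t))) fun i => (P.plantC w i).mulVec (x i t)

/-- The regulated output `e_i(t) = y_i(t) - y₀(t)`. -/
def regulatedOutput (P : MultiAgentSystem N n m p q) (w : Uncertainty N n m p q)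
    (v : ℤ → Fin q → ℝ) (x : Fin N → ℤ → Fin n → ℝ) (i : Fin N) (t : ℤ) : Fin p → ℝ :=
  P.output w v x t i.succ - P.output w v x t 0

/-- The virtual regulated output `e_vi(t) = ∑_j a_ij (y_i(t) - y_j(t))`; summing over all nodes
`j` is the same as summing over the neighbours of `i`, the other weights being zero. -/
def virtualOutput (P : MultiAgentSystem N n m p q) (w : Uncertainty N n m p q)
    (v : ℤ → Fin q → ℝ) (x : Fin N → ℤ → Fin n → ℝ) (i : Fin N) (t : ℤ) : Fin p → ℝ :=
  ∑ j : Fin (N + 1), P.a i.succ j • (P.output w v x t i.succ - P.output w v x t j)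

/-- The states of all nodes, with the convention `x₀ = 0` for the leader. -/
def nodeState (x : Fin N → ℤ → Fin n → ℝ) (t : ℤ) : Fin (N + 1) → Fin n → ℝ :=
  Fin.cons 0 fun i => x i t

/-- `η_i(t) = ∑_j a_ij (x_i(t - rcom) - x_j(t - rcom))`. -/
def eta (P : MultiAgentSystem N n m p q) (x : Fin N → ℤ → Fin n → ℝ) (i : Fin N) (t : ℤ) :
    Fin n → ℝ :=
  ∑ j : Fin (N + 1), P.a i.succ j •
    (nodeState x (t - P.rcom) i.succ - nodeState x (t - P.rcom) j)

/-- `v` is generated by the exosystem `v(t+1) = S v(t)`, `t ≥ 0`. -/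
def IsExosystemTrajectory (P : MultiAgentSystem N n m p q) (v : ℤ → Fin q → ℝ) : Prop :=
  ∀ t : ℤ, 0 ≤ t → v (t + 1) = P.S.mulVec (v t)

/-- `(x, z)` is a trajectory, for `t ≥ 0`, of the plants with uncertainty `w`, driven by the
exogenous signal `v`, in closed loop with the distributed dynamic state feedback law
`u_i(t) = K_x η_i(t) + K_z z_i(t - rcom)`, `z_i(t+1) = G₁ z_i(t) + G₂ e_vi(t)`.
The initial condition is the arbitrary history of `(x, z)` on `{-(rcon + rcom), …, 0}`; the
inputs `u_i(t)` that reach the plants at times `t + rcon ≥ 0` are all given by the law. -/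
structure IsClosedLoopTrajectory (P : MultiAgentSystem N n m p q) (w : Uncertainty N n m p q)
    (G₁ : Matrix (Fin p × Fin k) (Fin p × Fin k) ℝ) (G₂ : Matrix (Fin p × Fin k) (Fin p) ℝ)
    (Kx : Matrix (Fin m) (Fin n) ℝ) (Kz : Matrix (Fin m) (Fin p × Fin k) ℝ)
    (v : ℤ → Fin q → ℝ) (x : Fin N → ℤ → Fin n → ℝ) (z : Fin N → ℤ → Fin p × Fin k → ℝ)
    (u : Fin N → ℤ → Fin m → ℝ) : Prop where
  plant : ∀ (i : Fin N) (t : ℤ), 0 ≤ t →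
    x i (t + 1) = (P.plantA w i).mulVec (x i t) + (P.plantB w i).mulVec (u i (t - P.rcon)) +
      (P.plantE w i).mulVec (v t)
  control : ∀ (i : Fin N) (t : ℤ), -(P.rcon : ℤ) ≤ t →
    u i t = Kx.mulVec (P.eta x i t) + Kz.mulVec (z i (t - P.rcom))
  internalModel : ∀ (i : Fin N) (t : ℤ), 0 ≤ t →
    z i (t + 1) = G₁.mulVec (z i t) + G₂.mulVec (P.virtualOutput w v x i t)

/-- The nominal closed-loop system (`w = 0`) with `v = 0` is exponentially stable: the state
`(x, z)` decays at a uniform geometric rate, relative to any bound `D` on the initial history. -/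
def NominalExponentiallyStable (P : MultiAgentSystem N n m p q)
    (G₁ : Matrix (Fin p × Fin k) (Fin p × Fin k) ℝ) (G₂ : Matrix (Fin p × Fin k) (Fin p) ℝ)
    (Kx : Matrix (Fin m) (Fin n) ℝ) (Kz : Matrix (Fin m) (Fin p × Fin k) ℝ) : Prop :=
  ∃ M ρ : ℝ, 0 < M ∧ 0 < ρ ∧ ρ < 1 ∧
    ∀ x z u, P.IsClosedLoopTrajectory 0 G₁ G₂ Kx Kz (fun _ => 0) x z u →
      ∀ D : ℝ,
        (∀ (i : Fin N) (s : ℤ), -((P.rcon : ℤ) + P.rcom) ≤ s → s ≤ 0 →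
          ‖x i s‖ ≤ D ∧ ‖z i s‖ ≤ D) →
        ∀ (i : Fin N) (t : ℕ), ‖x i t‖ ≤ M * ρ ^ t * D ∧ ‖z i t‖ ≤ M * ρ ^ t * D

/-- Robust regulation: for all `w` in an open neighbourhood of `0`, all initial conditions of
plants, controllers and exosystem, every regulated output tends to zero. -/
def RobustlyRegulates (P : MultiAgentSystem N n m p q)
    (G₁ : Matrix (Fin p × Fin k) (Fin p × Fin k) ℝ) (G₂ : Matrix (Fin p × Fin k) (Fin p) ℝ)
    (Kx : Matrix (Fin m) (Fin n) ℝ) (Kz : Matrix (Fin m) (Fin p × Fin k) ℝ) : Prop :=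
  ∃ W : Set (Uncertainty N n m p q), IsOpen W ∧ 0 ∈ W ∧
    ∀ w ∈ W, ∀ v x z u, P.IsExosystemTrajectory v →
      P.IsClosedLoopTrajectory w G₁ G₂ Kx Kz v x z u →
      ∀ i : Fin N,
        Filter.Tendsto (fun t : ℕ => P.regulatedOutput w v x i t) Filter.atTop (𝓝 0)

/-- The cooperative robust output regulation problem is solved by the distributed dynamic state
feedback law with internal model `(G₁, G₂)` and gains `K_x, K_z`. -/
def SolvesCooperativeRegulation (P : MultiAgentSystem N n m p q)
    (G₁ : Matrix (Fin p × Fin k) (Fin p × Fin k) ℝ) (G₂ : Matrix (Fin p × Fin k) (Fin p) ℝ)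
    (Kx : Matrix (Fin m) (Fin n) ℝ) (Kz : Matrix (Fin m) (Fin p × Fin k) ℝ) : Prop :=
  P.NominalExponentiallyStable G₁ G₂ Kx Kz ∧ P.RobustlyRegulates G₁ G₂ Kx Kz

end MultiAgentSystem

end

end CoopReg

open CoopReg

/-! Containing a spanning tree rooted at the leader amounts to every node being reachable from it.
Let H be the follower block of the Laplacian.

Necessity. The followers that the leader does not reach get information only from one another. If
they start with equal states, all their relative errors vanish for ever, so their internal models
run freely under G₁. An eigenvalue of G₁ is an eigenvalue of S and so has modulus 1, which excludes
decay (`reachable_of_nominalExponentiallyStable`).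

Sufficiency. Reachability puts the spectrum of H in the open right half plane, by a maximum
principle. In the variables X = Hx the nominal closed loop is a family of copies of the plant
augmented with the internal model, coupled by H through the input alone. It therefore suffices to
find one gain K such that, for each eigenvalue c of H, the loop η(t+1) = 𝒜η(t) + cℬKη(t-d) with
total delay d has no characteristic root of modulus at least 1 (`nominal_eq_zero`).

The augmented pair (𝒜, ℬ) has its eigenvalues in the closed disc and no uncontrollable mode on the
circle (`isCriticallyStabilizable_augmented`). For such a pair the Riccati inequality 𝒜ᵀP𝒜 - FᵀF <
P, with F = ℬᵀP𝒜, has arbitrarily small solutions (`exists_riccati`). They are inverses of large W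
with W + ℬℬᵀ > 𝒜W𝒜ᵀ. If no such W existed, Hahn-Banach would give a positive semidefinite Z ≠ 0 that
𝒜 expands. As the eigenvalues lie in the closed disc, the expansion would be isometric, and Z would
support a left eigenvector on the circle that kills ℬ. With P small, the gain -r⁻¹F𝒜^d differs
little from undelayed state feedback, so the Lyapunov function ⟨Pη, η⟩ tolerates the delay and every
c with r ≤ re c and ‖c‖ ≤ R (`eq_zero_of_lowGain`).

Some power of the companion matrix of the closed loop is then a strict contraction. This is an open
condition, so it persists for small uncertainty. For regulation no regulator equations are solved:
the minimal polynomial of S in the forward shift kills v and maps trajectories to trajectories,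
hence the image of z tends to zero. A fixed functional of that image is the virtual output, and
inverting H gives e → 0 (`robustlyRegulates_of_norm_pow_lt_one`). -/

namespace CoopReg

/-! ### Digraphs -/

section Graph

variable {V : Type*}

/-- `v` is the end of a directed walk of length `n` from `r`. -/
def ReachIn (G : Digraph V) (r : V) : ℕ → V → Prop
  | 0, v => v = r
  | n + 1, v => ∃ u, ReachIn G r n u ∧ G.Adj u v

theorem exists_reachIn {G : Digraph V} {r v : V} (h : Relation.ReflTransGen G.Adj r v) :
    ∃ n, ReachIn G r n v := by
  induction h with
  | refl => exact ⟨0, rfl⟩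
  | tail _ huv ih =>
    obtain ⟨n, hn⟩ := ih
    exact ⟨n + 1, _, hn, huv⟩

/-- Breadth-first search: each node other than `r` takes as parent the last node but one of a
shortest walk from `r`. The distance to `r` drops along parents, so the chosen edges lead back to
`r`. -/
theorem hasDirectedSpanningTree_iff {G : Digraph V} {r : V} :
    HasDirectedSpanningTree G r ↔ ∀ v, Relation.ReflTransGen G.Adj r v := by
  classical
  constructor
  · rintro ⟨T, hT⟩ v
    exact Relation.ReflTransGen.mono (fun u w h => hT.subgraph u w h) _ _ (hT.reachable v)
  · intro h
    have hex : ∀ v, ∃ n, ReachIn G r n v := fun v => exists_reachIn (h v)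
    have hpar : ∀ v, v ≠ r → ∃ u, G.Adj u v ∧ Nat.find (hex u) < Nat.find (hex v) := by
      intro v hv
      have hs := Nat.find_spec (hex v)
      cases hn : Nat.find (hex v) with
      | zero =>
        rw [hn] at hs
        exact absurd hs hv
      | succ n =>
        rw [hn] at hs
        obtain ⟨u, hu, huv⟩ := hs
        exact ⟨u, huv, Nat.lt_succ_of_le (Nat.find_min' _ hu)⟩
    choose! f hf using hpar
    refine ⟨{ Adj := fun u v => v ≠ r ∧ u = f v }, ?_, ?_, ?_, ?_⟩
    · rintro u v ⟨hv, rfl⟩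
      exact (hf v hv).1
    · rintro u ⟨hr, -⟩
      exact hr rfl
    · intro v hv
      exact ⟨f v, ⟨hv, rfl⟩, fun u hu => hu.2⟩
    · have key : ∀ n v, Nat.find (hex v) ≤ n →
          Relation.ReflTransGen (fun u v => v ≠ r ∧ u = f v) r v := by
        intro n
        induction n with
        | zero =>
          intro v hv
          have hs := Nat.find_spec (hex v)
          rw [Nat.le_zero.1 hv] at hs
          rw [show v = r from hs]
        | succ n ih =>
          intro v hv
          by_cases hr : v = r
          · rw [hr]
          · exact (ih (f v) (by have := (hf v hr).2; omega)).tail ⟨hr, rfl⟩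
      exact fun v => key _ v le_rfl

end Graph

/-! ### The follower block of the Laplacian -/

/-- The rows and columns of the followers in the Laplacian of the weights `a`. -/
def followerLaplacian {N : ℕ} (a : Matrix (Fin (N + 1)) (Fin (N + 1)) ℝ) :
    Matrix (Fin N) (Fin N) ℝ :=
  Matrix.of fun i j => (if i = j then ∑ l, a i.succ l else 0) - a i.succ j.succ

/-- The convention that the leader has state 0 is what removes its column, while its weight stays in
the diagonal entry. -/
theorem followerLaplacian_sum_smul {N : ℕ} {𝕜 E : Type*} [CommRing 𝕜] [AddCommGroup E]
    [Module 𝕜 E] (f : ℝ →+* 𝕜) (a : Matrix (Fin (N + 1)) (Fin (N + 1)) ℝ) (x : Fin N → E)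
    (i : Fin N) :
    ∑ j, f (followerLaplacian a i j) • x j =
      ∑ l, f (a i.succ l) • ((Fin.cons 0 x : Fin (N + 1) → E) i.succ -
        (Fin.cons 0 x : Fin (N + 1) → E) l) := by
  rw [Fin.sum_univ_succ]
  simp only [followerLaplacian, Matrix.of_apply, map_sub, sub_smul, Finset.sum_sub_distrib,
    Fin.cons_succ, Fin.cons_zero, smul_sub]
  rw [Finset.sum_eq_single i]
  · rw [if_pos rfl, Fin.sum_univ_succ, map_add, map_sum, add_smul, Finset.sum_smul]
    simp only [smul_zero, sub_zero]
    abel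
  · intro j _ hj
    rw [if_neg hj.symm]; simp
  · simp

/-- If every node is reachable from the leader, the eigenvalues of the follower block of the
Laplacian have positive real part. -/
theorem followerLaplacian_eigenvalue_re_pos {N : ℕ} {G : Digraph (Fin (N + 1))}
    {a : Matrix (Fin (N + 1)) (Fin (N + 1)) ℝ} (hG : IsWeightedAdjacency G a)
    (hreach : ∀ v, Relation.ReflTransGen G.Adj 0 v) {μ : ℂ} {v : Fin N → ℂ} (hv : v ≠ 0)
    (h : ((followerLaplacian a).map Complex.ofReal).mulVec v = μ • v) : 0 < μ.re := by
  by_contra! hμ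
  -- Maximum principle. Extend `v` by 0 at the leader and take `i₀` of maximal modulus. Where `y w =
  -- y i₀`, the row of `w` times the conjugate of `y i₀` is a sum of terms with nonnegative real
  -- part whose total is nonpositive. Hence every in-neighbour of `w` has the same value, and a walk
  -- back to the leader gives `y i₀ = 0`.
  set y : Fin (N + 1) → ℂ := Fin.cons 0 v with hy
  have hrow : ∀ i : Fin N, ∑ l, (a i.succ l : ℂ) * (y i.succ - y l) = μ * y i.succ := by
    intro i
    have h1 := followerLaplacian_sum_smul Complex.ofRealHom a v i
    have h2 := congrFun h i
    simp only [Matrix.mulVec, dotProduct, Matrix.map_apply, Pi.smul_apply, smul_eq_mul] at h2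
    simp only [Complex.ofRealHom_eq_coe, smul_eq_mul] at h1
    rw [← h1, h2]
    simp [hy]
  obtain ⟨i₀, -, hmax⟩ := Finset.exists_max_image Finset.univ (fun i => ‖y i‖) ⟨0, Finset.mem_univ 0⟩
  have hne : y i₀ ≠ 0 := by
    obtain ⟨j, hj⟩ := Function.ne_iff.1 hv
    have := hmax j.succ (Finset.mem_univ _)
    have hj' : 0 < ‖y j.succ‖ := by simpa [hy] using hj
    exact norm_pos_iff.1 (hj'.trans_le this)
  have hstep : ∀ u w, G.Adj u w → y w = y i₀ → y u = y i₀ := by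
    intro u w huw hw
    rcases Fin.eq_zero_or_eq_succ w with rfl | ⟨i, rfl⟩
    · exact absurd (by rw [← hw]; simp [hy]) hne
    have h1 := congrArg (fun s => (s * (starRingEnd ℂ) (y i₀)).re) (hrow i)
    simp only [Finset.sum_mul, Complex.re_sum, hw] at h1
    have hterm : ∀ l, 0 ≤ ((a i.succ l : ℂ) * (y i₀ - y l) * (starRingEnd ℂ) (y i₀)).re := by
      intro l
      have e : ((a i.succ l : ℂ) * (y i₀ - y l) * (starRingEnd ℂ) (y i₀)).re =
          a i.succ l * (‖y i₀‖ ^ 2 - (y l * (starRingEnd ℂ) (y i₀)).re) := by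
        rw [mul_assoc, Complex.re_ofReal_mul, sub_mul, Complex.mul_conj, Complex.sub_re,
          Complex.ofReal_re, Complex.normSq_eq_norm_sq]
      rw [e]
      refine mul_nonneg (hG.nonneg _ _) (sub_nonneg.2 ((Complex.re_le_norm _).trans ?_))
      rw [norm_mul, RCLike.norm_conj, sq]
      exact mul_le_mul_of_nonneg_right (hmax l (Finset.mem_univ _)) (norm_nonneg _)
    have hR : (μ * y i₀ * (starRingEnd ℂ) (y i₀)).re ≤ 0 := by
      rw [mul_assoc, Complex.mul_conj, Complex.re_mul_ofReal]
      exact mul_nonpos_of_nonpos_of_nonneg hμ (Complex.normSq_nonneg _)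
    have hz : ∀ l ∈ Finset.univ,
        ((a i.succ l : ℂ) * (y i₀ - y l) * (starRingEnd ℂ) (y i₀)).re = 0 := by
      rw [← Finset.sum_eq_zero_iff_of_nonneg fun l _ => hterm l]
      exact le_antisymm (h1 ▸ hR) (Finset.sum_nonneg fun l _ => hterm l)
    have hu := hz u (Finset.mem_univ _)
    rw [mul_assoc, Complex.re_ofReal_mul] at hu
    have hpos : 0 < a i.succ u := (hG.pos_iff _ _).2 huw
    have hre := (mul_eq_zero.1 hu).resolve_left hpos.ne'
    have hle := hmax u (Finset.mem_univ _)
    -- The vanishing term leaves ‖y i₀ - y u‖² = ‖y u‖² - ‖y i₀‖², and `i₀` is maximal.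
    have hn : ‖y i₀ - y u‖ ^ 2 ≤ 0 := by
      have e1 : ‖y i₀ - y u‖ ^ 2 = 2 * ((y i₀ - y u) * (starRingEnd ℂ) (y i₀)).re
          + ‖y u‖ ^ 2 - ‖y i₀‖ ^ 2 := by
        simp only [← Complex.normSq_eq_norm_sq, Complex.normSq_apply, Complex.mul_re,
          Complex.sub_re, Complex.sub_im, Complex.conj_re, Complex.conj_im]
        ring
      rw [e1, hre]
      nlinarith [norm_nonneg (y u), norm_nonneg (y i₀)]
    have : y i₀ - y u = 0 := by
      have := sq_nonneg ‖y i₀ - y u‖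
      exact norm_eq_zero.1 (pow_eq_zero_iff (two_ne_zero)|>.1 (le_antisymm hn this))
    exact (sub_eq_zero.1 this).symm
  have hpath : ∀ u w, Relation.ReflTransGen G.Adj u w → y w = y i₀ → y u = y i₀ := by
    intro u w huw hw
    induction huw using Relation.ReflTransGen.head_induction_on with
    | refl => exact hw
    | head h _ ih => exact hstep _ _ h ih
  have h0 : y 0 = y i₀ := hpath 0 i₀ (hreach i₀) rfl
  exact hne (by rw [← h0]; simp [hy])

/-! ### A Lyapunov inequality and its dual -/

section Lyapunov

open scoped Matrix Matrix.Norms.Operator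

variable {ι κ : Type*} [Fintype ι] [Fintype κ]

/-- By homogeneity positivity is tested on the compact unit sphere. Symmetry is not imposed, so that
the set is open among all matrices, as Hahn-Banach separation requires. -/
theorem isOpen_quadratic_pos :
    IsOpen {M : Matrix ι ι ℝ | ∀ x : ι → ℝ, x ≠ 0 → 0 < x ⬝ᵥ M.mulVec x} := by
  have e : {M : Matrix ι ι ℝ | ∀ x : ι → ℝ, x ≠ 0 → 0 < x ⬝ᵥ M.mulVec x} =
      {M | ∀ x ∈ Metric.sphere (0 : ι → ℝ) 1, 0 < x ⬝ᵥ M.mulVec x} := by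
    ext M
    refine ⟨fun h x hx => h x fun h0 => by simp [h0] at hx, fun h x hx => ?_⟩
    have hn : 0 < ‖x‖ := norm_pos_iff.2 hx
    have h1 := h (‖x‖⁻¹ • x) (by simp [norm_smul, hn.ne'])
    rw [Matrix.mulVec_smul, smul_dotProduct, dotProduct_smul, smul_smul, smul_eq_mul] at h1
    exact (pos_iff_pos_of_mul_pos h1).1 (by positivity)
  rw [e, isOpen_iff_mem_nhds]
  intro M hM
  refine (isCompact_sphere (0 : ι → ℝ) 1).eventually_forall_of_forall_eventually fun x hx => ?_
  have hc : Continuous fun z : Matrix ι ι ℝ × (ι → ℝ) => z.2 ⬝ᵥ z.1.mulVec z.2 := by fun_prop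
  exact hc.continuousAt.eventually (lt_mem_nhds (hM x hx))

theorem quadratic_vecMulVec (M : Matrix ι ι ℝ) (x : ι → ℝ) :
    (M * Matrix.vecMulVec x x).trace = x ⬝ᵥ M.mulVec x := by
  rw [Matrix.mul_vecMulVec, Matrix.trace_vecMulVec, dotProduct_comm]

theorem linear_eq_trace [DecidableEq ι] (φ : Matrix ι ι ℝ →ₗ[ℝ] ℝ) (M : Matrix ι ι ℝ) :
    φ M = ((Matrix.of fun i j => φ (Matrix.single j i 1)) * M).trace := by
  conv_lhs => rw [Matrix.matrix_eq_sum_single M]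
  simp only [map_sum, Matrix.trace, Matrix.diag_apply, Matrix.mul_apply, Matrix.of_apply]
  rw [Finset.sum_comm]
  refine Finset.sum_congr rfl fun i _ => Finset.sum_congr rfl fun j _ => ?_
  have : Matrix.single j i (M j i) = M j i • Matrix.single j i (1 : ℝ) := by
    rw [Matrix.smul_single, smul_eq_mul, mul_one]
  rw [this, map_smul, smul_eq_mul, mul_comm]

/-- A theorem of alternatives. The affine image of {W ≥ c} meets the open cone of positive forms, or
a functional `f` separates them; `Z` represents `-f` in the trace pairing. The sign of `f` on the
cone gives `Z ≥ 0`. Its lower bound along the rays c + r xxᵀ gives `Aᵀ Z A - Z ≥ 0`, and its value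
at W = c gives the trace inequality. -/
theorem exists_lyapunov_or_dual [DecidableEq ι] (A : Matrix ι ι ℝ) (B : Matrix ι κ ℝ) (c : ℝ) :
    (∃ W : Matrix ι ι ℝ, Wᵀ = W ∧ (∀ x : ι → ℝ, c * (x ⬝ᵥ x) ≤ x ⬝ᵥ W.mulVec x) ∧
      (W + B * Bᵀ - A * W * Aᵀ).PosDef) ∨
    ∃ Z : Matrix ι ι ℝ, Z ≠ 0 ∧ Z.PosSemidef ∧ (Aᵀ * Z * A - Z).PosSemidef ∧
      (Bᵀ * Z * B).trace ≤ c * (Aᵀ * Z * A - Z).trace := by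
  set s := {M : Matrix ι ι ℝ | ∀ x : ι → ℝ, x ≠ 0 → 0 < x ⬝ᵥ M.mulVec x} with hs
  set t := (fun W => W + B * Bᵀ - A * W * Aᵀ) ''
    {W : Matrix ι ι ℝ | ∀ x : ι → ℝ, c * (x ⬝ᵥ x) ≤ x ⬝ᵥ W.mulVec x} with ht
  by_cases hdis : Disjoint s t
  swap
  · left
    obtain ⟨_, hMs, W, hW, rfl⟩ := Set.not_disjoint_iff.1 hdis
    have hquad : ∀ (M : Matrix ι ι ℝ) (x : ι → ℝ), x ⬝ᵥ Mᵀ.mulVec x = x ⬝ᵥ M.mulVec x := by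
      intro M x
      rw [Matrix.mulVec_transpose, Matrix.dotProduct_mulVec, dotProduct_comm]
    -- Passing to the symmetric part does not change the quadratic forms.
    refine ⟨(1 / 2 : ℝ) • (W + Wᵀ), ?_, ?_, ?_⟩
    · rw [Matrix.transpose_smul, Matrix.transpose_add, Matrix.transpose_transpose, add_comm]
    · intro x
      rw [Matrix.smul_mulVec, Matrix.add_mulVec, dotProduct_smul, dotProduct_add, hquad,
        smul_eq_mul]
      linarith [hW x]
    · have e : (1 / 2 : ℝ) • (W + Wᵀ) + B * Bᵀ - A * ((1 / 2 : ℝ) • (W + Wᵀ)) * Aᵀ =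
          (1 / 2 : ℝ) • ((W + B * Bᵀ - A * W * Aᵀ) + (W + B * Bᵀ - A * W * Aᵀ)ᵀ) := by
        simp only [Matrix.transpose_sub, Matrix.transpose_add, Matrix.transpose_mul,
          Matrix.transpose_transpose, Matrix.mul_smul, Matrix.smul_mul, Matrix.mul_add,
          Matrix.add_mul, ← Matrix.mul_assoc]
        module
      rw [e]
      refine Matrix.PosDef.of_dotProduct_mulVec_pos ?_ fun x hx => ?_
      · rw [Matrix.IsHermitian, Matrix.conjTranspose_eq_transpose_of_trivial,
          Matrix.transpose_smul, Matrix.transpose_add, Matrix.transpose_transpose, add_comm]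
      · rw [Matrix.smul_mulVec, Matrix.add_mulVec, dotProduct_smul, dotProduct_add, star_trivial,
          hquad, smul_eq_mul]
        linarith [hMs x hx]
  right
  have hs1 : Convex ℝ s := by
    intro M hM M' hM' a b ha hb hab x hx
    rw [Matrix.add_mulVec, Matrix.smul_mulVec, Matrix.smul_mulVec, dotProduct_add,
      dotProduct_smul, dotProduct_smul, smul_eq_mul, smul_eq_mul]
    have h1 := hM x hx
    have h2 := hM' x hx
    rcases ha.eq_or_lt with rfl | ha
    · rw [zero_add] at hab; subst hab; linarith
    · have := mul_pos ha h1
      have := mul_nonneg hb h2.le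
      linarith
  have ht1 : Convex ℝ t := by
    rintro _ ⟨W, hW, rfl⟩ _ ⟨W', hW', rfl⟩ a b ha hb hab
    refine ⟨a • W + b • W', fun x => ?_, ?_⟩
    · rw [Matrix.add_mulVec, Matrix.smul_mulVec, Matrix.smul_mulVec, dotProduct_add,
        dotProduct_smul, dotProduct_smul, smul_eq_mul, smul_eq_mul]
      have h1 := mul_le_mul_of_nonneg_left (hW x) ha
      have h2 := mul_le_mul_of_nonneg_left (hW' x) hb
      calc c * (x ⬝ᵥ x) = a * (c * (x ⬝ᵥ x)) + b * (c * (x ⬝ᵥ x)) := by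
            rw [← add_mul, hab, one_mul]
        _ ≤ _ := add_le_add h1 h2
    · have : B * Bᵀ = a • (B * Bᵀ) + b • (B * Bᵀ) := by rw [← add_smul, hab, one_smul]
      simp only [Matrix.mul_add, Matrix.add_mul, Matrix.mul_smul, Matrix.smul_mul]
      conv_lhs => rw [this]
      module
  obtain ⟨f, u, hfs, hft⟩ := geometric_hahn_banach_open hs1 isOpen_quadratic_pos ht1 hdis
  have h1s : (1 : Matrix ι ι ℝ) ∈ s := by
    intro x hx
    rw [Matrix.one_mulVec]
    exact lt_of_le_of_ne (Finset.sum_nonneg fun i _ => mul_self_nonneg _)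
      fun h => hx (dotProduct_self_eq_zero.1 h.symm)
  have hscale : ∀ M ∈ s, ∀ r : ℝ, 0 < r → r • M ∈ s := by
    intro M hM r hr x hx
    rw [Matrix.smul_mulVec, dotProduct_smul, smul_eq_mul]
    exact mul_pos hr (hM x hx)
  have hneg : ∀ M ∈ s, f M ≤ 0 := by
    intro M hM
    by_contra! h
    have h1 := hfs _ (hscale M hM ((|u| + 1) / f M) (by positivity))
    rw [map_smul, smul_eq_mul, div_mul_cancel₀ _ h.ne'] at h1
    linarith [le_abs_self u]
  have hu : 0 ≤ u := by
    by_contra! h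
    have h0 := hneg 1 h1s
    have hne : f 1 ≠ 0 := fun h' => by
      have := hfs 1 h1s
      linarith
    have h2 : 0 < u / f 1 := div_pos_of_neg_of_neg h (lt_of_le_of_ne h0 hne)
    have h1 := hfs _ (hscale 1 h1s (u / f 1) h2)
    rw [map_smul, smul_eq_mul, div_mul_cancel₀ _ hne] at h1
    exact lt_irrefl _ h1
  have hpsd : ∀ M : Matrix ι ι ℝ, (∀ x : ι → ℝ, 0 ≤ x ⬝ᵥ M.mulVec x) → f M ≤ 0 := by
    intro M hM
    by_contra! h
    have hmem : ∀ ε : ℝ, 0 < ε → M + ε • (1 : Matrix ι ι ℝ) ∈ s := by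
      intro ε hε x hx
      rw [Matrix.add_mulVec, dotProduct_add]
      exact add_pos_of_nonneg_of_pos (hM x) (hscale 1 h1s ε hε x hx)
    have h1 := hneg _ (hmem (f M / (2 * (|f 1| + 1))) (by positivity))
    rw [map_add, map_smul, smul_eq_mul] at h1
    have h2 : -(f M / 2) ≤ f M / (2 * (|f 1| + 1)) * f 1 := by
      have e : f M / (2 * (|f 1| + 1)) * f 1 = f M / 2 * (f 1 / (|f 1| + 1)) := by
        field_simp
      have e2 : -1 ≤ f 1 / (|f 1| + 1) := by
        rw [le_div_iff₀ (by positivity)]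
        linarith [neg_abs_le (f 1)]
      rw [e]
      nlinarith
    linarith
  set Z : Matrix ι ι ℝ := Matrix.of fun i j => -f (Matrix.single j i 1) with hZ
  have hfZ : ∀ M : Matrix ι ι ℝ, (Z * M).trace = -f M := by
    intro M
    have := linear_eq_trace (-(f : Matrix ι ι ℝ →ₗ[ℝ] ℝ)) M
    simpa [hZ] using this.symm
  have hZq : ∀ x : ι → ℝ, x ⬝ᵥ Z.mulVec x = -f (Matrix.vecMulVec x x) := by
    intro x
    rw [← hfZ, quadratic_vecMulVec]
  have hcone : ∀ W : Matrix ι ι ℝ, (∀ x : ι → ℝ, c * (x ⬝ᵥ x) ≤ x ⬝ᵥ W.mulVec x) →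
      0 ≤ f (W + B * Bᵀ - A * W * Aᵀ) := fun W hW => hu.trans (hft _ ⟨W, hW, rfl⟩)
  have hc1 : ∀ x : ι → ℝ, c * (x ⬝ᵥ x) ≤ x ⬝ᵥ (c • (1 : Matrix ι ι ℝ)).mulVec x := by
    intro x
    rw [Matrix.smul_mulVec, Matrix.one_mulVec, dotProduct_smul, smul_eq_mul]
  have hvv : ∀ x y : ι → ℝ, y ⬝ᵥ (Matrix.vecMulVec x x).mulVec y = (x ⬝ᵥ y) ^ 2 := by
    intro x y
    rw [← quadratic_vecMulVec, Matrix.vecMulVec_mul_vecMulVec, Matrix.trace_vecMulVec,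
      dotProduct_smul, smul_eq_mul, sq]
  -- An antisymmetric matrix and its negative both have the zero quadratic form, so `f` is
  -- nonpositive on both and vanishes there.
  have hsymm : Zᵀ = Z := by
    ext i j
    have hpm : ∀ r : ℝ, f (r • (Matrix.single i j (1 : ℝ) - Matrix.single j i 1)) ≤ 0 := by
      intro r
      refine hpsd _ fun x => le_of_eq ?_
      rw [Matrix.smul_mulVec, dotProduct_smul, Matrix.sub_mulVec, dotProduct_sub]
      simp [Matrix.single_mulVec, dotProduct, Function.update_apply, mul_comm]
    have h1 := hpm 1
    have h2 := hpm (-1)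
    rw [map_smul, map_sub, smul_eq_mul] at h1 h2
    simp only [Matrix.transpose_apply, hZ, Matrix.of_apply]
    linarith
  refine ⟨Z, ?_, ?_, ?_, ?_⟩
  · intro h0
    have h1 := hfZ 1
    rw [h0, Matrix.zero_mul, Matrix.trace_zero] at h1
    have h2 := hfs 1 h1s
    have h3 := hft _ ⟨c • 1, hc1, rfl⟩
    have h4 := hfZ (c • 1 + B * Bᵀ - A * c • 1 * Aᵀ)
    rw [h0, Matrix.zero_mul, Matrix.trace_zero] at h4
    linarith
  · refine Matrix.PosSemidef.of_dotProduct_mulVec_nonneg hsymm fun x => ?_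
    rw [star_trivial, hZq, neg_nonneg]
    exact hpsd _ fun y => by rw [hvv]; positivity
  · refine Matrix.PosSemidef.of_dotProduct_mulVec_nonneg ?_ fun x => ?_
    · rw [Matrix.IsHermitian, Matrix.conjTranspose_eq_transpose_of_trivial]
      simp only [Matrix.transpose_sub, Matrix.transpose_mul, Matrix.transpose_transpose, hsymm,
        Matrix.mul_assoc]
    · have e : x ⬝ᵥ (Aᵀ * Z * A - Z).mulVec x =
          f (Matrix.vecMulVec x x - A * Matrix.vecMulVec x x * Aᵀ) := by
        rw [← quadratic_vecMulVec, Matrix.sub_mul, Matrix.trace_sub, map_sub, hfZ,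
          Matrix.mul_assoc, Matrix.mul_assoc, Matrix.trace_mul_comm, Matrix.mul_assoc,
          Matrix.mul_assoc, hfZ]
        ring
      rw [star_trivial, e]
      by_contra! h
      have hr : ∀ r : ℝ, 0 ≤ r → 0 ≤ f (c • 1 + B * Bᵀ - A * c • 1 * Aᵀ) +
          r * f (Matrix.vecMulVec x x - A * Matrix.vecMulVec x x * Aᵀ) := by
        intro r hr
        have := hcone (c • 1 + r • Matrix.vecMulVec x x) fun y => by
          rw [Matrix.add_mulVec, dotProduct_add, Matrix.smul_mulVec r, dotProduct_smul, hvv,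
            smul_eq_mul]
          have := mul_nonneg hr (sq_nonneg (x ⬝ᵥ y))
          linarith [hc1 y]
        refine this.trans_eq ?_
        have hlin : ∀ M M' : Matrix ι ι ℝ, f M + r * f M' = f (M + r • M') := fun M M' => by
          rw [map_add, map_smul, smul_eq_mul]
        rw [hlin]
        congr 1
        simp only [Matrix.mul_add, Matrix.add_mul, Matrix.mul_smul, Matrix.smul_mul]
        module
      set g := f (Matrix.vecMulVec x x - A * Matrix.vecMulVec x x * Aᵀ)
      set g0 := f (c • 1 + B * Bᵀ - A * c • 1 * Aᵀ)
      have := hr ((|g0| + 1) / (-g)) (div_nonneg (by positivity) (by linarith))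
      have e2 : (|g0| + 1) / (-g) * g = -(|g0| + 1) := by
        have := h.ne
        field_simp
      rw [e2] at this
      linarith [le_abs_self g0]
  · have h := hcone _ hc1
    have e : f (c • 1 + B * Bᵀ - A * c • 1 * Aᵀ) =
        c * (Aᵀ * Z * A - Z).trace - (Bᵀ * Z * B).trace := by
      have e1 : (Aᵀ * Z * A).trace = -f (A * Aᵀ) := by
        rw [← hfZ, Matrix.mul_assoc, Matrix.trace_mul_comm, Matrix.mul_assoc]
      have e2 : (Bᵀ * Z * B).trace = -f (B * Bᵀ) := by
        rw [← hfZ, Matrix.mul_assoc, Matrix.trace_mul_comm, Matrix.mul_assoc]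
      have e3 : Z.trace = -f 1 := by rw [← hfZ, Matrix.mul_one]
      rw [Matrix.trace_sub, e1, e2, e3]
      simp only [Matrix.mul_smul, Matrix.smul_mul, Matrix.mul_one, map_add, map_sub, map_smul,
        smul_eq_mul]
      ring
    linarith

end Lyapunov

/-! ### Expanding maps with eigenvalues in the closed unit disc -/

section Expanding

open scoped InnerProductSpace

/-- The Hermitian form ‖Tx‖² - ‖x‖² is nonnegative and vanishes at `v`, since expansion and ‖μ‖ ≤ 1
force ‖Tv‖ = ‖v‖. A zero of a nonnegative form lies in its radical. -/
theorem inner_map_map_of_expanding_of_eigenvector {V : Type*} [NormedAddCommGroup V]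
    [InnerProductSpace ℂ V] {T : V →ₗ[ℂ] V} (hT : ∀ v, ‖v‖ ≤ ‖T v‖) {μ : ℂ} (hμ : ‖μ‖ ≤ 1)
    {v : V} (hv : T v = μ • v) (y : V) : ⟪T v, T y⟫_ℂ = ⟪v, y⟫_ℂ := by
  have hn : ‖T v‖ = ‖v‖ := by
    refine le_antisymm ?_ (hT v)
    rw [hv, norm_smul]
    exact mul_le_of_le_one_left (norm_nonneg v) hμ
  set δ := ⟪T v, T y⟫_ℂ - ⟪v, y⟫_ℂ with hδ
  have key : ∀ s : ℂ, 0 ≤ ‖T y‖ ^ 2 - ‖y‖ ^ 2 + 2 * ((starRingEnd ℂ) s * δ).re := by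
    intro s
    have h1 := pow_le_pow_left₀ (norm_nonneg _) (hT (s • v + y)) 2
    rw [map_add, map_smul, @norm_add_sq ℂ, @norm_add_sq ℂ, inner_smul_left, inner_smul_left,
      norm_smul, norm_smul, hn] at h1
    simp only [RCLike.re_to_complex] at h1
    rw [hδ, mul_sub, Complex.sub_re]
    linarith
  by_contra h
  have hd : 0 < ‖δ‖ := norm_pos_iff.2 (sub_ne_zero.2 h)
  -- This multiple of `δ` makes the linear term equal to -2(‖Ty‖² + 1), which exceeds the constant
  -- term in size.
  have h1 := key ((-((‖T y‖ ^ 2 + 1) / ‖δ‖ ^ 2) : ℝ) * δ)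
  rw [map_mul, Complex.conj_ofReal, mul_assoc, mul_comm _ δ, Complex.mul_conj,
    Complex.normSq_eq_norm_sq, Complex.re_ofReal_mul, Complex.ofReal_re, neg_mul,
    div_mul_cancel₀ _ (by positivity)] at h1
  nlinarith [sq_nonneg ‖y‖, sq_nonneg ‖T y‖]

/-- Eigenvectors span: products with them are preserved, so the orthogonal complement of their span
is invariant. If it were nonzero it would contain an eigenvector, which would be orthogonal to
itself. -/
theorem inner_map_map_of_expanding {V : Type*} [NormedAddCommGroup V]
    [InnerProductSpace ℂ V] [FiniteDimensional ℂ V] {T : V →ₗ[ℂ] V} (hT : ∀ v, ‖v‖ ≤ ‖T v‖)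
    (hμ : ∀ (μ : ℂ) (v : V), v ≠ 0 → T v = μ • v → ‖μ‖ ≤ 1) (x y : V) :
    ⟪T x, T y⟫_ℂ = ⟪x, y⟫_ℂ := by
  have hin : ∀ (μ : ℂ) (v : V), T v = μ • v → ∀ y, ⟪T v, T y⟫_ℂ = ⟪v, y⟫_ℂ := by
    intro μ v hv y
    by_cases h0 : v = 0
    · simp [h0]
    · exact inner_map_map_of_expanding_of_eigenvector hT (hμ μ v h0 hv) hv y
  set E : Submodule ℂ V := Submodule.span ℂ {v | ∃ μ : ℂ, T v = μ • v} with hE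
  have hmem : ∀ y, y ∈ Eᗮ ↔ ∀ v, (∃ μ : ℂ, T v = μ • v) → ⟪v, y⟫_ℂ = 0 := by
    intro y
    rw [Submodule.mem_orthogonal]
    refine ⟨fun h v hv => h v (Submodule.subset_span hv), fun h u hu => ?_⟩
    induction hu using Submodule.span_induction with
    | mem v hv => exact h v hv
    | zero => exact inner_zero_left _
    | add a b _ _ ha hb => rw [inner_add_left, ha, hb, add_zero]
    | smul c a _ ha => rw [inner_smul_left, ha, mul_zero]
  have hinv : ∀ y ∈ Eᗮ, T y ∈ Eᗮ := by
    intro y hy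
    rw [hmem] at hy ⊢
    rintro v ⟨μ, hv⟩
    have h1 := hin μ v hv y
    rw [hy v ⟨μ, hv⟩, hv, inner_smul_left] at h1
    by_cases hv0 : v = 0
    · rw [hv0, inner_zero_left]
    refine (mul_eq_zero.1 h1).resolve_left fun h0 => hv0 ?_
    rw [map_eq_zero] at h0
    have h2 := hT v
    rw [hv, h0, zero_smul, norm_zero] at h2
    exact norm_le_zero_iff.1 h2
  have hbot : Eᗮ = ⊥ := by
    by_contra hne
    have : Nontrivial Eᗮ := Submodule.nontrivial_iff_ne_bot.2 hne
    obtain ⟨μ, hev⟩ := Module.End.exists_eigenvalue (T.restrict hinv)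
    obtain ⟨v, hv⟩ := hev.exists_hasEigenvector
    have hTv : T v = μ • (v : V) := congrArg Subtype.val hv.apply_eq_smul
    have := (hmem _).1 v.2 v ⟨μ, hTv⟩
    exact hv.2 (Subtype.ext (inner_self_eq_zero.1 this))
  have htop : x ∈ E := by
    rw [(Submodule.orthogonal_eq_bot_iff).1 hbot]; trivial
  induction htop using Submodule.span_induction with
  | mem v hv => obtain ⟨μ, hv⟩ := hv; exact hin μ v hv y
  | zero => simp
  | add a b _ _ ha hb => rw [map_add, inner_add_left, inner_add_left, ha, hb]
  | smul c a _ ha => rw [map_smul, inner_smul_left, inner_smul_left, ha]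

/-- `A` descends to X / ker R, realised as the range of `R`, where the degenerate inner product
becomes a genuine one. -/
theorem exists_range_map {X Y : Type*} [AddCommGroup X] [Module ℂ X] [AddCommGroup Y]
    [Module ℂ Y] (R : X →ₗ[ℂ] Y) (A : X →ₗ[ℂ] X) (h : ∀ x, R x = 0 → R (A x) = 0) :
    ∃ T : LinearMap.range R →ₗ[ℂ] LinearMap.range R,
      ∀ x, T (R.rangeRestrict x) = R.rangeRestrict (A x) := by
  obtain ⟨g, hg⟩ := R.rangeRestrict.exists_rightInverse_of_surjective R.range_rangeRestrict
  refine ⟨R.rangeRestrict ∘ₗ A ∘ₗ g, fun x => ?_⟩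
  have h1 : R.rangeRestrict (g (R.rangeRestrict x)) = R.rangeRestrict x :=
    LinearMap.congr_fun hg _
  have h2 : R (g (R.rangeRestrict x) - x) = 0 := by
    have := congrArg Subtype.val h1
    simpa [sub_eq_zero] using this
  have h3 := h _ h2
  rw [map_sub, map_sub, sub_eq_zero] at h3
  exact Subtype.ext h3

/-- A map that expands a degenerate inner product and has its eigenvalues in the closed unit disc
preserves this inner product, and has a left eigenvector supported by it. -/
theorem eq_zero_and_exists_left_eigenvector {X Y Y' : Type*} [AddCommGroup X] [Module ℂ X]
    [FiniteDimensional ℂ X] [NormedAddCommGroup Y] [InnerProductSpace ℂ Y]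
    [NormedAddCommGroup Y'] [InnerProductSpace ℂ Y']
    (R : X →ₗ[ℂ] Y) (L : X →ₗ[ℂ] Y') (A : X →ₗ[ℂ] X)
    (h : ∀ x, ‖R (A x)‖ ^ 2 = ‖R x‖ ^ 2 + ‖L x‖ ^ 2)
    (hA : ∀ (μ : ℂ) (x : X), x ≠ 0 → A x = μ • x → ‖μ‖ ≤ 1) :
    L = 0 ∧ (R ≠ 0 → ∃ (μ : ℂ) (w : X →ₗ[ℂ] ℂ), ‖μ‖ = 1 ∧ w ≠ 0 ∧ (∀ x, w (A x) = μ * w x) ∧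
      ∀ x, R x = 0 → w x = 0) := by
  have hker1 : LinearMap.ker (R ∘ₗ A) ≤ LinearMap.ker R := by
    intro x hx
    have h1 := h x
    rw [show R (A x) = 0 from hx, norm_zero] at h1
    have : ‖R x‖ ^ 2 = 0 := by nlinarith [sq_nonneg ‖R x‖, sq_nonneg ‖L x‖]
    exact norm_eq_zero.1 (pow_eq_zero_iff two_ne_zero |>.1 this)
  -- The norm identity gives one inclusion; the rank of `R ∘ A` is at most that of `R`, so
  -- dimensions give equality. The reverse inclusion is what lets `A` descend.
  have hker : LinearMap.ker (R ∘ₗ A) = LinearMap.ker R := by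
    refine Submodule.eq_of_le_of_finrank_le hker1 ?_
    have h1 := (R ∘ₗ A).finrank_range_add_finrank_ker
    have h2 := R.finrank_range_add_finrank_ker
    have h3 := Submodule.finrank_mono (LinearMap.range_comp_le_range A R)
    omega
  obtain ⟨T, hT⟩ := exists_range_map R A fun x hx =>
    show x ∈ LinearMap.ker (R ∘ₗ A) by rw [hker]; exact hx
  have hexp : ∀ v, ‖v‖ ≤ ‖T v‖ := by
    intro v
    obtain ⟨x, rfl⟩ := R.surjective_rangeRestrict v
    rw [hT]
    refine le_of_sq_le_sq ?_ (norm_nonneg _)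
    change ‖R x‖ ^ 2 ≤ ‖R (A x)‖ ^ 2
    linarith [h x, sq_nonneg ‖L x‖]
  -- If ‖μ‖ > 1 then A - μ is injective, hence surjective; so T - μ is surjective on the quotient,
  -- hence injective.
  have heig : ∀ (μ : ℂ) (v : LinearMap.range R), v ≠ 0 → T v = μ • v → ‖μ‖ ≤ 1 := by
    intro μ v hv hTv
    by_contra hμ
    have hinj : Function.Injective (A - μ • (LinearMap.id : X →ₗ[ℂ] X)) := by
      rw [← LinearMap.ker_eq_bot, LinearMap.ker_eq_bot']
      intro x hx
      by_contra hx0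
      exact hμ (hA μ x hx0 (sub_eq_zero.1 hx))
    have hsur := LinearMap.injective_iff_surjective.1 hinj
    have hsurT : Function.Surjective (T - μ • (LinearMap.id : LinearMap.range R →ₗ[ℂ] LinearMap.range R)) := by
      intro y
      obtain ⟨x, rfl⟩ := R.surjective_rangeRestrict y
      obtain ⟨x', rfl⟩ := hsur x
      refine ⟨R.rangeRestrict x', ?_⟩
      simp [hT]
    have hinjT := LinearMap.injective_iff_surjective.2 hsurT
    refine hv (hinjT ?_)
    simp [hTv]
  have hiso := inner_map_map_of_expanding hexp heig
  constructor
  · ext x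
    have h1 := hiso (R.rangeRestrict x) (R.rangeRestrict x)
    rw [hT, inner_self_eq_norm_sq_to_K, inner_self_eq_norm_sq_to_K] at h1
    have h2 : ‖R (A x)‖ ^ 2 = ‖R x‖ ^ 2 := by exact_mod_cast h1
    have h3 := h x
    have : ‖L x‖ ^ 2 = 0 := by linarith
    exact norm_eq_zero.1 (pow_eq_zero_iff two_ne_zero |>.1 this)
  · intro hR
    have : Nontrivial (LinearMap.range R) :=
      Submodule.nontrivial_iff_ne_bot.2 fun h0 => hR (LinearMap.range_eq_bot.1 h0)
    obtain ⟨μ, hev⟩ := Module.End.exists_eigenvalue T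
    obtain ⟨v, hv⟩ := hev.exists_hasEigenvector
    have hTv : T v = μ • v := hv.apply_eq_smul
    have hv0 : ‖v‖ ≠ 0 := norm_ne_zero_iff.2 hv.2
    have hμ : ‖μ‖ = 1 := by
      refine le_antisymm (heig μ v hv.2 hTv) ?_
      have := hexp v
      rw [hTv, norm_smul] at this
      have hp : 0 < ‖v‖ := norm_pos_iff.2 hv.2
      exact le_of_mul_le_mul_right (by linarith) hp
    have hconj : μ * (starRingEnd ℂ) μ = 1 := by
      rw [Complex.mul_conj, Complex.normSq_eq_norm_sq, hμ]; norm_num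
    -- For an isometry, an eigenvector with eigenvalue of modulus 1 is also a left eigenvector: ⟨v,
    -- Ty⟩ = μ⟨v, y⟩.
    refine ⟨μ, (innerSL ℂ v).toLinearMap ∘ₗ R.rangeRestrict, hμ, ?_, ?_, ?_⟩
    · intro h0
      obtain ⟨x, hx⟩ := R.surjective_rangeRestrict v
      have := LinearMap.congr_fun h0 x
      simp only [LinearMap.comp_apply, hx, LinearMap.zero_apply] at this
      exact hv.2 (inner_self_eq_zero.1 this)
    · intro x
      have h1 := hiso v (R.rangeRestrict x)
      rw [hT, hTv, inner_smul_left] at h1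
      change ⟪v, R.rangeRestrict (A x)⟫_ℂ = μ * ⟪v, R.rangeRestrict x⟫_ℂ
      rw [← h1, ← mul_assoc, hconj, one_mul]
    · intro x hx
      have : R.rangeRestrict x = 0 := Subtype.ext hx
      simp [this]

end Expanding

/-! ### Low gain feedback under a delay -/

section LowGain

open scoped InnerProductSpace

variable {E U : Type*} [NormedAddCommGroup E] [InnerProductSpace ℂ E] [NormedAddCommGroup U]
  [InnerProductSpace ℂ U]

/-- Prediction error. On a mode growing like zᵗ, the vector z⁻ˢη is the state `s` steps earlier and
`A ^ s` carries it forward without input. The difference is the effect of the inputs in between, and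
these are no larger than `u` because 1 ≤ ‖z‖. -/
theorem norm_sub_inv_pow_smul_le {A : E →L[ℂ] E} {B : U →L[ℂ] E} {z c : ℂ} {R : ℝ}
    (hz : 1 ≤ ‖z‖) (hc : ‖c‖ ≤ R) {η : E} {u : U} (h : z • η = A η + c • B u) (s : ℕ) :
    ‖η - (z⁻¹) ^ s • (A ^ s) η‖ ≤ R * (∑ j ∈ Finset.range s, ‖(A ^ j) ∘L B‖) * ‖u‖ := by
  have hz0 : z ≠ 0 := fun h0 => by rw [h0, norm_zero] at hz; linarith
  have hzi : ‖z⁻¹‖ ≤ 1 := by rw [norm_inv]; exact inv_le_one_of_one_le₀ hz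
  have hR : 0 ≤ R := (norm_nonneg c).trans hc
  have h1 : η - z⁻¹ • A η = z⁻¹ • c • B u := by
    rw [← smul_right_injective E hz0 |>.eq_iff]
    simp only [smul_sub, smul_inv_smul₀ hz0, h]
    abel
  induction s with
  | zero => simp
  | succ s ih =>
    have e : η - (z⁻¹) ^ (s + 1) • (A ^ (s + 1)) η =
        (η - (z⁻¹) ^ s • (A ^ s) η) + (z⁻¹) ^ s • (A ^ s) (z⁻¹ • c • B u) := by
      rw [← h1, map_sub, map_smul, smul_sub, smul_smul, ← pow_succ, pow_succ A,
        mul_apply_eq_comp]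
      abel
    have h2 : ‖(z⁻¹) ^ s • (A ^ s) (z⁻¹ • c • B u)‖ ≤ R * ‖(A ^ s) ∘L B‖ * ‖u‖ := by
      rw [map_smul, map_smul, norm_smul, norm_smul, norm_smul, norm_pow]
      have h3 : ‖(A ^ s) (B u)‖ ≤ ‖(A ^ s) ∘L B‖ * ‖u‖ := ((A ^ s) ∘L B).le_opNorm u
      calc ‖z⁻¹‖ ^ s * (‖z⁻¹‖ * (‖c‖ * ‖(A ^ s) (B u)‖))
          ≤ 1 * (1 * (R * (‖(A ^ s) ∘L B‖ * ‖u‖))) := by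
            gcongr
            exact pow_le_one₀ (norm_nonneg _) hzi
        _ = _ := by ring
    rw [e, Finset.sum_range_succ]
    calc _ ≤ _ := norm_add_le _ _
      _ ≤ _ := add_le_add ih h2
      _ = _ := by ring

/-- The predictor-type low gain `-r⁻¹ F A ^ d`, where `F = B† P A` for a small solution `P` of a
Riccati inequality, leaves no characteristic root outside the open unit disc. -/
theorem eq_zero_of_lowGain {A P : E →L[ℂ] E} {B : U →L[ℂ] E} {F : E →L[ℂ] U}
    (hF : ∀ x u, ⟪F x, u⟫_ℂ = ⟪P (A x), B u⟫_ℂ) (hP : ∀ x y, ⟪P x, y⟫_ℂ = ⟪x, P y⟫_ℂ)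
    (hP0 : ∀ x, 0 ≤ (⟪P x, x⟫_ℂ).re)
    (hric : ∀ x, x ≠ 0 → (⟪P (A x), A x⟫_ℂ).re - ‖F x‖ ^ 2 < (⟪P x, x⟫_ℂ).re)
    {r R τ : ℝ} {d : ℕ} (hr : 0 < r)
    (hFτ : r⁻¹ * ‖F‖ * (R * ∑ j ∈ Finset.range d, ‖(A ^ j) ∘L B‖) ≤ τ)
    (hsmall : r ^ 2 * (1 + τ) ^ 2 + 2 * r * (R * τ) + R ^ 2 * (‖B‖ ^ 2 * ‖P‖) ≤ 2 * r ^ 2)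
    {z c : ℂ} (hz : 1 ≤ ‖z‖) (hcr : r ≤ c.re) (hcR : ‖c‖ ≤ R) {η : E}
    (h : z ^ (d + 1) • η = z ^ d • A η - (c * (r⁻¹ : ℝ)) • B (F ((A ^ d) η))) : η = 0 := by
  by_contra hη
  have hz0 : z ≠ 0 := fun h0 => by rw [h0, norm_zero] at hz; linarith
  have hR : 0 ≤ R := (norm_nonneg c).trans hcR
  -- The input that the mode receives after the delay: dividing the equation by z^d leaves zη = Aη +
  -- cBu.
  set u : U := -(((r⁻¹ : ℝ) : ℂ) • F ((z⁻¹) ^ d • (A ^ d) η)) with hu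
  have hdyn : z • η = A η + c • B u := by
    have hzd : z ^ d ≠ 0 := pow_ne_zero _ hz0
    rw [← smul_right_injective E hzd |>.eq_iff]
    simp only [smul_add, hu, map_neg, map_smul, smul_neg, smul_smul]
    rw [← pow_succ, h, sub_eq_add_neg]
    congr 3
    rw [inv_pow]
    field_simp
  -- The deviation of `u` from the undelayed feedback -r⁻¹Fη. It is the feedback of the prediction
  -- error, small because `F` is.
  set θ : U := u + ((r⁻¹ : ℝ) : ℂ) • F η with hθdef
  have hθ : ‖θ‖ ≤ τ * ‖u‖ := by
    have e : θ = ((r⁻¹ : ℝ) : ℂ) • F (η - (z⁻¹) ^ d • (A ^ d) η) := by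
      rw [hθdef, hu, map_sub, smul_sub]
      abel
    have h1 := norm_sub_inv_pow_smul_le hz hcR hdyn d
    rw [e, norm_smul, Complex.norm_real, Real.norm_of_nonneg (by positivity)]
    calc r⁻¹ * ‖F (η - (z⁻¹) ^ d • (A ^ d) η)‖
        ≤ r⁻¹ * (‖F‖ * (R * (∑ j ∈ Finset.range d, ‖(A ^ j) ∘L B‖) * ‖u‖)) := by
          gcongr
          exact F.le_opNorm_of_le h1
      _ = r⁻¹ * ‖F‖ * (R * ∑ j ∈ Finset.range d, ‖(A ^ j) ∘L B‖) * ‖u‖ := by ring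
      _ ≤ _ := by gcongr
  have hFη : F η = (r : ℂ) • (θ - u) := by
    rw [hθdef, add_sub_cancel_left, smul_smul]
    rw [← Complex.ofReal_mul, mul_inv_cancel₀ hr.ne', Complex.ofReal_one, one_smul]
  have hFn : ‖F η‖ ≤ r * ((1 + τ) * ‖u‖) := by
    rw [hFη, norm_smul, Complex.norm_real, Real.norm_of_nonneg hr.le]
    gcongr
    calc ‖θ - u‖ ≤ ‖θ‖ + ‖u‖ := norm_sub_le _ _
      _ ≤ _ := by linarith
  have hcross : (c * ⟪F η, u⟫_ℂ).re ≤ r * (R * τ * ‖u‖ ^ 2 - r * ‖u‖ ^ 2) := by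
    rw [hFη, inner_smul_left, Complex.conj_ofReal, inner_sub_left, inner_self_eq_norm_sq_to_K]
    have e : c * ((r : ℂ) * (⟪θ, u⟫_ℂ - (‖u‖ : ℂ) ^ 2)) =
        (r : ℂ) * (c * ⟪θ, u⟫_ℂ - ((‖u‖ ^ 2 : ℝ) : ℂ) * c) := by
      push_cast; ring
    erw [e]
    rw [Complex.re_ofReal_mul, Complex.sub_re, Complex.re_ofReal_mul]
    refine mul_le_mul_of_nonneg_left (sub_le_sub ?_ ?_) hr.le
    · calc (c * ⟪θ, u⟫_ℂ).re ≤ ‖c * ⟪θ, u⟫_ℂ‖ := Complex.re_le_norm _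
        _ = ‖c‖ * ‖⟪θ, u⟫_ℂ‖ := norm_mul _ _
        _ ≤ R * (τ * ‖u‖ * ‖u‖) := by
          gcongr
          exact (norm_inner_le_norm _ _).trans (by gcongr)
        _ = _ := by ring
    · rw [mul_comm]; gcongr
  have hBu : (⟪P (B u), B u⟫_ℂ).re ≤ ‖B‖ ^ 2 * ‖P‖ * ‖u‖ ^ 2 := by
    calc (⟪P (B u), B u⟫_ℂ).re ≤ ‖⟪P (B u), B u⟫_ℂ‖ := Complex.re_le_norm _
      _ ≤ ‖P (B u)‖ * ‖B u‖ := norm_inner_le_norm _ _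
      _ ≤ (‖P‖ * (‖B‖ * ‖u‖)) * (‖B‖ * ‖u‖) := by
        gcongr
        · exact P.le_opNorm_of_le (B.le_opNorm u)
        · exact B.le_opNorm u
      _ = _ := by ring
  -- The Lyapunov function ⟨Pη, η⟩ on both sides of zη = Aη + cBu; the cross term is expressed
  -- through `F` by `hF`.
  have hexp : ‖z‖ ^ 2 * (⟪P η, η⟫_ℂ).re = (⟪P (A η), A η⟫_ℂ).re + 2 * (c * ⟪F η, u⟫_ℂ).re +
      ‖c‖ ^ 2 * (⟪P (B u), B u⟫_ℂ).re := by
    have h1 : ⟪P (z • η), z • η⟫_ℂ = ((‖z‖ ^ 2 : ℝ) : ℂ) * ⟪P η, η⟫_ℂ := by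
      rw [map_smul, inner_smul_left, inner_smul_right, ← mul_assoc, mul_comm _ z,
        Complex.mul_conj, Complex.normSq_eq_norm_sq]
    have h2 : ⟪P (c • B u), A η⟫_ℂ = (starRingEnd ℂ) (c * ⟪F η, u⟫_ℂ) := by
      rw [hF, hP, ← inner_conj_symm, inner_smul_right]
    have h3 : ⟪P (c • B u), c • B u⟫_ℂ = ((‖c‖ ^ 2 : ℝ) : ℂ) * ⟪P (B u), B u⟫_ℂ := by
      rw [map_smul, inner_smul_left, inner_smul_right, ← mul_assoc, mul_comm _ c,
        Complex.mul_conj, Complex.normSq_eq_norm_sq]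
    have h4 := congrArg Complex.re h1
    rw [Complex.re_ofReal_mul] at h4
    rw [← h4, hdyn, map_add, inner_add_left, inner_add_right, inner_add_right, h2, h3,
      inner_smul_right, ← hF]
    simp only [Complex.add_re, Complex.conj_re, Complex.re_ofReal_mul]
    ring
  have hV : (⟪P η, η⟫_ℂ).re ≤ ‖z‖ ^ 2 * (⟪P η, η⟫_ℂ).re :=
    le_mul_of_one_le_left (hP0 η) (one_le_pow₀ hz)
  have hF2 : ‖F η‖ ^ 2 ≤ r ^ 2 * (1 + τ) ^ 2 * ‖u‖ ^ 2 := by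
    calc ‖F η‖ ^ 2 ≤ (r * ((1 + τ) * ‖u‖)) ^ 2 := by gcongr
      _ = _ := by ring
  have hlast : ‖c‖ ^ 2 * (⟪P (B u), B u⟫_ℂ).re ≤ R ^ 2 * (‖B‖ ^ 2 * ‖P‖ * ‖u‖ ^ 2) := by
    gcongr
    exact hP0 _
  -- If η ≠ 0, the strict Riccati inequality gives 0 < ‖Fη‖² + 2 re(c⟨Fη, u⟩) + ‖c‖²⟨PBu, Bu⟩. By
  -- the bounds above the right side is at most (r²(1+τ)² + 2rRτ - 2r² + R²‖B‖²‖P‖)‖u‖², which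
  -- `hsmall` makes nonpositive.
  have hfin := mul_le_mul_of_nonneg_right hsmall (sq_nonneg ‖u‖)
  have := hric η hη
  nlinarith

/-- Here `a * b * ε` stands for the bound ‖A‖‖B‖ε on ‖F‖. As ε → 0 with τ equal to its lower bound,
the left side of the last inequality tends to r² < 2r². -/
theorem exists_pos_lowGain_bound (a b S r R : ℝ) (ha : 0 ≤ a) (hb : 0 ≤ b) (hS : 0 ≤ S)
    (hr : 0 < r) (hR : 0 ≤ R) : ∃ ε > 0, ∃ τ ≥ 0, r⁻¹ * (a * b * ε) * (R * S) ≤ τ ∧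
      r ^ 2 * (1 + τ) ^ 2 + 2 * r * (R * τ) + R ^ 2 * (b ^ 2 * ε) ≤ 2 * r ^ 2 := by
  have hlim : Filter.Tendsto (fun ε : ℝ =>
      r ^ 2 * (1 + r⁻¹ * (a * b * ε) * (R * S)) ^ 2 +
        2 * r * (R * (r⁻¹ * (a * b * ε) * (R * S))) + R ^ 2 * (b ^ 2 * ε)) (𝓝[>] 0)
      (𝓝 (r ^ 2)) := by
    have hc : Continuous (fun ε : ℝ =>
      r ^ 2 * (1 + r⁻¹ * (a * b * ε) * (R * S)) ^ 2 +
        2 * r * (R * (r⁻¹ * (a * b * ε) * (R * S))) + R ^ 2 * (b ^ 2 * ε)) := by fun_prop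
    have := hc.tendsto 0
    simp only [mul_zero, zero_mul, add_zero, one_pow, mul_one] at this
    exact this.mono_left nhdsWithin_le_nhds
  have hev := hlim.eventually (ge_mem_nhds (show r ^ 2 < 2 * r ^ 2 by nlinarith [sq_pos_of_pos hr]))
  obtain ⟨ε, h1, h2⟩ := (hev.and self_mem_nhdsWithin).exists
  have hε : (0 : ℝ) < ε := h2
  exact ⟨ε, hε, _, by positivity, le_rfl, h1⟩

end LowGain

/-! ### Real matrices acting on complex Euclidean spaces -/

section Complexification

set_option linter.unusedSectionVars false

open scoped Matrix InnerProductSpace MatrixOrder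

variable {ι κ ν : Type*} [Fintype ι] [Fintype κ] [Fintype ν] [DecidableEq ι] [DecidableEq κ]
  [DecidableEq ν]

/-- The complexification of a real matrix, as an operator between Euclidean spaces. -/
noncomputable def complexOp (M : Matrix ι κ ℝ) : EuclideanSpace ℂ κ →L[ℂ] EuclideanSpace ℂ ι :=
  LinearMap.toContinuousLinearMap (Matrix.toEuclideanLin (M.map Complex.ofReal))

theorem complexOp_apply (M : Matrix ι κ ℝ) (x : EuclideanSpace ℂ κ) :
    complexOp M x = WithLp.toLp 2 (M.map Complex.ofReal *ᵥ x.ofLp) := rfl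

theorem complexOp_mul (M : Matrix ι κ ℝ) (M' : Matrix κ ν ℝ) (x : EuclideanSpace ℂ ν) :
    complexOp (M * M') x = complexOp M (complexOp M' x) := by
  have : (M * M').map Complex.ofReal = M.map Complex.ofReal * M'.map Complex.ofReal :=
    Matrix.map_mul (f := Complex.ofRealHom)
  simp only [complexOp_apply, this, Matrix.mulVec_mulVec]

theorem complexOp_add (M M' : Matrix ι κ ℝ) (x : EuclideanSpace ℂ κ) :
    complexOp (M + M') x = complexOp M x + complexOp M' x := by
  have : (M + M').map Complex.ofReal = M.map Complex.ofReal + M'.map Complex.ofReal :=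
    Matrix.map_add _ Complex.ofReal_add _ _
  simp only [complexOp_apply, this, Matrix.add_mulVec, WithLp.toLp_add]

theorem complexOp_sub (M M' : Matrix ι κ ℝ) (x : EuclideanSpace ℂ κ) :
    complexOp (M - M') x = complexOp M x - complexOp M' x := by
  have : (M - M').map Complex.ofReal = M.map Complex.ofReal - M'.map Complex.ofReal :=
    Matrix.map_sub _ Complex.ofReal_sub _ _
  simp only [complexOp_apply, this, Matrix.sub_mulVec, WithLp.toLp_sub]

theorem complexOp_smul (r : ℝ) (M : Matrix ι κ ℝ) (x : EuclideanSpace ℂ κ) :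
    complexOp (r • M) x = (r : ℂ) • complexOp M x := by
  have : (r • M).map Complex.ofReal = (r : ℂ) • M.map Complex.ofReal := by
    ext i j; simp
  simp only [complexOp_apply, this, Matrix.smul_mulVec, WithLp.toLp_smul]

theorem complexOp_one (x : EuclideanSpace ℂ κ) : complexOp (1 : Matrix κ κ ℝ) x = x := by
  have : (1 : Matrix κ κ ℝ).map Complex.ofReal = 1 :=
    Matrix.map_one _ Complex.ofReal_zero Complex.ofReal_one
  rw [complexOp_apply, this, Matrix.one_mulVec]

theorem complexOp_pow (M : Matrix ι ι ℝ) (d : ℕ) (x : EuclideanSpace ℂ ι) :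
    complexOp (M ^ d) x = (complexOp M ^ d) x := by
  induction d with
  | zero => simp [complexOp_one]
  | succ d ih => rw [pow_succ', pow_succ', complexOp_mul, ih, mul_apply_eq_comp]

theorem inner_complexOp_transpose (M : Matrix ι κ ℝ) (x : EuclideanSpace ℂ ι)
    (y : EuclideanSpace ℂ κ) : ⟪complexOp Mᵀ x, y⟫_ℂ = ⟪x, complexOp M y⟫_ℂ := by
  have h : (Mᵀ).map Complex.ofReal = (M.map Complex.ofReal)ᴴ := by
    ext i j; simp
  have : complexOp Mᵀ x = LinearMap.adjoint (Matrix.toEuclideanLin (M.map Complex.ofReal)) x := by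
    rw [← Matrix.toEuclideanLin_conjTranspose_eq_adjoint, ← h]; rfl
  rw [this, LinearMap.adjoint_inner_left]
  rfl

theorem complexOp_eq_zero {M : Matrix ι κ ℝ} (h : ∀ x, complexOp M x = 0) : M = 0 := by
  ext i j
  have := congrFun (congrArg WithLp.ofLp (h (WithLp.toLp 2 (Pi.single j 1)))) i
  simpa [complexOp_apply] using this

theorem exists_eq_transpose_mul_self {M : Matrix ι ι ℝ} (hM : M.PosSemidef) :
    ∃ R : Matrix ι ι ℝ, M = Rᵀ * R := by
  obtain ⟨R, rfl⟩ := CStarAlgebra.nonneg_iff_eq_star_mul_self.mp hM.nonneg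
  exact ⟨R, rfl⟩

theorem inner_complexOp_transpose_mul_self (R : Matrix ι κ ℝ) (x : EuclideanSpace ℂ κ) :
    ⟪complexOp (Rᵀ * R) x, x⟫_ℂ = ((‖complexOp R x‖ ^ 2 : ℝ) : ℂ) := by
  rw [complexOp_mul, inner_complexOp_transpose, inner_self_eq_norm_sq_to_K]
  norm_cast

theorem re_inner_complexOp_nonneg {M : Matrix ι ι ℝ} (hM : M.PosSemidef)
    (x : EuclideanSpace ℂ ι) : 0 ≤ (⟪complexOp M x, x⟫_ℂ).re := by
  obtain ⟨R, rfl⟩ := exists_eq_transpose_mul_self hM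
  rw [inner_complexOp_transpose_mul_self, Complex.ofReal_re]
  positivity

theorem re_inner_complexOp_pos {M : Matrix ι ι ℝ} (hM : M.PosDef)
    {x : EuclideanSpace ℂ ι} (hx : x ≠ 0) : 0 < (⟪complexOp M x, x⟫_ℂ).re := by
  obtain ⟨R, hR⟩ := exists_eq_transpose_mul_self hM.posSemidef
  have e : ⟪complexOp M x, x⟫_ℂ = ((‖complexOp R x‖ ^ 2 : ℝ) : ℂ) := by
    rw [hR, inner_complexOp_transpose_mul_self]
  rw [e, Complex.ofReal_re]
  refine pow_pos (norm_pos_iff.2 fun h0 => hx ?_) 2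
  rw [← complexOp_one x, ← Matrix.nonsing_inv_mul M ((Matrix.isUnit_iff_isUnit_det _).1 hM.isUnit),
    complexOp_mul, hR, complexOp_mul, h0, map_zero, map_zero]

/-- `A` has its eigenvalues in the closed unit disc and `B` reaches its modes on the unit
circle. -/
structure IsCriticallyStabilizable (A : Matrix ι ι ℝ) (B : Matrix ι κ ℝ) : Prop where
  norm_le_one : ∀ (μ : ℂ) (x : EuclideanSpace ℂ ι), x ≠ 0 → complexOp A x = μ • x → ‖μ‖ ≤ 1
  eq_zero : ∀ (μ : ℂ) (w : EuclideanSpace ℂ ι →ₗ[ℂ] ℂ), ‖μ‖ = 1 →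
    (∀ x, w (complexOp A x) = μ * w x) → (∀ u, w (complexOp B u) = 0) → w = 0

/-- The dual alternative is impossible. With Z = RᵀR and AᵀZA - Z = LᵀL, the map `A` expands the
seminorm ‖R·‖ with defect ‖L·‖, so L = 0. The trace inequality then gives RB = 0, and the left
eigenvector that vanishes on ker R kills `B`. -/
theorem IsCriticallyStabilizable.exists_lyapunov {A : Matrix ι ι ℝ} {B : Matrix ι κ ℝ}
    (h : IsCriticallyStabilizable A B) (c : ℝ) :
    ∃ W : Matrix ι ι ℝ, Wᵀ = W ∧ (∀ x : ι → ℝ, c * (x ⬝ᵥ x) ≤ x ⬝ᵥ W.mulVec x) ∧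
      (W + B * Bᵀ - A * W * Aᵀ).PosDef := by
  refine (exists_lyapunov_or_dual A B c).resolve_right ?_
  rintro ⟨Z, hZ0, hZ, hAZ, htr⟩
  obtain ⟨R, rfl⟩ := exists_eq_transpose_mul_self hZ
  obtain ⟨L, hL⟩ := exists_eq_transpose_mul_self hAZ
  have hnorm : ∀ x, ‖complexOp R (complexOp A x)‖ ^ 2 = ‖complexOp R x‖ ^ 2 +
      ‖complexOp L x‖ ^ 2 := by
    intro x
    have e : (R * A)ᵀ * (R * A) = Rᵀ * R + Lᵀ * L := by
      rw [← hL, Matrix.transpose_mul]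
      simp only [Matrix.mul_assoc]
      abel
    have h1 := congrArg (fun M => ⟪complexOp M x, x⟫_ℂ) e
    simp only [complexOp_add, inner_add_left, inner_complexOp_transpose_mul_self] at h1
    rw [complexOp_mul] at h1
    exact_mod_cast h1
  obtain ⟨hL0, hw⟩ := eq_zero_and_exists_left_eigenvector (complexOp R).toLinearMap
    (complexOp L).toLinearMap (complexOp A).toLinearMap hnorm h.norm_le_one
  have hL1 : L = 0 := complexOp_eq_zero fun x => LinearMap.congr_fun hL0 x
  rw [hL, hL1, Matrix.mul_zero, Matrix.trace_zero, mul_zero] at htr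
  have hRB : R * B = 0 := by
    have e : Bᵀ * (Rᵀ * R) * B = (R * B)ᴴ * (R * B) := by
      rw [Matrix.conjTranspose_eq_transpose_of_trivial, Matrix.transpose_mul]
      simp only [Matrix.mul_assoc]
    rw [e] at htr
    exact Matrix.trace_conjTranspose_mul_self_eq_zero_iff.1
      (le_antisymm htr (Matrix.posSemidef_conjTranspose_mul_self _).trace_nonneg)
  have hR0 : (complexOp R).toLinearMap ≠ 0 := by
    intro h0
    apply hZ0
    rw [complexOp_eq_zero fun x => LinearMap.congr_fun h0 x, Matrix.mul_zero]
  obtain ⟨μ, w, hμ, hw0, hwA, hwR⟩ := hw hR0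
  refine hw0 (h.eq_zero μ w hμ hwA fun u => hwR _ ?_)
  change complexOp R (complexOp B u) = 0
  rw [← complexOp_mul, hRB]
  have := complexOp_smul 0 (0 : Matrix ι κ ℝ) u
  simpa using this

/-- P = W⁻¹ with W ≥ ε⁻¹, so `P` is at most ε. The Riccati inequality at x is the sum of W + BBᵀ >
AWAᵀ at b = PAx and the nonnegative form `P` at x - WAᵀb. The case b = 0, where the first loses its
strictness, uses positivity of `P`. -/
theorem IsCriticallyStabilizable.exists_riccati {A : Matrix ι ι ℝ} {B : Matrix ι κ ℝ}
    (h : IsCriticallyStabilizable A B) {ε : ℝ} (hε : 0 < ε) :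
    ∃ P : Matrix ι ι ℝ, Pᵀ = P ∧ (∀ x, 0 ≤ (⟪complexOp P x, x⟫_ℂ).re) ∧ ‖complexOp P‖ ≤ ε ∧
      ∀ x, x ≠ 0 → (⟪complexOp P (complexOp A x), complexOp A x⟫_ℂ).re -
        ‖complexOp (Bᵀ * P * A) x‖ ^ 2 < (⟪complexOp P x, x⟫_ℂ).re := by
  obtain ⟨W, hWt, hWc, hWB⟩ := h.exists_lyapunov ε⁻¹
  have hWpd : W.PosDef := by
    refine Matrix.PosDef.of_dotProduct_mulVec_pos hWt fun x hx => ?_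
    rw [star_trivial]
    refine lt_of_lt_of_le (mul_pos (inv_pos.2 hε) ?_) (hWc x)
    exact lt_of_le_of_ne (Finset.sum_nonneg fun i _ => mul_self_nonneg _)
      fun h0 => hx (dotProduct_self_eq_zero.1 h0.symm)
  have hWsub : (W - ε⁻¹ • (1 : Matrix ι ι ℝ)).PosSemidef := by
    refine Matrix.PosSemidef.of_dotProduct_mulVec_nonneg ?_ fun x => ?_
    · rw [Matrix.IsHermitian, Matrix.conjTranspose_eq_transpose_of_trivial, Matrix.transpose_sub,
        Matrix.transpose_smul, Matrix.transpose_one, hWt]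
    · rw [star_trivial, Matrix.sub_mulVec, dotProduct_sub, Matrix.smul_mulVec, Matrix.one_mulVec,
        dotProduct_smul, smul_eq_mul]
      linarith [hWc x]
  have hdet := (Matrix.isUnit_iff_isUnit_det _).1 hWpd.isUnit
  have hPt : (W⁻¹)ᵀ = W⁻¹ := by rw [Matrix.transpose_nonsing_inv, hWt]
  have hPW : ∀ x, complexOp W⁻¹ (complexOp W x) = x := fun x => by
    rw [← complexOp_mul, Matrix.nonsing_inv_mul _ hdet, complexOp_one]
  have hWP : ∀ x, complexOp W (complexOp W⁻¹ x) = x := fun x => by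
    rw [← complexOp_mul, Matrix.mul_nonsing_inv _ hdet, complexOp_one]
  refine ⟨W⁻¹, hPt, re_inner_complexOp_nonneg hWpd.inv.posSemidef, ?_, ?_⟩
  · refine ContinuousLinearMap.opNorm_le_bound _ hε.le fun x => ?_
    set y := complexOp W⁻¹ x
    have h1 := re_inner_complexOp_nonneg hWsub y
    rw [complexOp_sub, complexOp_smul, complexOp_one, hWP, inner_sub_left, inner_smul_left,
      Complex.conj_ofReal, inner_self_eq_norm_sq_to_K, Complex.sub_re] at h1
    erw [Complex.re_ofReal_mul] at h1
    have h2 : (((‖y‖ : ℂ)) ^ 2).re = ‖y‖ ^ 2 := by norm_cast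
    erw [h2] at h1
    have h3 : (⟪x, y⟫_ℂ).re ≤ ‖x‖ * ‖y‖ := (Complex.re_le_norm _).trans (norm_inner_le_norm _ _)
    rcases (norm_nonneg y).eq_or_lt with h0 | h0
    · rw [← h0]; positivity
    · have h4 : ε⁻¹ * ‖y‖ * ‖y‖ ≤ ‖x‖ * ‖y‖ := by nlinarith
      have h5 := le_of_mul_le_mul_right h4 h0
      rwa [inv_mul_le_iff₀ hε] at h5
  · intro x hx
    set b := complexOp W⁻¹ (complexOp A x) with hb
    have hWb : complexOp W b = complexOp A x := hWP _
    have hF : complexOp (Bᵀ * W⁻¹ * A) x = complexOp Bᵀ b := by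
      rw [complexOp_mul, complexOp_mul]
    rw [hF]
    by_cases hb0 : b = 0
    · rw [hb0, inner_zero_left, map_zero, norm_zero]
      simpa using re_inner_complexOp_pos hWpd.inv hx
    · have h1 := re_inner_complexOp_nonneg hWpd.inv.posSemidef
        (x - complexOp W (complexOp Aᵀ b))
      have h2 := re_inner_complexOp_pos hWB hb0
      have e1 : ⟪complexOp Aᵀ b, x⟫_ℂ = ⟪b, complexOp A x⟫_ℂ := inner_complexOp_transpose _ _ _
      have e2 : ⟪complexOp W⁻¹ x, complexOp W (complexOp Aᵀ b)⟫_ℂ =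
          (starRingEnd ℂ) ⟪b, complexOp A x⟫_ℂ := by
        have e3 := inner_complexOp_transpose W (complexOp W⁻¹ x) (complexOp Aᵀ b)
        rw [hWt, hWP] at e3
        rw [← e3, ← e1, inner_conj_symm]
      have e4 : ⟪complexOp (A * W * Aᵀ) b, b⟫_ℂ =
          ⟪complexOp W (complexOp Aᵀ b), complexOp Aᵀ b⟫_ℂ := by
        have := inner_complexOp_transpose Aᵀ (complexOp W (complexOp Aᵀ b)) b
        rw [Matrix.transpose_transpose] at this
        rw [complexOp_mul, complexOp_mul, this]
      have e5 : ⟪complexOp (B * Bᵀ) b, b⟫_ℂ = ((‖complexOp Bᵀ b‖ ^ 2 : ℝ) : ℂ) := by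
        have := inner_complexOp_transpose_mul_self Bᵀ b
        rwa [Matrix.transpose_transpose] at this
      have e6 : ⟪complexOp Aᵀ b, complexOp W (complexOp Aᵀ b)⟫_ℂ =
          ⟪complexOp W (complexOp Aᵀ b), complexOp Aᵀ b⟫_ℂ := by
        have := inner_complexOp_transpose W (complexOp Aᵀ b) (complexOp Aᵀ b)
        rw [hWt] at this
        exact this.symm
      have e7 : (⟪complexOp A x, b⟫_ℂ).re = (⟪b, complexOp A x⟫_ℂ).re := by
        rw [← inner_conj_symm, Complex.conj_re]
      rw [map_sub, hPW, inner_sub_left, inner_sub_right, inner_sub_right, e1, e2, e6] at h1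
      rw [complexOp_sub, complexOp_add, inner_sub_left, inner_add_left, e4, e5, hWb] at h2
      simp only [Complex.sub_re, Complex.add_re, Complex.conj_re, Complex.ofReal_re] at h1 h2
      linarith

/-- A critically stabilizable pair admits a gain that, under a delay of `d` steps, leaves no
characteristic root outside the open unit disc for any scaling `c` with `r ≤ re c`, `‖c‖ ≤ R`. -/
theorem IsCriticallyStabilizable.exists_gain {A : Matrix ι ι ℝ} {B : Matrix ι κ ℝ}
    (h : IsCriticallyStabilizable A B) (d : ℕ) {r R : ℝ} (hr : 0 < r) (hR : 0 ≤ R) :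
    ∃ K : Matrix κ ι ℝ, ∀ z c : ℂ, 1 ≤ ‖z‖ → r ≤ c.re → ‖c‖ ≤ R → ∀ η : ι → ℂ,
      z ^ (d + 1) • η = z ^ d • (A.map Complex.ofReal *ᵥ η) +
        c • ((B * K).map Complex.ofReal *ᵥ η) → η = 0 := by
  obtain ⟨ε, hε, τ, -, h1, h2⟩ := exists_pos_lowGain_bound ‖complexOp A‖ ‖complexOp B‖
    (∑ j ∈ Finset.range d, ‖(complexOp A ^ j) ∘L complexOp B‖) r R (norm_nonneg _) (norm_nonneg _)
    (Finset.sum_nonneg fun _ _ => norm_nonneg _) hr hR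
  obtain ⟨P, hPt, hP0, hPε, hric⟩ := h.exists_riccati hε
  have hF : ∀ x u, ⟪complexOp (Bᵀ * P * A) x, u⟫_ℂ =
      ⟪complexOp P (complexOp A x), complexOp B u⟫_ℂ := fun x u => by
    rw [complexOp_mul, complexOp_mul, inner_complexOp_transpose]
  have hFn : ‖complexOp (Bᵀ * P * A)‖ ≤ ‖complexOp A‖ * ‖complexOp B‖ * ε := by
    refine ContinuousLinearMap.opNorm_le_bound _ (by positivity) fun x => ?_
    have h3 := hF x (complexOp (Bᵀ * P * A) x)
    set y := complexOp (Bᵀ * P * A) x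
    rcases (norm_nonneg y).eq_or_lt with h0 | h0
    · rw [← h0]; positivity
    · have h4 : ‖y‖ * ‖y‖ ≤ (‖complexOp A‖ * ‖complexOp B‖ * ε * ‖x‖) * ‖y‖ := by
        have h5 : ‖y‖ * ‖y‖ = ‖⟪y, y⟫_ℂ‖ := by
          rw [inner_self_eq_norm_sq_to_K]
          simp [sq]
        rw [h5, h3]
        calc _ ≤ ‖complexOp P (complexOp A x)‖ * ‖complexOp B y‖ := norm_inner_le_norm _ _
          _ ≤ (ε * (‖complexOp A‖ * ‖x‖)) * (‖complexOp B‖ * ‖y‖) := by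
            gcongr
            · exact (ContinuousLinearMap.le_opNorm_of_le _ (ContinuousLinearMap.le_opNorm _ x)).trans
                (by gcongr)
            · exact ContinuousLinearMap.le_opNorm _ y
          _ = _ := by ring
      exact le_of_mul_le_mul_right h4 h0
  refine ⟨(-r⁻¹) • (Bᵀ * P * A * A ^ d), fun z c hz hcr hcR η hη => ?_⟩
  have key := eq_zero_of_lowGain (A := complexOp A) (P := complexOp P) (B := complexOp B)
    (F := complexOp (Bᵀ * P * A)) (r := r) (R := R) (τ := τ) (d := d) (z := z) (c := c)
    (η := WithLp.toLp 2 η) hF ?_ hP0 hric hr ?_ ?_ hz hcr hcR ?_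
  · exact congrArg WithLp.ofLp key
  · intro x y
    have := inner_complexOp_transpose P x y
    rwa [hPt] at this
  · refine le_trans ?_ h1
    gcongr
  · refine le_trans ?_ h2
    gcongr
  · have h5 := congrArg (WithLp.toLp 2) hη
    rw [WithLp.toLp_add, WithLp.toLp_smul, WithLp.toLp_smul, WithLp.toLp_smul] at h5
    rw [h5]
    change z ^ d • complexOp A _ + c • complexOp (B * _) (WithLp.toLp 2 η) = _
    rw [complexOp_mul, complexOp_smul, complexOp_mul, complexOp_pow, sub_eq_add_neg]
    congr 1
    rw [map_smul, smul_smul, ← neg_smul]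
    congr 1
    push_cast
    ring

end Complexification

/-! ### Exponential stability of linear delay systems -/

section Delay

set_option linter.unusedSectionVars false

open scoped Matrix Matrix.Norms.Operator

theorem exists_norm_pow_le {𝓐 : Type*} [NormedRing 𝓐] {a : 𝓐} {T : ℕ} (hT : 0 < T)
    (h : ‖a ^ T‖ < 1) : ∃ M ρ : ℝ, 0 < M ∧ 0 < ρ ∧ ρ < 1 ∧ ∀ t : ℕ, ‖a ^ t‖ ≤ M * ρ ^ t := by
  -- The maximum with 1/2 keeps the rate positive when `a ^ T = 0`. The factor `q⁻¹` in the final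
  -- constant pays for the incomplete last block of length less than `T`.
  set q : ℝ := max ‖a ^ T‖ (1 / 2) with hq
  have hq0 : 0 < q := lt_max_of_lt_right (by norm_num)
  have hq1 : q < 1 := max_lt h (by norm_num)
  set ρ : ℝ := q ^ ((T : ℝ)⁻¹) with hρ
  have hρ0 : 0 < ρ := Real.rpow_pos_of_pos hq0 _
  have hρ1 : ρ < 1 := Real.rpow_lt_one hq0.le hq1 (by positivity)
  have hρT : ρ ^ T = q := Real.rpow_inv_natCast_pow hq0.le hT.ne'
  have hblock : ∀ (s r : ℕ), ‖a ^ (T * s + r)‖ ≤ q ^ s * ‖a ^ r‖ := by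
    intro s r
    induction s with
    | zero => simp
    | succ s ih =>
      rw [show T * (s + 1) + r = T + (T * s + r) by ring, pow_add]
      calc ‖a ^ T * a ^ (T * s + r)‖ ≤ ‖a ^ T‖ * ‖a ^ (T * s + r)‖ := norm_mul_le _ _
        _ ≤ q * (q ^ s * ‖a ^ r‖) := by
          gcongr
          exact le_max_left _ _
        _ = _ := by ring
  refine ⟨q⁻¹ * (∑ r ∈ Finset.range T, ‖a ^ r‖ + 1), ρ, by positivity, hρ0, hρ1, fun t => ?_⟩
  have hmod := Nat.mod_lt t hT
  have hsum : ‖a ^ (t % T)‖ ≤ ∑ r ∈ Finset.range T, ‖a ^ r‖ + 1 :=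
    (Finset.single_le_sum (f := fun r => ‖a ^ r‖) (fun _ _ => norm_nonneg _)
      (Finset.mem_range.2 hmod)).trans (by linarith)
  have hpow : q ^ (t / T) ≤ q⁻¹ * ρ ^ t := by
    have e : q * q ^ (t / T) ≤ ρ ^ t := by
      rw [← pow_succ', ← hρT, ← pow_mul]
      refine pow_le_pow_of_le_one hρ0.le hρ1.le ?_
      have := Nat.div_add_mod t T
      rw [mul_add, mul_one]
      omega
    rwa [le_inv_mul_iff₀ hq0]
  calc ‖a ^ t‖ = ‖a ^ (T * (t / T) + t % T)‖ := by rw [Nat.div_add_mod]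
    _ ≤ q ^ (t / T) * ‖a ^ (t % T)‖ := hblock _ _
    _ ≤ (q⁻¹ * ρ ^ t) * (∑ r ∈ Finset.range T, ‖a ^ r‖ + 1) := by gcongr
    _ = _ := by ring

variable {ι : Type*} [Fintype ι] [DecidableEq ι]

theorem mem_spectrum_iff_exists_mulVec {K : Type*} [Field K] {M : Matrix ι ι K} {μ : K} :
    μ ∈ spectrum K M ↔ ∃ v, v ≠ 0 ∧ M *ᵥ v = μ • v := by
  rw [← Matrix.spectrum_toLin', ← Module.End.hasEigenvalue_iff_mem_spectrum]
  constructor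
  · intro h
    obtain ⟨v, hv⟩ := h.exists_hasEigenvector
    exact ⟨v, hv.2, hv.apply_eq_smul⟩
  · rintro ⟨v, hv, h⟩
    exact Module.End.hasEigenvalue_of_hasEigenvector
      (x := v) ⟨Module.End.mem_eigenspace_iff.2 h, hv⟩

/-- Gelfand's formula with spectral radius below 1. One contracting power is a single strict
inequality between norms, a form of stability that survives perturbation. -/
theorem exists_norm_pow_lt_one {M : Matrix ι ι ℂ}
    (h : ∀ (μ : ℂ) (v : ι → ℂ), 1 ≤ ‖μ‖ → M *ᵥ v = μ • v → v = 0) :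
    ∃ T, 0 < T ∧ ‖M ^ T‖ < 1 := by
  rcases isEmpty_or_nonempty ι with hι | hι
  · exact ⟨1, one_pos, by rw [Subsingleton.elim (M ^ 1) 0, norm_zero]; exact one_pos⟩
  have hr : spectralRadius ℂ M < (1 : NNReal) := by
    refine spectrum.spectralRadius_lt_of_forall_lt M fun μ hμ => ?_
    obtain ⟨v, hv, hMv⟩ := mem_spectrum_iff_exists_mulVec.1 hμ
    by_contra! hle
    exact hv (h μ v (by exact_mod_cast hle) hMv)
  have hev := (spectrum.pow_nnnorm_pow_one_div_tendsto_nhds_spectralRadius M).eventually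
    (gt_mem_nhds hr)
  obtain ⟨T, hT, hT0⟩ := (hev.and (Filter.eventually_gt_atTop 0)).exists
  refine ⟨T, hT0, ?_⟩
  by_contra! hle
  have h1 : (1 : ENNReal) ≤ (‖M ^ T‖₊ : ENNReal) := by exact_mod_cast hle
  have h2 := ENNReal.one_le_rpow h1 (show (0 : ℝ) < 1 / T by positivity)
  exact absurd hT (not_lt.2 (by simpa using h2))

/-- The companion matrix of `ξ(t+1) = A ξ(t) + B ξ(t-d)`. -/
def delayCompanion {R : Type*} [Semiring R] (d : ℕ) (A B : Matrix ι ι R) :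
    Matrix (Fin (d + 1) × ι) (Fin (d + 1) × ι) R :=
  Matrix.of fun p q =>
    if p.1 = 0 then (if q.1 = 0 then A p.2 q.2 else 0) + (if q.1 = Fin.last d then B p.2 q.2 else 0)
    else if (q.1 : ℕ) + 1 = p.1 ∧ p.2 = q.2 then 1 else 0

theorem delayCompanion_mulVec_zero {R : Type*} [CommSemiring R] (d : ℕ) (A B : Matrix ι ι R)
    (Y : Fin (d + 1) × ι → R) (i : ι) :
    (delayCompanion d A B *ᵥ Y) (0, i) =
      (A *ᵥ fun j => Y (0, j)) i + (B *ᵥ fun j => Y (Fin.last d, j)) i := by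
  simp only [Matrix.mulVec, dotProduct, delayCompanion, Matrix.of_apply, if_true, add_mul,
    Finset.sum_add_distrib, Fintype.sum_prod_type, ite_mul, zero_mul]
  congr 1
  · rw [Finset.sum_eq_single 0] <;> simp +contextual
  · rw [Finset.sum_eq_single (Fin.last d)] <;> simp +contextual

theorem delayCompanion_mulVec_succ {R : Type*} [CommSemiring R] (d : ℕ) (A B : Matrix ι ι R)
    (Y : Fin (d + 1) × ι → R) (l : Fin d) (i : ι) :
    (delayCompanion d A B *ᵥ Y) (l.succ, i) = Y (l.castSucc, i) := by
  simp only [Matrix.mulVec, dotProduct, delayCompanion, Matrix.of_apply, Fin.succ_ne_zero,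
    if_false, ite_mul, zero_mul, one_mul]
  rw [Finset.sum_eq_single (l.castSucc, i)]
  · simp
  · rintro ⟨q, j⟩ _ hne
    rw [if_neg]
    rintro ⟨h1, h2⟩
    refine hne (Prod.ext (Fin.ext ?_) h2.symm)
    simpa using h1
  · simp

theorem delayCompanion_map (d : ℕ) (A B : Matrix ι ι ℝ) :
    (delayCompanion d A B).map Complex.ofReal =
      delayCompanion d (A.map Complex.ofReal) (B.map Complex.ofReal) := by
  ext p q
  simp only [delayCompanion, Matrix.map_apply, Matrix.of_apply]
  split_ifs <;> simp

theorem continuous_delayCompanion (d : ℕ) :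
    Continuous fun p : Matrix ι ι ℝ × Matrix ι ι ℝ => delayCompanion d p.1 p.2 := by
  refine continuous_matrix fun p q => ?_
  simp only [delayCompanion, Matrix.of_apply]
  split_ifs <;> fun_prop

theorem norm_map_ofReal {κ : Type*} [Fintype κ] (M : Matrix ι κ ℝ) :
    ‖M.map Complex.ofReal‖ = ‖M‖ := by
  simp [Matrix.linfty_opNorm_def, Complex.nnnorm_real]

/-- If no characteristic root of a linear delay system lies outside the open unit disc, some power
of its companion matrix is a strict contraction. -/
theorem exists_norm_delayCompanion_pow_lt_one {d : ℕ} {A B : Matrix ι ι ℝ}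
    (h : ∀ (z : ℂ) (η : ι → ℂ), 1 ≤ ‖z‖ → z ^ (d + 1) • η =
      z ^ d • (A.map Complex.ofReal *ᵥ η) + B.map Complex.ofReal *ᵥ η → η = 0) :
    ∃ T, 0 < T ∧ ‖delayCompanion d A B ^ T‖ < 1 := by
  obtain ⟨T, hT, hlt⟩ := exists_norm_pow_lt_one (M := (delayCompanion d A B).map Complex.ofReal) (by
    intro μ v hμ hv
    rw [delayCompanion_map] at hv
    have hstep : ∀ (l : Fin d) (i : ι), v (l.castSucc, i) = μ * v (l.succ, i) := by
      intro l i
      rw [← delayCompanion_mulVec_succ d (A.map Complex.ofReal) (B.map Complex.ofReal) v, hv]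
      rfl
    -- Slot `l` holds the state delayed by `l` steps, so an eigenvector is geometric along the slots
    -- and its first row is the characteristic equation for the last slot.
    have hall : ∀ (s : ℕ) (hs : s ≤ d) (i : ι),
        v (⟨d - s, by omega⟩, i) = μ ^ s * v (Fin.last d, i) := by
      intro s
      induction s with
      | zero => intro _ i; simp [Fin.last]
      | succ s ih =>
        intro hs i
        have h1 := hstep ⟨d - (s + 1), by omega⟩ i
        have h2 := ih (by omega) i
        have e : (⟨d - s, by omega⟩ : Fin (d + 1)) = Fin.succ ⟨d - (s + 1), by omega⟩ :=
          Fin.ext (by simp; omega)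
        rw [e] at h2
        rw [h2] at h1
        rw [pow_succ', mul_assoc]
        exact h1
    have h0 : (fun j => v (0, j)) = μ ^ d • fun j => v (Fin.last d, j) := by
      funext j
      have := hall d le_rfl j
      simpa using this
    have hη := h μ (fun j => v (Fin.last d, j)) hμ (by
      funext i
      have h1 := congrFun hv (0, i)
      rw [delayCompanion_mulVec_zero, h0, Matrix.mulVec_smul] at h1
      have h2 := congrFun h0 i
      simp only [Pi.smul_apply, Pi.add_apply, smul_eq_mul] at h1 h2 ⊢
      rw [h1, h2, pow_succ]
      ring)
    funext ⟨l, i⟩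
    have h1 := hall (d - l) (by omega) i
    have h2 := congrFun hη i
    simp only [Pi.zero_apply] at h2
    have e : (⟨d - (d - l), by omega⟩ : Fin (d + 1)) = l := Fin.ext (by simp; omega)
    rw [e, h2, mul_zero] at h1
    exact h1)
  refine ⟨T, hT, ?_⟩
  have e : ((delayCompanion d A B).map Complex.ofReal) ^ T =
      (delayCompanion d A B ^ T).map Complex.ofReal :=
    (Matrix.map_pow (delayCompanion d A B) Complex.ofRealHom T).symm
  rwa [e, norm_map_ofReal] at hlt

/-- Solutions of a linear delay system decay like the powers of its companion matrix. -/
theorem norm_le_of_norm_delayCompanion_pow_le {d : ℕ} {A B : Matrix ι ι ℝ} {M ρ : ℝ}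
    (hM : ∀ t : ℕ, ‖delayCompanion d A B ^ t‖ ≤ M * ρ ^ t) {ξ : ℤ → ι → ℝ}
    (hξ : ∀ t : ℤ, 0 ≤ t → ξ (t + 1) = A *ᵥ ξ t + B *ᵥ ξ (t - d)) {D : ℝ}
    (hD : ∀ s : ℤ, -(d : ℤ) ≤ s → s ≤ 0 → ‖ξ s‖ ≤ D) (t : ℕ) : ‖ξ t‖ ≤ M * ρ ^ t * D := by
  set Y : ℕ → Fin (d + 1) × ι → ℝ := fun t p => ξ (t - (p.1 : ℕ)) p.2 with hY
  have hstep : ∀ t, Y (t + 1) = delayCompanion d A B *ᵥ Y t := by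
    intro t
    funext ⟨l, i⟩
    rcases Fin.eq_zero_or_eq_succ l with rfl | ⟨l, rfl⟩
    · rw [delayCompanion_mulVec_zero]
      have := congrFun (hξ t (by positivity)) i
      simpa [hY] using this
    · rw [delayCompanion_mulVec_succ]
      simp [hY]
  have hpow : ∀ t, Y t = delayCompanion d A B ^ t *ᵥ Y 0 := by
    intro t
    induction t with
    | zero => simp
    | succ t ih => rw [hstep, ih, Matrix.mulVec_mulVec, pow_succ']
  have hD0 : 0 ≤ D := (norm_nonneg _).trans (hD 0 (by simp) le_rfl)
  have hY0 : ‖Y 0‖ ≤ D := by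
    refine (pi_norm_le_iff_of_nonneg hD0).2 fun ⟨l, i⟩ => ?_
    refine (norm_le_pi_norm (ξ _) i).trans (hD _ ?_ ?_)
    · have := l.is_le
      simp only [Nat.cast_zero, zero_sub, neg_le_neg_iff]
      exact_mod_cast this
    · simp
  have hξY : ‖ξ t‖ ≤ ‖Y t‖ := by
    refine (pi_norm_le_iff_of_nonneg (norm_nonneg _)).2 fun i => ?_
    have := norm_le_pi_norm (Y t) (0, i)
    simpa [hY] using this
  calc ‖ξ t‖ ≤ ‖Y t‖ := hξY
    _ ≤ ‖delayCompanion d A B ^ t‖ * ‖Y 0‖ := by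
      rw [hpow]; exact Matrix.linfty_opNorm_mulVec _ _
    _ ≤ M * ρ ^ t * D := by
      gcongr
      · exact (norm_nonneg _).trans (hM t)
      · exact hM t

end Delay

/-! ### The internal model and the augmented plant -/

section InternalModel

open scoped Matrix

theorem eq_zero_of_vecMul_eq_zero {a b K : Type*} [Fintype a] [Fintype b] [Field K]
    {M : Matrix a b K} (hM : M.rank = Fintype.card a) {y : a → K} (hy : y ᵥ* M = 0) : y = 0 := by
  have h1 := (Mᵀ.mulVecLin).finrank_range_add_finrank_ker
  have h2 : Module.finrank K (LinearMap.range Mᵀ.mulVecLin) = Fintype.card a := by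
    rw [← hM, ← Matrix.rank_transpose]; rfl
  rw [h2, Module.finrank_pi] at h1
  have h3 : LinearMap.ker Mᵀ.mulVecLin = ⊥ := Submodule.finrank_eq_zero.1 (by omega)
  have h4 : y ∈ LinearMap.ker Mᵀ.mulVecLin := by
    rw [LinearMap.mem_ker, Matrix.mulVecLin_apply, Matrix.mulVec_transpose, hy]
  rwa [h3, Submodule.mem_bot] at h4

theorem eq_zero_of_vecMul_map_eq_zero {a b : Type*} [Fintype a] [Fintype b]
    {M : Matrix a b ℝ} (hM : M.rank = Fintype.card a) {y : a → ℂ}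
    (hy : y ᵥ* M.map Complex.ofReal = 0) : y = 0 := by
  have hre : (fun i => (y i).re) = 0 := eq_zero_of_vecMul_eq_zero hM (by
    funext j
    have := congrArg Complex.re (congrFun hy j)
    simpa [Matrix.vecMul, dotProduct] using this)
  have him : (fun i => (y i).im) = 0 := eq_zero_of_vecMul_eq_zero hM (by
    funext j
    have := congrArg Complex.im (congrFun hy j)
    simpa [Matrix.vecMul, dotProduct] using this)
  funext i
  exact Complex.ext (congrFun hre i) (congrFun him i)

theorem mem_spectrum_iff_exists_vecMul {ι K : Type*} [Fintype ι] [DecidableEq ι] [Field K]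
    {M : Matrix ι ι K} {μ : K} : μ ∈ spectrum K M ↔ ∃ v, v ≠ 0 ∧ v ᵥ* M = μ • v := by
  rw [Matrix.mem_spectrum_iff_isRoot_charpoly, ← Matrix.charpoly_transpose,
    ← Matrix.mem_spectrum_iff_isRoot_charpoly, mem_spectrum_iff_exists_mulVec]
  simp only [Matrix.mulVec_transpose]

theorem mem_complexSpectrum_of_charpoly_eq_minpoly {q k : ℕ} {S : Matrix (Fin q) (Fin q) ℝ}
    {β : Matrix (Fin k) (Fin k) ℝ} (h : β.charpoly = minpoly ℝ S) {μ : ℂ}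
    (hμ : μ ∈ complexSpectrum β) : μ ∈ complexSpectrum S := by
  have e : ∀ {l : ℕ} (M : Matrix (Fin l) (Fin l) ℝ), μ ∈ complexSpectrum M ↔
      (M.charpoly.map Complex.ofRealHom).IsRoot μ := by
    intro l M
    rw [complexSpectrum, Matrix.mem_spectrum_iff_isRoot_charpoly, ← Matrix.charpoly_map]
    rfl
  rw [e] at hμ ⊢
  rw [h] at hμ
  exact hμ.dvd (Polynomial.map_dvd _ (Matrix.minpoly_dvd_charpoly S))

theorem one_kronecker_mulVec {R : Type*} [CommRing R] {p k : ℕ} (β : Matrix (Fin k) (Fin k) R)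
    (z : Fin p × Fin k → R) (l : Fin p) (a : Fin k) :
    (((1 : Matrix (Fin p) (Fin p) R) ⊗ₖ β) *ᵥ z) (l, a) = (β *ᵥ fun b => z (l, b)) a := by
  simp only [Matrix.mulVec, dotProduct, Fintype.sum_prod_type, Matrix.kronecker_apply,
    Matrix.one_apply, ite_mul, one_mul, zero_mul]
  rw [Finset.sum_eq_single l] <;> simp +contextual [eq_comm]

theorem vecMul_one_kronecker {R : Type*} [CommRing R] {p k : ℕ} (β : Matrix (Fin k) (Fin k) R)
    (z : Fin p × Fin k → R) (l : Fin p) (a : Fin k) :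
    (z ᵥ* ((1 : Matrix (Fin p) (Fin p) R) ⊗ₖ β)) (l, a) = ((fun b => z (l, b)) ᵥ* β) a := by
  simp only [Matrix.vecMul, dotProduct, Fintype.sum_prod_type, Matrix.kronecker_apply,
    Matrix.one_apply, ite_mul, one_mul, zero_mul]
  rw [Finset.sum_eq_single l] <;> simp +contextual

theorem one_kronecker_col_mulVec {R : Type*} [CommRing R] {p k : ℕ} (σ : Matrix (Fin k) (Fin 1) R)
    (e : Fin p → R) (l : Fin p) (a : Fin k) :
    ((((1 : Matrix (Fin p) (Fin p) R) ⊗ₖ σ).submatrix id (fun i => (i, 0))) *ᵥ e) (l, a) =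
      σ a 0 * e l := by
  simp only [Matrix.mulVec, dotProduct, Matrix.submatrix_apply, id, Matrix.kronecker_apply,
    Matrix.one_apply, ite_mul, one_mul, zero_mul]
  rw [Finset.sum_eq_single l] <;> simp +contextual [eq_comm]

theorem vecMul_one_kronecker_col {R : Type*} [CommRing R] {p k : ℕ} (σ : Matrix (Fin k) (Fin 1) R)
    (z : Fin p × Fin k → R) (l : Fin p) :
    (z ᵥ* (((1 : Matrix (Fin p) (Fin p) R) ⊗ₖ σ).submatrix id (fun i => (i, 0)))) l =
      ((fun b => z (l, b)) ᵥ* σ) 0 := by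
  simp only [Matrix.vecMul, dotProduct, Fintype.sum_prod_type, Matrix.submatrix_apply, id,
    Matrix.kronecker_apply, Matrix.one_apply, ite_mul, one_mul, zero_mul]
  rw [Finset.sum_eq_single l] <;> simp +contextual

theorem map_one_kronecker {p k r : ℕ} (β : Matrix (Fin k) (Fin r) ℝ) :
    ((1 : Matrix (Fin p) (Fin p) ℝ) ⊗ₖ β).map Complex.ofReal =
      (1 : Matrix (Fin p) (Fin p) ℂ) ⊗ₖ β.map Complex.ofReal := by
  ext ⟨l, a⟩ ⟨l', b⟩
  simp only [Matrix.map_apply, Matrix.kronecker_apply, Matrix.one_apply]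
  split_ifs <;> simp

theorem vecMul_pow_mul {R : Type*} [CommRing R] {k m : ℕ} {β : Matrix (Fin k) (Fin k) R}
    {σ : Matrix (Fin k) (Fin m) R} {y : Fin k → R} {μ : R} (h : y ᵥ* β = μ • y) (l : ℕ) :
    y ᵥ* (β ^ l * σ) = μ ^ l • (y ᵥ* σ) := by
  induction l with
  | zero => simp
  | succ l ih =>
    rw [pow_succ', Matrix.mul_assoc, ← Matrix.vecMul_vecMul, h, Matrix.smul_vecMul, ih, smul_smul,
      pow_succ']

/-- Popov-Belevitch-Hautus test: a left eigenvector that kills σ kills every βˡσ, hence the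
controllability matrix. Its real full row rank also serves complex vectors. -/
theorem IsControllable.eq_zero_of_left_eigenvector {k m : ℕ} {β : Matrix (Fin k) (Fin k) ℝ}
    {σ : Matrix (Fin k) (Fin m) ℝ} (h : IsControllable β σ) {y : Fin k → ℂ} {μ : ℂ}
    (hβ : y ᵥ* β.map Complex.ofReal = μ • y) (hσ : y ᵥ* σ.map Complex.ofReal = 0) : y = 0 := by
  refine eq_zero_of_vecMul_map_eq_zero (M := controllabilityMatrix β σ) (by rw [Fintype.card_fin]; exact h) ?_
  funext ⟨l, j⟩
  have h1 := congrFun (vecMul_pow_mul (σ := σ.map Complex.ofReal) hβ l) j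
  rw [hσ, smul_zero] at h1
  have e : (β.map Complex.ofReal) ^ (l : ℕ) * σ.map Complex.ofReal =
      (β ^ (l : ℕ) * σ).map Complex.ofReal := by
    have h2 : (β ^ (l : ℕ)).map Complex.ofReal = (β.map Complex.ofReal) ^ (l : ℕ) :=
      Matrix.map_pow β Complex.ofRealHom l
    have h3 : (β ^ (l : ℕ) * σ).map Complex.ofReal =
        (β ^ (l : ℕ)).map Complex.ofReal * σ.map Complex.ofReal :=
      Matrix.map_mul (f := Complex.ofRealHom)
    rw [h3, h2]
  rw [e] at h1
  exact h1

/-- A left eigenvector of `A` that kills `B` remains one of A + BK for every K. -/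
theorem IsStabilizable.eq_zero_of_left_eigenvector {n m : ℕ} {A : Matrix (Fin n) (Fin n) ℝ}
    {B : Matrix (Fin n) (Fin m) ℝ} (h : IsStabilizable A B) {y : Fin n → ℂ} {μ : ℂ}
    (hμ : 1 ≤ ‖μ‖) (hA : y ᵥ* A.map Complex.ofReal = μ • y)
    (hB : y ᵥ* B.map Complex.ofReal = 0) : y = 0 := by
  obtain ⟨K, hK⟩ := h
  by_contra hy
  refine absurd (hK μ (mem_spectrum_iff_exists_vecMul.2 ⟨y, hy, ?_⟩)) (not_lt.2 hμ)
  have e1 : (A + B * K).map Complex.ofReal = A.map Complex.ofReal + (B * K).map Complex.ofReal :=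
    Matrix.map_add _ Complex.ofReal_add _ _
  have e2 : (B * K).map Complex.ofReal = B.map Complex.ofReal * K.map Complex.ofReal :=
    Matrix.map_mul (f := Complex.ofRealHom)
  rw [e1, e2, Matrix.vecMul_add, ← Matrix.vecMul_vecMul, hB, Matrix.zero_vecMul, add_zero, hA]

/-- The state matrix of the plant augmented with the internal model. -/
abbrev augmentedA {n p k : ℕ} (A : Matrix (Fin n) (Fin n) ℝ) (C : Matrix (Fin p) (Fin n) ℝ)
    (G₁ : Matrix (Fin p × Fin k) (Fin p × Fin k) ℝ) (G₂ : Matrix (Fin p × Fin k) (Fin p) ℝ) :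
    Matrix (Fin n ⊕ Fin p × Fin k) (Fin n ⊕ Fin p × Fin k) ℝ :=
  Matrix.fromBlocks A 0 (G₂ * C) G₁

/-- The input matrix of the plant augmented with the internal model. -/
abbrev augmentedB {n m : ℕ} (p k : ℕ) (B : Matrix (Fin n) (Fin m) ℝ) :
    Matrix (Fin n ⊕ Fin p × Fin k) (Fin m) ℝ :=
  Matrix.fromRows B 0

/-- By block triangularity the eigenvalues are among those of `A` and β. For a left eigenvector (y₁,
y₂) that kills the input: if y₂ = 0, stabilizability of (A, B) applies. Otherwise μ is an eigenvalue
of β, hence of `S`, and (y₁, y₂G₂) is a left null vector of the Rosenbrock matrix. Full row rank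
gives y₁ = 0 and y₂G₂ = 0, and controllability of (β, σ) gives y₂ = 0 copy by copy. -/
theorem isCriticallyStabilizable_augmented {n m p q k : ℕ} {A : Matrix (Fin n) (Fin n) ℝ}
    {B : Matrix (Fin n) (Fin m) ℝ} {C : Matrix (Fin p) (Fin n) ℝ} {S : Matrix (Fin q) (Fin q) ℝ}
    (hAB : IsStabilizable A B)
    (hrank : ∀ μ ∈ complexSpectrum S, (rosenbrockMatrix A B C μ).rank = n + p)
    (hS : ∀ μ ∈ complexSpectrum S, ‖μ‖ = 1) (hA : ∀ μ ∈ complexSpectrum A, ‖μ‖ ≤ 1)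
    {G₁ : Matrix (Fin p × Fin k) (Fin p × Fin k) ℝ} {G₂ : Matrix (Fin p × Fin k) (Fin p) ℝ}
    (hIM : IsMinimalPCopyInternalModel S G₁ G₂) :
    IsCriticallyStabilizable (augmentedA A C G₁ G₂) (augmentedB p k B) := by
  obtain ⟨β, σ, hβ, hβσ, rfl, rfl⟩ := hIM
  set G₁ := (1 : Matrix (Fin p) (Fin p) ℝ) ⊗ₖ β with hG₁
  set G₂ := ((1 : Matrix (Fin p) (Fin p) ℝ) ⊗ₖ σ).submatrix id (fun i => (i, (0 : Fin 1))) with hG₂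
  have eA : (augmentedA A C G₁ G₂).map Complex.ofReal = Matrix.fromBlocks (A.map Complex.ofReal) 0
      (G₂.map Complex.ofReal * C.map Complex.ofReal) (G₁.map Complex.ofReal) := by
    have : (G₂ * C).map Complex.ofReal = G₂.map Complex.ofReal * C.map Complex.ofReal :=
      Matrix.map_mul (f := Complex.ofRealHom)
    rw [augmentedA, Matrix.fromBlocks_map, this, Matrix.map_zero _ Complex.ofReal_zero]
  have eB : (augmentedB p k B).map Complex.ofReal =
      Matrix.fromRows (B.map Complex.ofReal) (0 : Matrix (Fin p × Fin k) (Fin m) ℂ) := by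
    ext i j
    rcases i with i | i <;> simp
  have eG₁ : G₁.map Complex.ofReal = (1 : Matrix (Fin p) (Fin p) ℂ) ⊗ₖ β.map Complex.ofReal :=
    map_one_kronecker β
  have eG₂ : G₂.map Complex.ofReal = ((1 : Matrix (Fin p) (Fin p) ℂ) ⊗ₖ
      σ.map Complex.ofReal).submatrix id (fun i => (i, (0 : Fin 1))) := by
    rw [← map_one_kronecker]; rfl
  constructor
  · intro μ x hx hAx
    have h1 : (augmentedA A C G₁ G₂).map Complex.ofReal *ᵥ x.ofLp = μ • x.ofLp :=
      congrArg WithLp.ofLp hAx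
    rw [eA, Matrix.fromBlocks_mulVec, Matrix.zero_mulVec, add_zero] at h1
    set x₁ := x.ofLp ∘ Sum.inl with hx₁
    set x₂ := x.ofLp ∘ Sum.inr with hx₂
    have h2 : A.map Complex.ofReal *ᵥ x₁ = μ • x₁ := funext fun i => congrFun h1 (Sum.inl i)
    by_cases hx0 : x₁ = 0
    · have h3 : G₁.map Complex.ofReal *ᵥ x₂ = μ • x₂ := by
        funext i
        have := congrFun h1 (Sum.inr i)
        simp only [hx0, Matrix.mulVec_zero, zero_add, Sum.elim_inr] at this
        exact this
      have hx2 : x₂ ≠ 0 := by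
        intro h0
        apply hx
        ext i
        rcases i with i | i
        · exact congrFun hx0 i
        · exact congrFun h0 i
      obtain ⟨⟨l, a⟩, hla⟩ := Function.ne_iff.1 hx2
      refine (hS μ (mem_complexSpectrum_of_charpoly_eq_minpoly hβ
        (mem_spectrum_iff_exists_mulVec.2 ⟨fun b => x₂ (l, b), fun h0 => hla (congrFun h0 a), ?_⟩))).le
      funext b
      have := congrFun h3 (l, b)
      rw [eG₁, one_kronecker_mulVec] at this
      exact this
    · exact hA μ (mem_spectrum_iff_exists_mulVec.2 ⟨x₁, hx0, h2⟩)
  · intro μ w hμ hwA hwB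
    set y : Fin n ⊕ Fin p × Fin k → ℂ := fun i => w (WithLp.toLp 2 (Pi.single i 1)) with hy
    have hwy : ∀ x : Fin n ⊕ Fin p × Fin k → ℂ, w (WithLp.toLp 2 x) = y ⬝ᵥ x := by
      intro x
      have e : WithLp.toLp 2 x = ∑ i, x i • (WithLp.toLp 2 (Pi.single i 1) :
          EuclideanSpace ℂ (Fin n ⊕ Fin p × Fin k)) := by
        ext j
        rcases j with j | j <;> simp [Pi.single_apply]
      rw [e, map_sum, dotProduct]
      exact Finset.sum_congr rfl fun i _ => by rw [map_smul, smul_eq_mul, mul_comm]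
    have h1 : y ᵥ* (augmentedA A C G₁ G₂).map Complex.ofReal = μ • y := by
      funext j
      have := hwA (WithLp.toLp 2 (Pi.single j 1))
      rw [complexOp_apply, hwy, Matrix.dotProduct_mulVec, dotProduct_single, mul_one] at this
      exact this
    have h2 : y ᵥ* (augmentedB p k B).map Complex.ofReal = 0 := by
      funext j
      have := hwB (WithLp.toLp 2 (Pi.single j 1))
      rw [complexOp_apply, hwy, Matrix.dotProduct_mulVec, dotProduct_single, mul_one] at this
      exact this
    set y₁ := y ∘ Sum.inl with hy₁
    set y₂ := y ∘ Sum.inr with hy₂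
    rw [eB, Matrix.vecMul_fromRows, Matrix.vecMul_zero, add_zero] at h2
    rw [eA, Matrix.vecMul_fromBlocks, Matrix.vecMul_zero, zero_add, ← Matrix.vecMul_vecMul] at h1
    have h3 : y₁ ᵥ* A.map Complex.ofReal +
        (y₂ ᵥ* G₂.map Complex.ofReal) ᵥ* C.map Complex.ofReal = μ • y₁ :=
      funext fun i => congrFun h1 (Sum.inl i)
    have h4 : y₂ ᵥ* G₁.map Complex.ofReal = μ • y₂ := funext fun i => congrFun h1 (Sum.inr i)
    have h5 : ∀ l, (fun b => y₂ (l, b)) ᵥ* β.map Complex.ofReal = μ • fun b => y₂ (l, b) := by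
      intro l
      funext b
      have := congrFun h4 (l, b)
      rw [eG₁, vecMul_one_kronecker] at this
      exact this
    have hboth : y₁ = 0 ∧ y₂ = 0 := by
      by_cases hy2 : y₂ = 0
      · refine ⟨hAB.eq_zero_of_left_eigenvector hμ.ge ?_ h2, hy2⟩
        rwa [hy2, Matrix.zero_vecMul, Matrix.zero_vecMul, add_zero] at h3
      · obtain ⟨⟨l, a⟩, hla⟩ := Function.ne_iff.1 hy2
        have hμS : μ ∈ complexSpectrum S := mem_complexSpectrum_of_charpoly_eq_minpoly hβ
          (mem_spectrum_iff_exists_vecMul.2 ⟨_, fun h0 => hla (congrFun h0 a), h5 l⟩)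
        have h6 : Sum.elim y₁ (y₂ ᵥ* G₂.map Complex.ofReal) = 0 := by
          refine eq_zero_of_vecMul_eq_zero (M := rosenbrockMatrix A B C μ)
            (by rw [hrank μ hμS]; simp) ?_
          rw [rosenbrockMatrix, Matrix.vecMul_fromBlocks, Sum.elim_comp_inl, Sum.elim_comp_inr,
            Matrix.vecMul_zero, add_zero, h2, Matrix.vecMul_sub, Matrix.vecMul_smul,
            Matrix.vecMul_one, sub_add_eq_add_sub, h3, sub_self]
          funext i
          rcases i with i | i <;> rfl
        have h7 : y₁ = 0 := funext fun i => congrFun h6 (Sum.inl i)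
        have h8 : y₂ ᵥ* G₂.map Complex.ofReal = 0 := funext fun i => congrFun h6 (Sum.inr i)
        refine ⟨h7, funext fun ⟨l, a⟩ => ?_⟩
        refine congrFun (hβσ.eq_zero_of_left_eigenvector (h5 l) ?_) a
        funext j
        have := congrFun h8 l
        rw [eG₂, vecMul_one_kronecker_col] at this
        rw [Subsingleton.elim j 0]
        exact this
    have hy0 : y = 0 := by
      funext i
      rcases i with i | i
      · exact congrFun hboth.1 i
      · exact congrFun hboth.2 i
    ext x
    have := hwy x.ofLp
    rw [hy0, zero_dotProduct] at this
    exact this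

end InternalModel

/-! ### The closed loop as a linear delay system -/

section ClosedLoop

open scoped Matrix

/-- A family of coupled systems with coupling matrix `H` has only the zero solution if the systems
decoupled along the eigenvalues of `H` have. -/
theorem eq_zero_of_forall_eigenvalue {N : ℕ} {ι : Type*} [Fintype ι]
    {H : Matrix (Fin N) (Fin N) ℂ} {L M : Matrix ι ι ℂ} {α : ℂ}
    (h : ∀ (c : ℂ) (v : Fin N → ℂ), v ≠ 0 → H *ᵥ v = c • v →
      ∀ η : ι → ℂ, α • η = L *ᵥ η + c • (M *ᵥ η) → η = 0)
    {ξ : Fin N → ι → ℂ} (hξ : ∀ i, α • ξ i = L *ᵥ ξ i + M *ᵥ ∑ j, H i j • ξ j) : ξ = 0 := by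
  let T : (Fin N → ι → ℂ) →ₗ[ℂ] (Fin N → ι → ℂ) :=
    { toFun := fun ξ i => ∑ j, H i j • ξ j
      map_add' := fun ξ ξ' => by
        funext i; simp only [Pi.add_apply, smul_add, Finset.sum_add_distrib]
      map_smul' := fun r ξ => by
        funext i
        simp only [Pi.smul_apply, RingHom.id_apply, Finset.smul_sum]
        exact Finset.sum_congr rfl fun j _ => smul_comm _ _ _ }
  -- `H` need not be diagonalisable: the solution space is invariant under the coupling `T`, so if
  -- nonzero it contains an eigenvector of `T`. That vector solves the decoupled equation, and its
  -- slices are eigenvectors of `H` or zero.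
  let s : Submodule ℂ (Fin N → ι → ℂ) :=
    { carrier := {ξ | ∀ i, α • ξ i = L *ᵥ ξ i + M *ᵥ T ξ i}
      add_mem' := fun {ξ ξ'} h1 h2 i => by
        rw [map_add, Pi.add_apply, Pi.add_apply, smul_add, h1 i, h2 i, Matrix.mulVec_add,
          Matrix.mulVec_add]
        abel
      zero_mem' := fun i => by
        rw [map_zero, Pi.zero_apply, smul_zero, Matrix.mulVec_zero, Matrix.mulVec_zero, add_zero]
      smul_mem' := fun r ξ h1 i => by
        rw [map_smul, Pi.smul_apply, Pi.smul_apply, smul_comm, h1 i, Matrix.mulVec_smul,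
          Matrix.mulVec_smul, smul_add] }
  have hinv : ∀ ξ ∈ s, T ξ ∈ s := by
    intro ξ h1 i
    change α • ∑ j, H i j • ξ j = L *ᵥ (∑ j, H i j • ξ j) + M *ᵥ ∑ j, H i j • T ξ j
    rw [Matrix.mulVec_sum, Matrix.mulVec_sum, Finset.smul_sum, ← Finset.sum_add_distrib]
    refine Finset.sum_congr rfl fun j _ => ?_
    rw [smul_comm, h1 j, Matrix.mulVec_smul, Matrix.mulVec_smul, smul_add]
  have hbot : s = ⊥ := by
    by_contra hne
    have : Nontrivial s := Submodule.nontrivial_iff_ne_bot.2 hne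
    obtain ⟨c, hev⟩ := Module.End.exists_eigenvalue (T.restrict hinv)
    obtain ⟨ξ, hξ⟩ := hev.exists_hasEigenvector
    have hT : T (ξ : Fin N → ι → ℂ) = c • (ξ : Fin N → ι → ℂ) :=
      congrArg Subtype.val hξ.apply_eq_smul
    have hne : (ξ : Fin N → ι → ℂ) ≠ 0 := fun h0 => hξ.2 (Subtype.ext h0)
    obtain ⟨i, hi⟩ := Function.ne_iff.1 hne
    obtain ⟨b, hb⟩ := Function.ne_iff.1 hi
    refine hi (h c (fun i => (ξ : Fin N → ι → ℂ) i b) (fun h0 => hb (congrFun h0 i)) ?_ _ ?_)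
    · funext l
      have := congrFun (congrFun hT l) b
      simpa [T, Matrix.mulVec, dotProduct] using this
    · have := ξ.2 i
      rw [hT] at this
      rw [this, Pi.smul_apply, Matrix.mulVec_smul]
  have : ξ ∈ s := hξ
  rwa [hbot, Submodule.mem_bot] at this

variable {N n m p q k : ℕ}

/-- The index set of the state of the closed loop. -/
abbrev StateIndex (N n p k : ℕ) : Type := Fin N × (Fin n ⊕ Fin p × Fin k)

/-- The state of the closed loop. -/
def stack {R : Type*} (x : Fin N → Fin n → R) (z : Fin N → Fin p × Fin k → R) :
    StateIndex N n p k → R := fun s => Sum.elim (x s.1) (z s.1) s.2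

/-- The undelayed part of the closed loop. -/
def currentMatrix (P : MultiAgentSystem N n m p q) (w : Uncertainty N n m p q)
    (G₁ : Matrix (Fin p × Fin k) (Fin p × Fin k) ℝ) (G₂ : Matrix (Fin p × Fin k) (Fin p) ℝ) :
    Matrix (StateIndex N n p k) (StateIndex N n p k) ℝ :=
  Matrix.of fun s t =>
    (if s.1 = t.1 then Matrix.fromBlocks (P.plantA w s.1) 0 0 G₁ s.2 t.2 else 0) +
      followerLaplacian P.a s.1 t.1 * Matrix.fromBlocks (0 : Matrix (Fin n) (Fin n) ℝ) 0
        (G₂ * P.plantC w t.1) (0 : Matrix (Fin p × Fin k) (Fin p × Fin k) ℝ) s.2 t.2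

/-- The delayed part of the closed loop. -/
def delayedMatrix (P : MultiAgentSystem N n m p q) (w : Uncertainty N n m p q)
    (Kx : Matrix (Fin m) (Fin n) ℝ) (Kz : Matrix (Fin m) (Fin p × Fin k) ℝ) :
    Matrix (StateIndex N n p k) (StateIndex N n p k) ℝ :=
  Matrix.of fun s t =>
    (if s.1 = t.1 then Matrix.fromBlocks (0 : Matrix (Fin n) (Fin n) ℝ) (P.plantB w s.1 * Kz) 0
        (0 : Matrix (Fin p × Fin k) (Fin p × Fin k) ℝ) s.2 t.2 else 0) +
      followerLaplacian P.a s.1 t.1 * Matrix.fromBlocks (P.plantB w s.1 * Kx) 0 0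
        (0 : Matrix (Fin p × Fin k) (Fin p × Fin k) ℝ) s.2 t.2

/-- The ring homomorphism `f` is the identity for real trajectories and the embedding into ℂ for
characteristic roots, so both share one computation. -/
theorem coupled_mulVec {R : Type*} [CommRing R] (f : ℝ →+* R) {ι : Type*} [Fintype ι]
    (X : Fin N → Matrix ι ι ℝ) (H : Matrix (Fin N) (Fin N) ℝ) (Y : Fin N → Fin N → Matrix ι ι ℝ)
    (ξ : Fin N × ι → R) (i : Fin N) (b : ι) :
    (((Matrix.of fun s t : Fin N × ι => (if s.1 = t.1 then X s.1 s.2 t.2 else 0) +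
      H s.1 t.1 * Y s.1 t.1 s.2 t.2).map f) *ᵥ ξ) (i, b) =
      ((X i).map f *ᵥ fun c => ξ (i, c)) b +
        (∑ j, f (H i j) • ((Y i j).map f *ᵥ fun c => ξ (j, c))) b := by
  simp only [Matrix.mulVec, dotProduct, Matrix.map_apply, Matrix.of_apply, map_add, map_mul,
    add_mul, Finset.sum_add_distrib, Fintype.sum_prod_type, Finset.sum_apply, Pi.smul_apply,
    smul_eq_mul, Finset.mul_sum, mul_assoc]
  congr 1
  rw [Finset.sum_eq_single i] <;> simp +contextual [eq_comm]

theorem fromBlocks_map_mulVec_elim {R : Type*} [CommRing R] (f : ℝ →+* R) {a b : Type*}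
    [Fintype a] [Fintype b] (X : Matrix a a ℝ) (Y : Matrix a b ℝ) (Z : Matrix b a ℝ)
    (W : Matrix b b ℝ) (x : a → R) (z : b → R) :
    (Matrix.fromBlocks X Y Z W).map f *ᵥ Sum.elim x z =
      Sum.elim (X.map f *ᵥ x + Y.map f *ᵥ z) (Z.map f *ᵥ x + W.map f *ᵥ z) := by
  rw [Matrix.fromBlocks_map, Matrix.fromBlocks_mulVec, Sum.elim_comp_inl, Sum.elim_comp_inr]

theorem map_zero_matrix {R : Type*} [CommRing R] (f : ℝ →+* R) {a b : Type*} :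
    (0 : Matrix a b ℝ).map f = 0 := Matrix.map_zero _ (map_zero f)

theorem currentMatrix_mulVec_inl {R : Type*} [CommRing R] (f : ℝ →+* R)
    (P : MultiAgentSystem N n m p q) (w : Uncertainty N n m p q)
    (G₁ : Matrix (Fin p × Fin k) (Fin p × Fin k) ℝ) (G₂ : Matrix (Fin p × Fin k) (Fin p) ℝ)
    (x : Fin N → Fin n → R) (z : Fin N → Fin p × Fin k → R) (i : Fin N) (b : Fin n) :
    ((currentMatrix P w G₁ G₂).map f *ᵥ stack x z) (i, Sum.inl b) =
      ((P.plantA w i).map f *ᵥ x i) b := by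
  have := coupled_mulVec f (fun i => Matrix.fromBlocks (P.plantA w i) 0 0 G₁)
    (followerLaplacian P.a) (fun _ j => Matrix.fromBlocks (0 : Matrix (Fin n) (Fin n) ℝ) 0
        (G₂ * P.plantC w j) (0 : Matrix (Fin p × Fin k) (Fin p × Fin k) ℝ)) (stack x z) i (Sum.inl b)
  refine this.trans ?_
  change ((Matrix.fromBlocks _ _ _ _).map f *ᵥ Sum.elim (x i) (z i)) (Sum.inl b) +
    (∑ j, f _ • ((Matrix.fromBlocks _ _ _ _).map f *ᵥ Sum.elim (x j) (z j))) (Sum.inl b) = _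
  simp only [fromBlocks_map_mulVec_elim, map_zero_matrix, Matrix.zero_mulVec, add_zero,
    Sum.elim_inl, Finset.sum_apply, Pi.smul_apply, Pi.zero_apply, smul_zero,
    Finset.sum_const_zero]

theorem currentMatrix_mulVec_inr {R : Type*} [CommRing R] (f : ℝ →+* R)
    (P : MultiAgentSystem N n m p q) (w : Uncertainty N n m p q)
    (G₁ : Matrix (Fin p × Fin k) (Fin p × Fin k) ℝ) (G₂ : Matrix (Fin p × Fin k) (Fin p) ℝ)
    (x : Fin N → Fin n → R) (z : Fin N → Fin p × Fin k → R) (i : Fin N) (b : Fin p × Fin k) :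
    ((currentMatrix P w G₁ G₂).map f *ᵥ stack x z) (i, Sum.inr b) =
      (G₁.map f *ᵥ z i + G₂.map f *ᵥ ∑ j, f (followerLaplacian P.a i j) •
        ((P.plantC w j).map f *ᵥ x j)) b := by
  have := coupled_mulVec f (fun i => Matrix.fromBlocks (P.plantA w i) 0 0 G₁)
    (followerLaplacian P.a) (fun _ j => Matrix.fromBlocks (0 : Matrix (Fin n) (Fin n) ℝ) 0
        (G₂ * P.plantC w j) (0 : Matrix (Fin p × Fin k) (Fin p × Fin k) ℝ)) (stack x z) i (Sum.inr b)
  refine this.trans ?_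
  change ((Matrix.fromBlocks _ _ _ _).map f *ᵥ Sum.elim (x i) (z i)) (Sum.inr b) +
    (∑ j, f _ • ((Matrix.fromBlocks _ _ _ _).map f *ᵥ Sum.elim (x j) (z j))) (Sum.inr b) = _
  simp only [fromBlocks_map_mulVec_elim, map_zero_matrix, Matrix.zero_mulVec, add_zero, zero_add,
    Sum.elim_inr, Finset.sum_apply, Pi.smul_apply, Matrix.mulVec_sum, Matrix.mulVec_smul,
    Matrix.map_mul, Matrix.mulVec_mulVec, Pi.add_apply]

theorem delayedMatrix_mulVec_inl {R : Type*} [CommRing R] (f : ℝ →+* R)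
    (P : MultiAgentSystem N n m p q) (w : Uncertainty N n m p q)
    (Kx : Matrix (Fin m) (Fin n) ℝ) (Kz : Matrix (Fin m) (Fin p × Fin k) ℝ)
    (x : Fin N → Fin n → R) (z : Fin N → Fin p × Fin k → R) (i : Fin N) (b : Fin n) :
    ((delayedMatrix P w Kx Kz).map f *ᵥ stack x z) (i, Sum.inl b) =
      ((P.plantB w i).map f *ᵥ (Kx.map f *ᵥ (∑ j, f (followerLaplacian P.a i j) • x j) +
        Kz.map f *ᵥ z i)) b := by
  have := coupled_mulVec f (fun i => Matrix.fromBlocks (0 : Matrix (Fin n) (Fin n) ℝ)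
    (P.plantB w i * Kz) 0 (0 : Matrix (Fin p × Fin k) (Fin p × Fin k) ℝ))
    (followerLaplacian P.a) (fun i _ => Matrix.fromBlocks (P.plantB w i * Kx) 0 0
        (0 : Matrix (Fin p × Fin k) (Fin p × Fin k) ℝ)) (stack x z) i (Sum.inl b)
  refine this.trans ?_
  change ((Matrix.fromBlocks _ _ _ _).map f *ᵥ Sum.elim (x i) (z i)) (Sum.inl b) +
    (∑ j, f _ • ((Matrix.fromBlocks _ _ _ _).map f *ᵥ Sum.elim (x j) (z j))) (Sum.inl b) = _
  simp only [fromBlocks_map_mulVec_elim, map_zero_matrix, Matrix.zero_mulVec, add_zero, zero_add,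
    Sum.elim_inl, Finset.sum_apply, Pi.smul_apply, Matrix.mulVec_sum, Matrix.mulVec_smul,
    Matrix.map_mul, Matrix.mulVec_mulVec, Pi.add_apply, Matrix.mulVec_add]
  rw [add_comm]

theorem delayedMatrix_mulVec_inr {R : Type*} [CommRing R] (f : ℝ →+* R)
    (P : MultiAgentSystem N n m p q) (w : Uncertainty N n m p q)
    (Kx : Matrix (Fin m) (Fin n) ℝ) (Kz : Matrix (Fin m) (Fin p × Fin k) ℝ)
    (x : Fin N → Fin n → R) (z : Fin N → Fin p × Fin k → R) (i : Fin N) (b : Fin p × Fin k) :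
    ((delayedMatrix P w Kx Kz).map f *ᵥ stack x z) (i, Sum.inr b) = 0 := by
  have := coupled_mulVec f (fun i => Matrix.fromBlocks (0 : Matrix (Fin n) (Fin n) ℝ)
    (P.plantB w i * Kz) 0 (0 : Matrix (Fin p × Fin k) (Fin p × Fin k) ℝ))
    (followerLaplacian P.a) (fun i _ => Matrix.fromBlocks (P.plantB w i * Kx) 0 0
        (0 : Matrix (Fin p × Fin k) (Fin p × Fin k) ℝ)) (stack x z) i (Sum.inr b)
  refine this.trans ?_
  change ((Matrix.fromBlocks _ _ _ _).map f *ᵥ Sum.elim (x i) (z i)) (Sum.inr b) +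
    (∑ j, f _ • ((Matrix.fromBlocks _ _ _ _).map f *ᵥ Sum.elim (x j) (z j))) (Sum.inr b) = _
  simp only [fromBlocks_map_mulVec_elim, map_zero_matrix, Matrix.zero_mulVec, add_zero,
    Sum.elim_inr, Finset.sum_apply, Pi.smul_apply, Pi.zero_apply, smul_zero,
    Finset.sum_const_zero]

theorem continuous_currentMatrix (P : MultiAgentSystem N n m p q)
    (G₁ : Matrix (Fin p × Fin k) (Fin p × Fin k) ℝ) (G₂ : Matrix (Fin p × Fin k) (Fin p) ℝ) :
    Continuous fun w => currentMatrix P w G₁ G₂ := by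
  refine continuous_matrix fun ⟨i, s⟩ ⟨j, t⟩ => ?_
  have hA : Continuous fun w : Uncertainty N n m p q => P.plantA w i := by
    unfold MultiAgentSystem.plantA; fun_prop
  have hC : Continuous fun w : Uncertainty N n m p q => P.plantC w j := by
    unfold MultiAgentSystem.plantC; fun_prop
  simp only [currentMatrix, Matrix.of_apply]
  refine Continuous.add ?_ (continuous_const.mul ?_)
  · split_ifs
    · exact (Continuous.matrix_fromBlocks hA continuous_const continuous_const
        continuous_const).matrix_elem _ _
    · exact continuous_const
  · exact (Continuous.matrix_fromBlocks continuous_const continuous_const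
      (continuous_const.matrix_mul hC) continuous_const).matrix_elem _ _

theorem continuous_delayedMatrix (P : MultiAgentSystem N n m p q)
    (Kx : Matrix (Fin m) (Fin n) ℝ) (Kz : Matrix (Fin m) (Fin p × Fin k) ℝ) :
    Continuous fun w => delayedMatrix P w Kx Kz := by
  refine continuous_matrix fun ⟨i, s⟩ ⟨j, t⟩ => ?_
  have hB : Continuous fun w : Uncertainty N n m p q => P.plantB w i := by
    unfold MultiAgentSystem.plantB; fun_prop
  simp only [delayedMatrix, Matrix.of_apply]
  refine Continuous.add ?_ (continuous_const.mul ?_)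
  · split_ifs
    · exact (Continuous.matrix_fromBlocks continuous_const (hB.matrix_mul continuous_const)
        continuous_const continuous_const).matrix_elem _ _
    · exact continuous_const
  · exact (Continuous.matrix_fromBlocks (hB.matrix_mul continuous_const) continuous_const
      continuous_const continuous_const).matrix_elem _ _

theorem sum_smul_sub_eq_followerLaplacian {E : Type*} [AddCommGroup E] [Module ℝ E]
    (a : Matrix (Fin (N + 1)) (Fin (N + 1)) ℝ) (x : Fin N → E) (i : Fin N) :
    ∑ l, a i.succ l • ((Fin.cons 0 x : Fin (N + 1) → E) i.succ -
      (Fin.cons 0 x : Fin (N + 1) → E) l) = ∑ j, followerLaplacian a i j • x j :=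
  (followerLaplacian_sum_smul (RingHom.id ℝ) a x i).symm

/-- Without exogenous signal the closed loop is a linear delay system. -/
theorem MultiAgentSystem.IsClosedLoopTrajectory.stack_step {P : MultiAgentSystem N n m p q}
    {w : Uncertainty N n m p q} {G₁ : Matrix (Fin p × Fin k) (Fin p × Fin k) ℝ}
    {G₂ : Matrix (Fin p × Fin k) (Fin p) ℝ} {Kx : Matrix (Fin m) (Fin n) ℝ}
    {Kz : Matrix (Fin m) (Fin p × Fin k) ℝ} {v : ℤ → Fin q → ℝ} {x : Fin N → ℤ → Fin n → ℝ}
    {z : Fin N → ℤ → Fin p × Fin k → ℝ} {u : Fin N → ℤ → Fin m → ℝ}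
    (h : P.IsClosedLoopTrajectory w G₁ G₂ Kx Kz v x z u) {t : ℤ} (ht : 0 ≤ t) (hv : v t = 0) :
    stack (fun i => x i (t + 1)) (fun i => z i (t + 1)) =
      currentMatrix P w G₁ G₂ *ᵥ stack (fun i => x i t) (fun i => z i t) +
      delayedMatrix P w Kx Kz *ᵥ stack (fun i => x i (t - (P.rcon + P.rcom : ℕ)))
        (fun i => z i (t - (P.rcon + P.rcom : ℕ))) := by
  have hid : ∀ {a b : Type} (M : Matrix a b ℝ), M.map (RingHom.id ℝ) = M := fun M => Matrix.map_id M
  have et : t - ((P.rcon + P.rcom : ℕ) : ℤ) = t - P.rcon - P.rcom := by push_cast; ring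
  funext ⟨i, s⟩
  rw [et]
  rcases s with b | b
  · have h1 := currentMatrix_mulVec_inl (RingHom.id ℝ) P w G₁ G₂ (fun i => x i t)
      (fun i => z i t) i b
    have h2 := delayedMatrix_mulVec_inl (RingHom.id ℝ) P w Kx Kz
      (fun i => x i (t - P.rcon - P.rcom)) (fun i => z i (t - P.rcon - P.rcom)) i b
    simp only [hid, RingHom.id_apply] at h1 h2
    rw [Pi.add_apply, h1, h2]
    change x i (t + 1) b = _
    rw [h.plant i t ht, h.control i _ (by linarith), hv, Matrix.mulVec_zero, add_zero]
    rw [MultiAgentSystem.eta, ← sum_smul_sub_eq_followerLaplacian]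
    rfl
  · have h1 := currentMatrix_mulVec_inr (RingHom.id ℝ) P w G₁ G₂ (fun i => x i t)
      (fun i => z i t) i b
    have h2 := delayedMatrix_mulVec_inr (RingHom.id ℝ) P w Kx Kz
      (fun i => x i (t - P.rcon - P.rcom)) (fun i => z i (t - P.rcon - P.rcom)) i b
    simp only [hid, RingHom.id_apply] at h1 h2
    rw [Pi.add_apply, h1, h2, add_zero]
    change z i (t + 1) b = _
    rw [h.internalModel i t ht, MultiAgentSystem.virtualOutput, MultiAgentSystem.output, hv,
      Matrix.mulVec_zero, neg_zero, ← sum_smul_sub_eq_followerLaplacian]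

/-- The nominal closed loop has no characteristic root outside the open unit disc if the augmented
plant, in feedback scaled by the eigenvalues of the Laplacian, has none. -/
theorem nominal_eq_zero {P : MultiAgentSystem N n m p q}
    {G₁ : Matrix (Fin p × Fin k) (Fin p × Fin k) ℝ} {G₂ : Matrix (Fin p × Fin k) (Fin p) ℝ}
    {K : Matrix (Fin m) (Fin n ⊕ Fin p × Fin k) ℝ} {d : ℕ} {ζ : ℂ}
    (hH : ∀ v : Fin N → ℂ, (followerLaplacian P.a).map Complex.ofReal *ᵥ v = 0 → v = 0)
    (hK : ∀ (c : ℂ) (v : Fin N → ℂ), v ≠ 0 →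
      (followerLaplacian P.a).map Complex.ofReal *ᵥ v = c • v → ∀ η : _ → ℂ,
      ζ ^ (d + 1) • η = ζ ^ d • ((augmentedA P.A P.C G₁ G₂).map Complex.ofReal *ᵥ η) +
        c • ((augmentedB p k P.B * K).map Complex.ofReal *ᵥ η) → η = 0)
    {y : StateIndex N n p k → ℂ} (hy : ζ ^ (d + 1) • y =
      ζ ^ d • ((currentMatrix P 0 G₁ G₂).map Complex.ofReal *ᵥ y) +
        (delayedMatrix P 0 (K.submatrix id Sum.inl) (K.submatrix id Sum.inr)).map
          Complex.ofReal *ᵥ y) : y = 0 := by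
  set f : ℝ →+* ℂ := Complex.ofRealHom
  set Kx := K.submatrix id Sum.inl with hKx
  set Kz := K.submatrix id Sum.inr with hKz
  set H := followerLaplacian P.a with hHdef
  set x : Fin N → Fin n → ℂ := fun i b => y (i, Sum.inl b) with hx
  set z : Fin N → Fin p × Fin k → ℂ := fun i b => y (i, Sum.inr b) with hz
  have hstack : y = stack x z := by
    funext ⟨i, s⟩
    rcases s with b | b <;> rfl
  -- In terms of X = Hx each internal model is driven by C Xᵢ alone, and Xᵢ by the sum of Hᵢⱼ(Kx Xⱼ
  -- + Kz zⱼ). The pairs (Xᵢ, zᵢ) are thus augmented plants coupled by `H` in the feedback only; at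
  -- the end x is recovered because `H` is injective.
  set X : Fin N → Fin n → ℂ := fun i => ∑ j, f (H i j) • x j with hX
  have hpA : ∀ i, P.plantA 0 i = P.A := fun i => add_zero _
  have hpB : ∀ i, P.plantB 0 i = P.B := fun i => add_zero _
  have hpC : ∀ i, P.plantC 0 i = P.C := fun i => add_zero _
  rw [hstack] at hy
  have h1 : ∀ i, ζ ^ (d + 1) • x i = ζ ^ d • (P.A.map f *ᵥ x i) +
      P.B.map f *ᵥ (Kx.map f *ᵥ X i + Kz.map f *ᵥ z i) := by
    intro i
    funext b
    have e := congrFun hy (i, Sum.inl b)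
    have e1 := currentMatrix_mulVec_inl f P 0 G₁ G₂ x z i b
    have e2 := delayedMatrix_mulVec_inl f P 0 Kx Kz x z i b
    rw [Pi.add_apply, Pi.smul_apply, Pi.smul_apply] at e
    rw [hpA] at e1
    rw [hpB] at e2
    rw [Pi.add_apply, Pi.smul_apply, Pi.smul_apply, ← e1, ← e2]
    exact e
  have h2 : ∀ i, ζ ^ (d + 1) • z i = ζ ^ d • (G₁.map f *ᵥ z i +
      G₂.map f *ᵥ (P.C.map f *ᵥ X i)) := by
    intro i
    funext b
    have e := congrFun hy (i, Sum.inr b)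
    have e1 := currentMatrix_mulVec_inr f P 0 G₁ G₂ x z i b
    have e2 := delayedMatrix_mulVec_inr f P 0 Kx Kz x z i b
    rw [Pi.add_apply, Pi.smul_apply, Pi.smul_apply] at e
    simp only [hpC, ← Matrix.mulVec_smul, ← Matrix.mulVec_sum] at e1
    rw [Pi.smul_apply, Pi.smul_apply, ← e1]
    refine e.trans ?_
    erw [e2]
    rw [add_zero]
    rfl
  have h3 : ∀ i, ζ ^ (d + 1) • X i = ζ ^ d • (P.A.map f *ᵥ X i) +
      P.B.map f *ᵥ ∑ j, f (H i j) • (Kx.map f *ᵥ X j + Kz.map f *ᵥ z j) := by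
    intro i
    have hXi : X i = ∑ j, f (H i j) • x j := rfl
    rw [hXi, Matrix.mulVec_sum, Matrix.mulVec_sum, Finset.smul_sum, Finset.smul_sum,
      ← Finset.sum_add_distrib]
    refine Finset.sum_congr rfl fun j _ => ?_
    rw [Matrix.mulVec_smul, Matrix.mulVec_smul, smul_comm, h1 j, smul_add, smul_comm]
  have hξ := eq_zero_of_forall_eigenvalue (H := H.map f)
    (L := ζ ^ d • (augmentedA P.A P.C G₁ G₂).map f) (M := (augmentedB p k P.B * K).map f)
    (α := ζ ^ (d + 1)) (fun c v hv hcv η hη => hK c v hv hcv η (by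
      rw [Matrix.smul_mulVec] at hη
      exact hη)) (ξ := fun i => Sum.elim (X i) (z i)) (by
    intro i
    have eK : ∀ j, K.map f *ᵥ Sum.elim (X j) (z j) = Kx.map f *ᵥ X j + Kz.map f *ᵥ z j := by
      intro j
      funext b
      simp [Matrix.mulVec, dotProduct, Fintype.sum_sum_type, hKx, hKz]
    have eM : (augmentedB p k P.B * K).map f *ᵥ (∑ j, H.map f i j • Sum.elim (X j) (z j)) =
        (augmentedB p k P.B).map f *ᵥ ∑ j, f (H i j) • (Kx.map f *ᵥ X j + Kz.map f *ᵥ z j) := by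
      rw [Matrix.map_mul, ← Matrix.mulVec_mulVec, Matrix.mulVec_sum]
      simp only [Matrix.mulVec_smul, eK, Matrix.map_apply]
    have eB : (augmentedB p k P.B).map f =
        Matrix.fromRows (P.B.map f) (0 : Matrix (Fin p × Fin k) (Fin m) ℂ) := by
      ext i j
      rcases i with i | i <;> simp
    rw [eM, eB, Matrix.fromRows_mulVec, Matrix.zero_mulVec, Matrix.smul_mulVec,
      fromBlocks_map_mulVec_elim]
    funext s
    rcases s with b | b
    · have := congrFun (h3 i) b
      simpa [map_zero_matrix] using this
    · have := congrFun (h2 i) b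
      rw [Matrix.mulVec_mulVec, ← Matrix.map_mul] at this
      simp only [Pi.smul_apply, Pi.add_apply, Sum.elim_inr, Pi.zero_apply, add_zero] at this ⊢
      rw [this, add_comm])
  have hX0 : ∀ i, X i = 0 := fun i => funext fun b => congrFun (congrFun hξ i) (Sum.inl b)
  have hz0 : ∀ i, z i = 0 := fun i => funext fun b => congrFun (congrFun hξ i) (Sum.inr b)
  have hx0 : ∀ i b, x i b = 0 := by
    intro i b
    refine congrFun (hH (fun i => x i b) ?_) i
    funext i
    have := congrFun (hX0 i) b
    simpa [hX, Matrix.mulVec, dotProduct, f] using this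
  rw [hstack]
  funext ⟨i, s⟩
  rcases s with b | b
  · exact hx0 i b
  · exact congrFun (hz0 i) b

end ClosedLoop

/-! ### Stability of the closed loop -/

section Stability

open scoped Matrix Matrix.Norms.Operator

variable {N n m p q k : ℕ}

theorem exists_bounds_of_finite {s : Set ℂ} (hs : s.Finite) (hpos : ∀ c ∈ s, 0 < c.re) :
    ∃ r R : ℝ, 0 < r ∧ 0 ≤ R ∧ ∀ c ∈ s, r ≤ c.re ∧ ‖c‖ ≤ R := by
  induction s, hs using Set.Finite.induction_on with
  | empty => exact ⟨1, 0, one_pos, le_rfl, by simp⟩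
  | @insert c s _ _ ih =>
    obtain ⟨r, R, hr, hR, h⟩ := ih fun c' hc' => hpos c' (Set.mem_insert_of_mem _ hc')
    refine ⟨min r c.re, max R ‖c‖, lt_min hr (hpos c (Set.mem_insert _ _)), le_max_of_le_left hR, ?_⟩
    rintro c' (rfl | hc')
    · exact ⟨min_le_right _ _, le_max_right _ _⟩
    · exact ⟨(min_le_left _ _).trans (h c' hc').1, (h c' hc').2.trans (le_max_left _ _)⟩

/-- The companion matrix of the closed loop. -/
def closedLoopMatrix (P : MultiAgentSystem N n m p q) (w : Uncertainty N n m p q)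
    (G₁ : Matrix (Fin p × Fin k) (Fin p × Fin k) ℝ) (G₂ : Matrix (Fin p × Fin k) (Fin p) ℝ)
    (Kx : Matrix (Fin m) (Fin n) ℝ) (Kz : Matrix (Fin m) (Fin p × Fin k) ℝ) :
    Matrix (Fin (P.rcon + P.rcom + 1) × StateIndex N n p k)
      (Fin (P.rcon + P.rcom + 1) × StateIndex N n p k) ℝ :=
  delayCompanion (P.rcon + P.rcom) (currentMatrix P w G₁ G₂) (delayedMatrix P w Kx Kz)

/-- The Laplacian has finitely many eigenvalues, all with positive real part, so one pair r, R
covers them and a single gain serves every decoupled loop. -/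
theorem exists_gains {P : MultiAgentSystem N n m p q} {G : Digraph (Fin (N + 1))}
    (hG : IsWeightedAdjacency G P.a) (hreach : ∀ v, Relation.ReflTransGen G.Adj 0 v)
    {G₁ : Matrix (Fin p × Fin k) (Fin p × Fin k) ℝ} {G₂ : Matrix (Fin p × Fin k) (Fin p) ℝ}
    (h : IsCriticallyStabilizable (augmentedA P.A P.C G₁ G₂) (augmentedB p k P.B)) :
    ∃ (Kx : Matrix (Fin m) (Fin n) ℝ) (Kz : Matrix (Fin m) (Fin p × Fin k) ℝ), ∃ T, 0 < T ∧
      ‖closedLoopMatrix P 0 G₁ G₂ Kx Kz ^ T‖ < 1 := by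
  have hre : ∀ c ∈ spectrum ℂ ((followerLaplacian P.a).map Complex.ofReal), 0 < c.re := by
    intro c hc
    obtain ⟨v, hv, hcv⟩ := mem_spectrum_iff_exists_mulVec.1 hc
    exact followerLaplacian_eigenvalue_re_pos hG hreach hv hcv
  obtain ⟨r, R, hr, hR, hbd⟩ := exists_bounds_of_finite (Set.toFinite _) hre
  obtain ⟨K, hK⟩ := h.exists_gain (P.rcon + P.rcom) hr hR
  refine ⟨K.submatrix id Sum.inl, K.submatrix id Sum.inr,
    exists_norm_delayCompanion_pow_lt_one fun ζ y hζ hy => ?_⟩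
  refine nominal_eq_zero (K := K) (fun v hv => ?_) (fun c v hv hcv η hη => ?_) hy
  · by_contra hv0
    have := followerLaplacian_eigenvalue_re_pos hG hreach hv0 (μ := 0) (by rw [hv, zero_smul])
    simp at this
  · have := hbd c (mem_spectrum_iff_exists_mulVec.2 ⟨v, hv, hcv⟩)
    exact hK ζ c hζ this.1 this.2 η hη

theorem MultiAgentSystem.IsClosedLoopTrajectory.norm_stack_le {P : MultiAgentSystem N n m p q}
    {w : Uncertainty N n m p q} {G₁ : Matrix (Fin p × Fin k) (Fin p × Fin k) ℝ}
    {G₂ : Matrix (Fin p × Fin k) (Fin p) ℝ} {Kx : Matrix (Fin m) (Fin n) ℝ}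
    {Kz : Matrix (Fin m) (Fin p × Fin k) ℝ} {v : ℤ → Fin q → ℝ} {x : Fin N → ℤ → Fin n → ℝ}
    {z : Fin N → ℤ → Fin p × Fin k → ℝ} {u : Fin N → ℤ → Fin m → ℝ}
    (h : P.IsClosedLoopTrajectory w G₁ G₂ Kx Kz v x z u) (hv : ∀ t, 0 ≤ t → v t = 0) {M ρ : ℝ}
    (hM : ∀ t : ℕ, ‖closedLoopMatrix P w G₁ G₂ Kx Kz ^ t‖ ≤ M * ρ ^ t) {D : ℝ}
    (hD : ∀ s : ℤ, -((P.rcon : ℤ) + P.rcom) ≤ s → s ≤ 0 →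
      ‖stack (fun i => x i s) (fun i => z i s)‖ ≤ D) (t : ℕ) :
    ‖stack (fun i => x i t) (fun i => z i t)‖ ≤ M * ρ ^ t * D :=
  norm_le_of_norm_delayCompanion_pow_le (ξ := fun t => stack (fun i => x i t) (fun i => z i t))
    hM (fun t ht => h.stack_step ht (hv t ht)) (fun s hs => hD s (by push_cast at hs; exact hs)) t

theorem norm_le_norm_stack (x : Fin N → Fin n → ℝ) (z : Fin N → Fin p × Fin k → ℝ) (i : Fin N) :
    ‖x i‖ ≤ ‖stack x z‖ ∧ ‖z i‖ ≤ ‖stack x z‖ :=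
  ⟨(pi_norm_le_iff_of_nonneg (norm_nonneg _)).2 fun b => norm_le_pi_norm (stack x z) (i, Sum.inl b),
    (pi_norm_le_iff_of_nonneg (norm_nonneg _)).2 fun b =>
      norm_le_pi_norm (stack x z) (i, Sum.inr b)⟩

theorem norm_stack_le {x : Fin N → Fin n → ℝ} {z : Fin N → Fin p × Fin k → ℝ} {D : ℝ}
    (hD : 0 ≤ D) (h : ∀ i, ‖x i‖ ≤ D ∧ ‖z i‖ ≤ D) : ‖stack x z‖ ≤ D := by
  refine (pi_norm_le_iff_of_nonneg hD).2 fun ⟨i, s⟩ => ?_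
  rcases s with b | b
  · exact (norm_le_pi_norm (x i) b).trans (h i).1
  · exact (norm_le_pi_norm (z i) b).trans (h i).2

theorem nominalExponentiallyStable_of_norm_pow_lt_one {P : MultiAgentSystem N n m p q}
    {G₁ : Matrix (Fin p × Fin k) (Fin p × Fin k) ℝ}
    {G₂ : Matrix (Fin p × Fin k) (Fin p) ℝ} {Kx : Matrix (Fin m) (Fin n) ℝ}
    {Kz : Matrix (Fin m) (Fin p × Fin k) ℝ} {T : ℕ} (hT : 0 < T)
    (h : ‖closedLoopMatrix P 0 G₁ G₂ Kx Kz ^ T‖ < 1) :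
    P.NominalExponentiallyStable G₁ G₂ Kx Kz := by
  obtain ⟨M, ρ, hM, hρ, hρ1, hle⟩ := exists_norm_pow_le hT h
  refine ⟨M, ρ, hM, hρ, hρ1, fun x z u htr D hD i t => ?_⟩
  have hD0 : 0 ≤ D := (norm_nonneg _).trans
    (hD i 0 (neg_nonpos.2 (by positivity)) le_rfl).1
  have key := htr.norm_stack_le (fun _ _ => rfl) hle (D := D)
    (fun s hs hs0 => norm_stack_le hD0 fun i => hD i s hs hs0) t
  have := norm_le_norm_stack (fun i => x i t) (fun i => z i t) i
  exact ⟨this.1.trans key, this.2.trans key⟩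

theorem tendsto_internalState {P : MultiAgentSystem N n m p q} {w : Uncertainty N n m p q}
    {G₁ : Matrix (Fin p × Fin k) (Fin p × Fin k) ℝ}
    {G₂ : Matrix (Fin p × Fin k) (Fin p) ℝ} {Kx : Matrix (Fin m) (Fin n) ℝ}
    {Kz : Matrix (Fin m) (Fin p × Fin k) ℝ} {T : ℕ} (hT : 0 < T)
    (h : ‖closedLoopMatrix P w G₁ G₂ Kx Kz ^ T‖ < 1) {v : ℤ → Fin q → ℝ}
    {x : Fin N → ℤ → Fin n → ℝ}
    {z : Fin N → ℤ → Fin p × Fin k → ℝ} {u : Fin N → ℤ → Fin m → ℝ}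
    (htr : P.IsClosedLoopTrajectory w G₁ G₂ Kx Kz v x z u) (hv : ∀ t, 0 ≤ t → v t = 0)
    (i : Fin N) : Filter.Tendsto (fun t : ℕ => z i t) Filter.atTop (𝓝 0) := by
  obtain ⟨M, ρ, hM, hρ, hρ1, hle⟩ := exists_norm_pow_le hT h
  set D := ∑ s ∈ Finset.Icc (-((P.rcon : ℤ) + P.rcom)) 0,
    ‖stack (fun i => x i s) (fun i => z i s)‖ with hD
  have key := htr.norm_stack_le hv hle (D := D) fun s hs hs0 =>
    Finset.single_le_sum (f := fun s => ‖stack (fun i => x i s) (fun i => z i s)‖)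
      (fun _ _ => norm_nonneg _) (Finset.mem_Icc.2 ⟨hs, hs0⟩)
  refine squeeze_zero_norm (fun t => (norm_le_norm_stack (fun i => x i t)
    (fun i => z i t) i).2.trans (key t)) ?_
  have := ((tendsto_pow_atTop_nhds_zero_of_lt_one hρ.le hρ1).const_mul M).mul_const D
  simpa using this

theorem isOpen_closedLoopMatrix_pow_lt_one (P : MultiAgentSystem N n m p q)
    (G₁ : Matrix (Fin p × Fin k) (Fin p × Fin k) ℝ)
    (G₂ : Matrix (Fin p × Fin k) (Fin p) ℝ) (Kx : Matrix (Fin m) (Fin n) ℝ)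
    (Kz : Matrix (Fin m) (Fin p × Fin k) ℝ) (T : ℕ) :
    IsOpen {w : Uncertainty N n m p q | ‖closedLoopMatrix P w G₁ G₂ Kx Kz ^ T‖ < 1} := by
  have h1 : Continuous fun w : Uncertainty N n m p q =>
      closedLoopMatrix P w G₁ G₂ Kx Kz :=
    (continuous_delayCompanion (P.rcon + P.rcom)).comp
      ((continuous_currentMatrix P G₁ G₂).prodMk (continuous_delayedMatrix P Kx Kz))
  exact isOpen_lt (continuous_norm.comp (h1.pow T)) continuous_const

end Stability

/-! ### Output regulation by the internal model -/

section Regulation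

open scoped Matrix

variable {N n m p q k : ℕ}

/-- The difference operator `∑_{i < l} c_i s^i`, where `s` is the forward shift. -/
def shiftSum {V : Type*} [AddCommGroup V] [Module ℝ V] (c : ℕ → ℝ) (l : ℕ) (g : ℤ → V) (t : ℤ) :
    V := ∑ i ∈ Finset.range l, c i • g (t + i)

theorem mulVec_shiftSum {a b : Type*} [Fintype b] (M : Matrix a b ℝ) (c : ℕ → ℝ) (l : ℕ)
    (g : ℤ → b → ℝ) (t : ℤ) : M *ᵥ shiftSum c l g t = shiftSum c l (fun t => M *ᵥ g t) t := by
  simp only [shiftSum, Matrix.mulVec_sum, Matrix.mulVec_smul]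

theorem shiftSum_cons {V : Type*} [AddCommGroup V] [Module ℝ V] (c : ℕ → ℝ) (l : ℕ)
    (g₀ : ℤ → V) (g : Fin N → ℤ → V) (t : ℤ) (j : Fin (N + 1)) :
    (Fin.cons (shiftSum c l g₀ t) (fun i => shiftSum c l (g i) t) : Fin (N + 1) → V) j =
      shiftSum c l (fun t => (Fin.cons (g₀ t) (fun i => g i t) : Fin (N + 1) → V) j) t := by
  refine Fin.cases ?_ (fun i => ?_) j <;> simp

theorem sum_smul_shiftSum_sub {V : Type*} [AddCommGroup V] [Module ℝ V] {ι : Type*} [Fintype ι]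
    (a : ι → ℝ) (c : ℕ → ℝ) (l : ℕ) (g₀ : ℤ → V) (g : ι → ℤ → V) (t : ℤ) :
    ∑ j, a j • (shiftSum c l g₀ t - shiftSum c l (g j) t) =
      shiftSum c l (fun t => ∑ j, a j • (g₀ t - g j t)) t := by
  simp only [shiftSum, ← Finset.sum_sub_distrib, Finset.smul_sum]
  rw [Finset.sum_comm]
  refine Finset.sum_congr rfl fun i _ => Finset.sum_congr rfl fun j _ => ?_
  rw [← smul_sub, smul_comm]

theorem shiftSum_neg {V : Type*} [AddCommGroup V] [Module ℝ V] (c : ℕ → ℝ) (l : ℕ)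
    (g : ℤ → V) (t : ℤ) : -shiftSum c l g t = shiftSum c l (fun t => -g t) t := by
  simp [shiftSum]

theorem shiftSum_add {V : Type*} [AddCommGroup V] [Module ℝ V] (c : ℕ → ℝ) (l : ℕ)
    (g g' : ℤ → V) (t : ℤ) :
    shiftSum c l g t + shiftSum c l g' t = shiftSum c l (fun t => g t + g' t) t := by
  simp [shiftSum, Finset.sum_add_distrib]

theorem shiftSum_congr {V : Type*} [AddCommGroup V] [Module ℝ V] {c : ℕ → ℝ} {l : ℕ}
    {g g' : ℤ → V} {t t' : ℤ} (h : ∀ i : ℕ, g (t + i) = g' (t' + i)) :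
    shiftSum c l g t = shiftSum c l g' t' :=
  Finset.sum_congr rfl fun i _ => by rw [h i]

theorem output_shiftSum (P : MultiAgentSystem N n m p q) (w : Uncertainty N n m p q)
    (v : ℤ → Fin q → ℝ) (x : Fin N → ℤ → Fin n → ℝ) (c : ℕ → ℝ) (l : ℕ) (t : ℤ)
    (j : Fin (N + 1)) :
    P.output w (shiftSum c l v) (fun i => shiftSum c l (x i)) t j =
      shiftSum c l (fun t => P.output w v x t j) t := by
  simp only [MultiAgentSystem.output, mulVec_shiftSum, shiftSum_neg]
  exact shiftSum_cons c l _ _ t j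

theorem virtualOutput_shiftSum (P : MultiAgentSystem N n m p q) (w : Uncertainty N n m p q)
    (v : ℤ → Fin q → ℝ) (x : Fin N → ℤ → Fin n → ℝ) (c : ℕ → ℝ) (l : ℕ) (i : Fin N) (t : ℤ) :
    P.virtualOutput w (shiftSum c l v) (fun i => shiftSum c l (x i)) i t =
      shiftSum c l (P.virtualOutput w v x i) t := by
  simp only [MultiAgentSystem.virtualOutput, output_shiftSum]
  exact sum_smul_shiftSum_sub _ c l _ (fun j t => P.output w v x t j) t

theorem eta_shiftSum (P : MultiAgentSystem N n m p q)
    (x : Fin N → ℤ → Fin n → ℝ) (c : ℕ → ℝ) (l : ℕ) (i : Fin N) (t : ℤ) :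
    P.eta (fun i => shiftSum c l (x i)) i t = shiftSum c l (P.eta x i) t := by
  have h : ∀ (t : ℤ) (j : Fin (N + 1)), MultiAgentSystem.nodeState
      (fun i => shiftSum c l (x i)) t j =
        shiftSum c l (fun t => MultiAgentSystem.nodeState x t j) t := by
    intro t j
    have := shiftSum_cons c l (fun _ => (0 : Fin n → ℝ)) x t j
    rw [show shiftSum c l (fun _ => (0 : Fin n → ℝ)) t = 0 by simp [shiftSum]] at this
    exact this
  simp only [MultiAgentSystem.eta, h]
  rw [sum_smul_shiftSum_sub (P.a i.succ) c l
    (fun t => MultiAgentSystem.nodeState x t i.succ)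
    (fun j t => MultiAgentSystem.nodeState x t j)]
  exact shiftSum_congr fun j => by
    rw [show t - (P.rcom : ℤ) + j = t + j - P.rcom by ring]
    rfl

/-- Closed-loop trajectories are stable under difference operators. -/
theorem MultiAgentSystem.IsClosedLoopTrajectory.shiftSum {P : MultiAgentSystem N n m p q}
    {w : Uncertainty N n m p q} {G₁ : Matrix (Fin p × Fin k) (Fin p × Fin k) ℝ}
    {G₂ : Matrix (Fin p × Fin k) (Fin p) ℝ} {Kx : Matrix (Fin m) (Fin n) ℝ}
    {Kz : Matrix (Fin m) (Fin p × Fin k) ℝ} {v : ℤ → Fin q → ℝ} {x : Fin N → ℤ → Fin n → ℝ}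
    {z : Fin N → ℤ → Fin p × Fin k → ℝ} {u : Fin N → ℤ → Fin m → ℝ}
    (h : P.IsClosedLoopTrajectory w G₁ G₂ Kx Kz v x z u) (c : ℕ → ℝ) (l : ℕ) :
    P.IsClosedLoopTrajectory w G₁ G₂ Kx Kz (CoopReg.shiftSum c l v)
      (fun i => CoopReg.shiftSum c l (x i)) (fun i => CoopReg.shiftSum c l (z i))
      (fun i => CoopReg.shiftSum c l (u i)) where
  plant i t ht := by
    simp only [mulVec_shiftSum]
    rw [shiftSum_congr (g := fun t => P.plantB w i *ᵥ u i t) (t := t - P.rcon)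
      (g' := fun t => P.plantB w i *ᵥ u i (t - P.rcon)) (t' := t)
      (fun j => by rw [show t - (P.rcon : ℤ) + j = t + j - P.rcon by ring]), shiftSum_add, shiftSum_add]
    refine shiftSum_congr fun j => ?_
    rw [add_right_comm]
    exact h.plant i (t + j) (by positivity)
  control i t ht := by
    rw [eta_shiftSum]
    simp only [mulVec_shiftSum]
    rw [shiftSum_congr (g := fun t => Kz *ᵥ z i t) (t := t - P.rcom)
      (g' := fun t => Kz *ᵥ z i (t - P.rcom)) (t' := t)
      (fun j => by rw [show t - (P.rcom : ℤ) + j = t + j - P.rcom by ring]), shiftSum_add]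
    exact shiftSum_congr fun j => h.control i (t + j) (by
      have : (0 : ℤ) ≤ j := by positivity
      linarith)
  internalModel i t ht := by
    rw [virtualOutput_shiftSum]
    simp only [mulVec_shiftSum]
    rw [shiftSum_add]
    refine shiftSum_congr fun j => ?_
    rw [add_right_comm]
    exact h.internalModel i (t + j) (by positivity)

/-- With a scalar input the controllability matrix is square, hence invertible; φ is the row of its
inverse that singles out the last column βᵏ⁻¹σ. -/
theorem exists_dual_vector {β : Matrix (Fin k) (Fin k) ℝ} {σ : Matrix (Fin k) (Fin 1) ℝ}
    (h : IsControllable β σ) :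
    ∃ φ : Fin k → ℝ, ∀ l < k, (φ ᵥ* (β ^ l * σ)) 0 = if l + 1 = k then 1 else 0 := by
  have hinj : Function.Injective (controllabilityMatrix β σ).vecMulLinear := by
    rw [← LinearMap.ker_eq_bot, LinearMap.ker_eq_bot']
    intro y hy
    exact eq_zero_of_vecMul_eq_zero (by rw [Fintype.card_fin]; exact h) hy
  have hsur := (LinearMap.injective_iff_surjective_of_finrank_eq_finrank
    (by simp)).1 hinj
  obtain ⟨φ, hφ⟩ := hsur fun lj => if (lj.1 : ℕ) + 1 = k then 1 else 0
  exact ⟨φ, fun l hl => congrFun hφ (⟨l, hl⟩, 0)⟩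

/-- A copy of the internal model differentiates its output: the characteristic difference operator
recovers its input. -/
theorem dotProduct_shiftSum_charpoly {β : Matrix (Fin k) (Fin k) ℝ} {σ : Matrix (Fin k) (Fin 1) ℝ}
    (hk : 0 < k) {φ : Fin k → ℝ}
    (hφ : ∀ l < k, (φ ᵥ* (β ^ l * σ)) 0 = if l + 1 = k then 1 else 0) {ζ : ℤ → Fin k → ℝ}
    {e : ℤ → ℝ} (hζ : ∀ t, 0 ≤ t → ζ (t + 1) = β *ᵥ ζ t + σ *ᵥ fun _ => e t) {t : ℤ}
    (ht : 0 ≤ t) : φ ⬝ᵥ shiftSum β.charpoly.coeff (k + 1) ζ t = e t := by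
  -- Variation of constants. Under φ and the coefficients of the characteristic polynomial, the free
  -- response vanishes by Cayley-Hamilton. Of the input samples only `j = 0` with `i = k` survives,
  -- with leading coefficient 1.
  have hsol : ∀ i : ℕ, ζ (t + i) = β ^ i *ᵥ ζ t +
      ∑ j ∈ Finset.range i, (β ^ (i - 1 - j) * σ) *ᵥ fun _ => e (t + j) := by
    intro i
    induction i with
    | zero => simp
    | succ i ih =>
      rw [Nat.cast_succ, ← add_assoc, hζ _ (by positivity), ih, Matrix.mulVec_add,
        Matrix.mulVec_mulVec, ← pow_succ', Finset.sum_range_succ, Matrix.mulVec_sum, add_assoc]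
      congr 2
      · refine Finset.sum_congr rfl fun j hj => ?_
        rw [Finset.mem_range] at hj
        rw [Matrix.mulVec_mulVec, ← Matrix.mul_assoc, ← pow_succ',
          show i - 1 - j + 1 = i + 1 - 1 - j by omega]
      · simp
  have hterm : ∀ (l : ℕ) (r : ℝ), l < k →
      φ ⬝ᵥ ((β ^ l * σ) *ᵥ fun _ => r) = if l + 1 = k then r else 0 := by
    intro l r hl
    rw [Matrix.dotProduct_mulVec, dotProduct, Fin.sum_univ_one, hφ l hl]
    split_ifs <;> simp
  have hin : ∀ i ∈ Finset.range (k + 1), φ ⬝ᵥ ζ (t + i) = φ ⬝ᵥ (β ^ i *ᵥ ζ t) +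
      if i = k then e t else 0 := by
    intro i hi
    rw [Finset.mem_range] at hi
    rw [hsol i, dotProduct_add, dotProduct_sum]
    congr 1
    rw [Finset.sum_congr rfl fun j hj => hterm (i - 1 - j) (e (t + j))
      (by rw [Finset.mem_range] at hj; omega)]
    split_ifs with hik
    · rw [Finset.sum_eq_single_of_mem 0 (Finset.mem_range.2 (by omega))]
      · rw [if_pos (by omega)]; simp
      · intro j hj hj0
        rw [Finset.mem_range] at hj
        rw [if_neg (by omega)]
    · refine Finset.sum_eq_zero fun j hj => ?_
      rw [Finset.mem_range] at hj
      rw [if_neg (by omega)]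
  have hdeg : β.charpoly.natDegree = k := by
    rw [Matrix.charpoly_natDegree_eq_dim, Fintype.card_fin]
  have hch : ∑ i ∈ Finset.range (k + 1), β.charpoly.coeff i • β ^ i = 0 := by
    have := Matrix.aeval_self_charpoly β
    rwa [Polynomial.aeval_eq_sum_range, hdeg] at this
  rw [shiftSum, dotProduct_sum, Finset.sum_congr rfl fun i hi => by
    rw [dotProduct_smul, hin i hi, smul_add]]
  rw [Finset.sum_add_distrib]
  have h1 : ∑ i ∈ Finset.range (k + 1), β.charpoly.coeff i • (φ ⬝ᵥ (β ^ i *ᵥ ζ t)) = 0 := by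
    have := congrArg (fun M => φ ⬝ᵥ (M *ᵥ ζ t)) hch
    simpa only [Matrix.sum_mulVec, dotProduct_sum, Matrix.smul_mulVec, dotProduct_smul,
      Matrix.zero_mulVec, dotProduct_zero] using this
  have hlead : β.charpoly.coeff k = 1 := by
    have := (Matrix.charpoly_monic β).coeff_natDegree
    rwa [hdeg] at this
  rw [h1, zero_add, Finset.sum_eq_single_of_mem k (Finset.mem_range.2 (by omega)), if_pos rfl,
    hlead, one_smul]
  intro j _ hj
  rw [if_neg hj, smul_zero]

theorem shiftSum_minpoly_eq_zero {P : MultiAgentSystem N n m p q} {v : ℤ → Fin q → ℝ}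
    (hv : P.IsExosystemTrajectory v) {k : ℕ} (hk : (minpoly ℝ P.S).natDegree = k) {t : ℤ}
    (ht : 0 ≤ t) : shiftSum (minpoly ℝ P.S).coeff (k + 1) v t = 0 := by
  have hpow : ∀ i : ℕ, v (t + i) = P.S ^ i *ᵥ v t := by
    intro i
    induction i with
    | zero => simp
    | succ i ih =>
      rw [Nat.cast_succ, ← add_assoc, hv _ (by positivity), ih, Matrix.mulVec_mulVec, pow_succ']
  have h := minpoly.aeval ℝ P.S
  rw [Polynomial.aeval_eq_sum_range, hk] at h
  have := congrArg (fun M => M *ᵥ v t) h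
  simp only [Matrix.sum_mulVec, Matrix.smul_mulVec, Matrix.zero_mulVec] at this
  simpa only [shiftSum, hpow] using this

/-- The minimal polynomial of `S` in the shift turns the trajectory into one with v = 0, whose
internal states tend to zero by `hstab`. Applied to each copy, φ reads off the virtual output of the
original trajectory. The uncertainty does not enter G₁ and G₂, so this works for every `w` in `W`.
-/
theorem robustlyRegulates_of_norm_pow_lt_one {P : MultiAgentSystem N n m p q}
    {G₁ : Matrix (Fin p × Fin k) (Fin p × Fin k) ℝ}
    {G₂ : Matrix (Fin p × Fin k) (Fin p) ℝ} {Kx : Matrix (Fin m) (Fin n) ℝ}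
    {Kz : Matrix (Fin m) (Fin p × Fin k) ℝ} (hq : 0 < q)
    (hIM : IsMinimalPCopyInternalModel P.S G₁ G₂) (hdet : IsUnit (followerLaplacian P.a).det)
    {W : Set (Uncertainty N n m p q)} (hW : IsOpen W) (h0 : 0 ∈ W)
    (hstab : ∀ w ∈ W, ∀ v x z u, P.IsClosedLoopTrajectory w G₁ G₂ Kx Kz v x z u →
      (∀ t, 0 ≤ t → v t = 0) →
        ∀ i, Filter.Tendsto (fun t : ℕ => z i t) Filter.atTop (𝓝 0)) :
    P.RobustlyRegulates G₁ G₂ Kx Kz := by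
  obtain ⟨β, σ, hβ, hβσ, rfl, rfl⟩ := hIM
  have hdeg : (minpoly ℝ P.S).natDegree = k := by
    rw [← hβ, Matrix.charpoly_natDegree_eq_dim, Fintype.card_fin]
  have hk : 0 < k := by
    have : Nonempty (Fin q) := ⟨⟨0, hq⟩⟩
    rw [← hdeg]
    exact minpoly.natDegree_pos (Matrix.isIntegral P.S)
  obtain ⟨φ, hφ⟩ := exists_dual_vector hβσ
  refine ⟨W, hW, h0, fun w hw v x z u hv htr => ?_⟩
  have hz := hstab w hw _ _ _ _ (htr.shiftSum (minpoly ℝ P.S).coeff (k + 1))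
    (fun t ht => shiftSum_minpoly_eq_zero hv hdeg ht)
  have hvirt : ∀ i, Filter.Tendsto (fun t : ℕ => P.virtualOutput w v x i t) Filter.atTop (𝓝 0) := by
    intro i
    rw [tendsto_pi_nhds]
    intro l
    have h1 : ∀ t : ℕ, φ ⬝ᵥ (fun a => shiftSum (minpoly ℝ P.S).coeff (k + 1) (z i) t (l, a)) =
        P.virtualOutput w v x i t l := by
      intro t
      rw [← hβ]
      have h2 := dotProduct_shiftSum_charpoly hk hφ (ζ := fun t a => z i t (l, a))
        (e := fun t => P.virtualOutput w v x i t l) (fun t ht => by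
          funext a
          have := congrFun (htr.internalModel i t ht) (l, a)
          rw [Pi.add_apply, one_kronecker_mulVec, one_kronecker_col_mulVec] at this
          rw [this, Pi.add_apply]
          congr 1
          rw [Matrix.mulVec, dotProduct, Fin.sum_univ_one]) (t := t) (by positivity)
      rw [← h2]
      congr 1
      funext a
      simp [shiftSum]
    have h3 : Filter.Tendsto (fun t : ℕ => φ ⬝ᵥ
        (fun a => shiftSum (minpoly ℝ P.S).coeff (k + 1) (z i) t (l, a))) Filter.atTop (𝓝 0) := by
      have hc : Continuous fun y : Fin p × Fin k → ℝ => φ ⬝ᵥ fun a => y (l, a) := by fun_prop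
      have := (hc.tendsto 0).comp (hz i)
      simpa [Function.comp_def, dotProduct] using this
    simp only [h1] at h3
    exact h3
  intro i
  -- Differences of outputs are differences of regulated outputs, and the leader's is 0; hence the
  -- virtual outputs are `H` applied to the regulated ones.
  have hreg : ∀ t : ℤ, P.regulatedOutput w v x i t =
      ∑ j, (followerLaplacian P.a)⁻¹ i j • P.virtualOutput w v x j t := by
    intro t
    have h1 : ∀ j, P.virtualOutput w v x j t =
        ∑ l, followerLaplacian P.a j l • P.regulatedOutput w v x l t := by
      intro j
      rw [← sum_smul_sub_eq_followerLaplacian]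
      refine Finset.sum_congr rfl fun l _ => ?_
      congr 1
      refine Fin.cases ?_ (fun l => ?_) l
      · simp [MultiAgentSystem.regulatedOutput]
      · simp [MultiAgentSystem.regulatedOutput]
    simp only [h1, Finset.smul_sum, smul_smul]
    rw [Finset.sum_comm]
    simp only [← Finset.sum_smul, ← Matrix.mul_apply]
    rw [Matrix.nonsing_inv_mul _ hdet, Finset.sum_eq_single i]
    · simp
    · intro j _ hj
      rw [Matrix.one_apply_ne hj.symm, zero_smul]
    · simp
  simp only [hreg]
  have := tendsto_finsetSum Finset.univ fun j _ =>
    (hvirt j).const_smul ((followerLaplacian P.a)⁻¹ i j)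
  simpa using this

end Regulation

/-! ### Nodes that the leader does not reach -/

section Necessity

open scoped Matrix

variable {N n m p q k : ℕ}

/-- The solution of the delay equation `ξ(t+1) = F(ξ(t), ξ(t-d))` with constant history. -/
def delaySolution {V : Type*} (F : V → V → V) (d : ℕ) (ξ₀ : V) : ℕ → V
  | 0 => ξ₀
  | t + 1 => F (delaySolution F d ξ₀ t) (delaySolution F d ξ₀ (t - d))

theorem exists_delaySolution {V : Type*} (F : V → V → V) (d : ℕ) (ξ₀ : V) :
    ∃ ξ : ℤ → V, (∀ s, s ≤ 0 → ξ s = ξ₀) ∧ ∀ t, 0 ≤ t → ξ (t + 1) = F (ξ t) (ξ (t - d)) := by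
  refine ⟨fun t => delaySolution F d ξ₀ t.toNat, fun s hs => ?_, fun t ht => ?_⟩
  · simp only [Int.toNat_of_nonpos hs, delaySolution]
  · simp only [Int.toNat_add ht zero_le_one, Int.toNat_one, delaySolution,
      show (t - d).toNat = t.toNat - d by omega]

theorem exists_isClosedLoopTrajectory (P : MultiAgentSystem N n m p q)
    (w : Uncertainty N n m p q) (G₁ : Matrix (Fin p × Fin k) (Fin p × Fin k) ℝ)
    (G₂ : Matrix (Fin p × Fin k) (Fin p) ℝ) (Kx : Matrix (Fin m) (Fin n) ℝ)
    (Kz : Matrix (Fin m) (Fin p × Fin k) ℝ) (x₀ : Fin N → Fin n → ℝ)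
    (z₀ : Fin N → Fin p × Fin k → ℝ) :
    ∃ x z u, P.IsClosedLoopTrajectory w G₁ G₂ Kx Kz (fun _ => 0) x z u ∧
      ∀ s, s ≤ 0 → ∀ i, x i s = x₀ i ∧ z i s = z₀ i := by
  -- The virtual output at a time depends only on the values at that time, so it may be evaluated at
  -- 0 on constant signals.
  obtain ⟨ξ, h0, hξ⟩ := exists_delaySolution
    (fun ξ ξ' : Fin N → (Fin n → ℝ) × (Fin p × Fin k → ℝ) => fun i =>
      (P.plantA w i *ᵥ (ξ i).1 + P.plantB w i *ᵥ (Kx *ᵥ (∑ j, P.a i.succ j •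
          ((Fin.cons 0 fun l => (ξ' l).1 : Fin (N + 1) → Fin n → ℝ) i.succ -
            (Fin.cons 0 fun l => (ξ' l).1 : Fin (N + 1) → Fin n → ℝ) j)) + Kz *ᵥ (ξ' i).2),
        G₁ *ᵥ (ξ i).2 + G₂ *ᵥ P.virtualOutput w (fun _ => 0) (fun l _ => (ξ l).1) i 0))
    (P.rcon + P.rcom) (fun i => (x₀ i, z₀ i))
  refine ⟨fun i t => (ξ t i).1, fun i t => (ξ t i).2, fun i t =>
    Kx *ᵥ P.eta (fun i t => (ξ t i).1) i t + Kz *ᵥ (ξ (t - P.rcom) i).2,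
    ⟨fun i t ht => ?_, fun i t _ => rfl, fun i t ht => ?_⟩, fun s hs i => by simp [h0 s hs]⟩
  · have e : t - ((P.rcon + P.rcom : ℕ) : ℤ) = t - P.rcon - P.rcom := by push_cast; ring
    simp only [hξ t ht, Matrix.mulVec_zero, add_zero, e]
    rfl
  · simp only [hξ t ht]
    rfl

/-- Agents that only receive information from one another stay synchronised. -/
theorem MultiAgentSystem.IsClosedLoopTrajectory.synchronised {P : MultiAgentSystem N n m p q}
    {G₁ : Matrix (Fin p × Fin k) (Fin p × Fin k) ℝ}
    {G₂ : Matrix (Fin p × Fin k) (Fin p) ℝ} {Kx : Matrix (Fin m) (Fin n) ℝ}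
    {Kz : Matrix (Fin m) (Fin p × Fin k) ℝ} {v : ℤ → Fin q → ℝ} {x : Fin N → ℤ → Fin n → ℝ}
    {z : Fin N → ℤ → Fin p × Fin k → ℝ} {u : Fin N → ℤ → Fin m → ℝ}
    (h : P.IsClosedLoopTrajectory 0 G₁ G₂ Kx Kz v x z u) {U : Set (Fin N)}
    (hU : ∀ i ∈ U, ∀ l, P.a i.succ l ≠ 0 → ∃ j ∈ U, l = j.succ)
    {x₀ : Fin n → ℝ} {z₀ : Fin p × Fin k → ℝ}
    (h0 : ∀ s, s ≤ 0 → ∀ i ∈ U, x i s = x₀ ∧ z i s = z₀) (t : ℕ) :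
    (∀ s, s ≤ (t : ℤ) → ∀ i ∈ U, ∀ j ∈ U, x i s = x j s) ∧ ∀ i ∈ U, z i t = G₁ ^ t *ᵥ z₀ := by
  have hz : ∀ t : ℤ, t ≤ 0 → ∀ i ∈ U, ∀ j ∈ U, z i t = z j t := fun t ht i hi j hj =>
    (h0 t ht i hi).2.trans (h0 t ht j hj).2.symm
  have heta : ∀ t : ℤ, (∀ i ∈ U, ∀ j ∈ U, x i (t - P.rcom) = x j (t - P.rcom)) →
      ∀ i ∈ U, P.eta x i t = 0 := by
    intro t ht i hi
    refine Finset.sum_eq_zero fun l _ => ?_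
    by_cases hl : P.a i.succ l = 0
    · rw [hl, zero_smul]
    · obtain ⟨j, hj, rfl⟩ := hU i hi l hl
      simp [MultiAgentSystem.nodeState, ht i hi j hj]
  have hvirt : ∀ t : ℤ, (∀ i ∈ U, ∀ j ∈ U, x i t = x j t) →
      ∀ i ∈ U, P.virtualOutput 0 v x i t = 0 := by
    intro t ht i hi
    refine Finset.sum_eq_zero fun l _ => ?_
    by_cases hl : P.a i.succ l = 0
    · rw [hl, zero_smul]
    · obtain ⟨j, hj, rfl⟩ := hU i hi l hl
      simp [MultiAgentSystem.output, MultiAgentSystem.plantC, ht i hi j hj]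
  -- The induction also carries equality of the internal states and all earlier times, because the
  -- inputs use delayed values of both x and z.
  suffices H : ∀ t : ℕ, (∀ s, s ≤ (t : ℤ) → ∀ i ∈ U, ∀ j ∈ U, x i s = x j s ∧ z i s = z j s) ∧
      ∀ i ∈ U, z i t = G₁ ^ t *ᵥ z₀ from
    ⟨fun s hs i hi j hj => ((H t).1 s hs i hi j hj).1, (H t).2⟩
  intro t
  induction t with
  | zero =>
    refine ⟨fun s hs i hi j hj => ?_, fun i hi => ?_⟩
    · have hs' : s ≤ 0 := by simpa using hs
      exact ⟨(h0 s hs' i hi).1.trans (h0 s hs' j hj).1.symm, hz s hs' i hi j hj⟩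
    · rw [pow_zero, Matrix.one_mulVec]
      exact (h0 _ le_rfl i hi).2
  | succ t ih =>
    obtain ⟨ih1, ih2⟩ := ih
    have hst : ∀ i ∈ U, z i ((t : ℤ) + 1) = G₁ *ᵥ z i t := by
      intro i hi
      rw [h.internalModel i t (by positivity), hvirt t (fun i hi j hj => (ih1 t le_rfl i hi j hj).1)
        i hi, Matrix.mulVec_zero, add_zero]
    refine ⟨fun s hs i hi j hj => ?_, fun i hi => ?_⟩
    · rcases (Nat.cast_succ (R := ℤ) t ▸ hs).lt_or_eq with hs | rfl
      · exact ih1 s (Int.lt_add_one_iff.1 hs) i hi j hj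
      · rw [hst i hi, hst j hj, (ih1 t le_rfl i hi j hj).2]
        refine ⟨?_, rfl⟩
        have hle : (t : ℤ) - P.rcon - P.rcom ≤ t := by
          have : (0 : ℤ) ≤ P.rcon := by positivity
          have : (0 : ℤ) ≤ P.rcom := by positivity
          linarith
        have he := heta (t - P.rcon) fun i hi j hj => (ih1 _ hle i hi j hj).1
        have ht : -(P.rcon : ℤ) ≤ t - P.rcon := by
          have : (0 : ℤ) ≤ t := by positivity
          linarith
        rw [h.plant i t (by positivity), h.plant j t (by positivity), h.control i _ ht,
          h.control j _ ht, he i hi, he j hj, (ih1 t le_rfl i hi j hj).1,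
          (ih1 _ hle i hi j hj).2]
        rfl
    · rw [Nat.cast_succ, hst i hi, ih2 i hi, Matrix.mulVec_mulVec, pow_succ']

/-- The powers of a real matrix with an eigenvalue on the unit circle do not tend to zero. -/
theorem not_tendsto_pow_mulVec_zero {ι : Type*} [Fintype ι] [DecidableEq ι] {M : Matrix ι ι ℝ}
    {μ : ℂ} (hμ : ‖μ‖ = 1) {y : ι → ℂ} (hy : y ≠ 0)
    (h : M.map Complex.ofReal *ᵥ y = μ • y) :
    ¬ ∀ z : ι → ℝ, Filter.Tendsto (fun t : ℕ => M ^ t *ᵥ z) Filter.atTop (𝓝 0) := by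
  intro hM
  obtain ⟨b, hb⟩ := Function.ne_iff.1 hy
  have hpow : ∀ t : ℕ, (M ^ t).map Complex.ofRealHom *ᵥ y = μ ^ t • y := by
    intro t
    induction t with
    | zero => simp [Matrix.map_one]
    | succ t ih =>
      rw [pow_succ, Matrix.map_mul, ← Matrix.mulVec_mulVec]
      erw [h]
      rw [Matrix.mulVec_smul, ih, smul_smul, pow_succ']
  -- The real and imaginary parts of `y` are two real initial vectors whose responses recombine to
  -- μᵗy, of constant modulus.
  have hsplit : ∀ t : ℕ, (((M ^ t *ᵥ fun c => (y c).re) b : ℝ) : ℂ) +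
      ((M ^ t *ᵥ fun c => (y c).im) b : ℝ) * Complex.I = μ ^ t * y b := by
    intro t
    rw [← smul_eq_mul (μ ^ t), ← Pi.smul_apply, ← hpow t]
    simp only [Matrix.mulVec, dotProduct, Complex.ofReal_sum, Complex.ofReal_mul, Finset.sum_mul,
      ← Finset.sum_add_distrib, Matrix.map_apply, Complex.ofRealHom_eq_coe]
    refine Finset.sum_congr rfl fun c _ => ?_
    rw [mul_assoc, ← mul_add, Complex.re_add_im]
  have hlim : Filter.Tendsto (fun t : ℕ => ‖μ ^ t * y b‖) Filter.atTop (𝓝 0) := by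
    simp only [← hsplit]
    have hc : ∀ z : ι → ℝ, Filter.Tendsto (fun t : ℕ => (((M ^ t *ᵥ z) b : ℝ) : ℂ))
        Filter.atTop (𝓝 0) := fun z => by
      have := (Complex.continuous_ofReal.tendsto 0).comp (tendsto_pi_nhds.1 (hM z) b)
      simpa [Function.comp_def] using this
    simpa using ((hc _).add ((hc _).mul_const Complex.I)).norm
  simp only [norm_mul, norm_pow, hμ, one_pow, one_mul] at hlim
  exact hb (norm_eq_zero.1 (tendsto_nhds_unique tendsto_const_nhds hlim))

theorem exists_eigenvector_internalModel {S : Matrix (Fin q) (Fin q) ℝ}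
    {G₁ : Matrix (Fin p × Fin k) (Fin p × Fin k) ℝ} {G₂ : Matrix (Fin p × Fin k) (Fin p) ℝ}
    (hp : 0 < p) (hq : 0 < q) (hIM : IsMinimalPCopyInternalModel S G₁ G₂) :
    ∃ μ ∈ complexSpectrum S, ∃ y, y ≠ 0 ∧ G₁.map Complex.ofReal *ᵥ y = μ • y := by
  obtain ⟨β, σ, hβ, -, rfl, -⟩ := hIM
  have hk : 0 < k := by
    have : Nonempty (Fin q) := ⟨⟨0, hq⟩⟩
    have := minpoly.natDegree_pos (Matrix.isIntegral (R := ℝ) S)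
    rwa [← hβ, Matrix.charpoly_natDegree_eq_dim, Fintype.card_fin] at this
  have : Nonempty (Fin k) := ⟨⟨0, hk⟩⟩
  obtain ⟨μ, hμ⟩ := spectrum.nonempty_of_isAlgClosed_of_finiteDimensional ℂ
    (β.map Complex.ofReal)
  obtain ⟨y, hy, hβy⟩ := mem_spectrum_iff_exists_mulVec.1 hμ
  refine ⟨μ, mem_complexSpectrum_of_charpoly_eq_minpoly hβ hμ, fun a => y a.2, fun h0 => hy ?_, ?_⟩
  · funext a
    exact congrFun h0 (⟨0, hp⟩, a)
  · rw [map_one_kronecker]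
    funext ⟨l, a⟩
    rw [one_kronecker_mulVec]
    exact congrFun hβy a

/-- The set `U` of unreached followers contains all in-neighbours of its members. Starting from x =
0 and a common z₀, its internal states are G₁ᵗz₀. Exponential stability would send these to zero for
every z₀, against the eigenvalue of modulus 1. -/
theorem reachable_of_nominalExponentiallyStable {P : MultiAgentSystem N n m p q}
    {G : Digraph (Fin (N + 1))} (hG : IsWeightedAdjacency G P.a)
    {G₁ : Matrix (Fin p × Fin k) (Fin p × Fin k) ℝ} {G₂ : Matrix (Fin p × Fin k) (Fin p) ℝ}
    {Kx : Matrix (Fin m) (Fin n) ℝ} {Kz : Matrix (Fin m) (Fin p × Fin k) ℝ}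
    (hstab : P.NominalExponentiallyStable G₁ G₂ Kx Kz) {μ : ℂ} (hμ : ‖μ‖ = 1)
    {y : Fin p × Fin k → ℂ} (hy : y ≠ 0) (hGy : G₁.map Complex.ofReal *ᵥ y = μ • y)
    (l : Fin (N + 1)) : Relation.ReflTransGen G.Adj 0 l := by
  obtain ⟨M, ρ, -, hρ, hρ1, hdec⟩ := hstab
  by_contra hl
  set U : Set (Fin N) := {i | ¬ Relation.ReflTransGen G.Adj 0 i.succ} with hUdef
  have hU : ∀ i ∈ U, ∀ l, P.a i.succ l ≠ 0 → ∃ j ∈ U, l = j.succ := by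
    intro i hi l hil
    have hadj : G.Adj l i.succ := (hG.pos_iff _ _).1 ((hG.nonneg _ _).lt_of_ne hil.symm)
    induction l using Fin.cases with
    | zero => exact absurd (Relation.ReflTransGen.single hadj) hi
    | succ j => exact ⟨j, fun hj => hi (hj.tail hadj), rfl⟩
  obtain ⟨i, rfl⟩ := Fin.exists_succ_eq.2 (fun h : l = 0 => hl (h ▸ Relation.ReflTransGen.refl))
  refine not_tendsto_pow_mulVec_zero hμ hy hGy fun z₀ => ?_
  obtain ⟨x, z, u, htr, h0⟩ := exists_isClosedLoopTrajectory P 0 G₁ G₂ Kx Kz (fun _ => 0)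
    (fun _ => z₀)
  have hz := fun t => (htr.synchronised hU (fun s hs i _ => h0 s hs i) t).2 i hl
  have hb := fun t => (hdec x z u htr ‖z₀‖ (fun i s _ hs => by simp [h0 s hs i]) i t).2
  simp only [hz] at hb
  refine squeeze_zero_norm hb ?_
  have := ((tendsto_pow_atTop_nhds_zero_of_lt_one hρ.le hρ1).const_mul M).mul_const ‖z₀‖
  simpa using this

theorem isUnit_det_followerLaplacian {G : Digraph (Fin (N + 1))}
    {a : Matrix (Fin (N + 1)) (Fin (N + 1)) ℝ} (hG : IsWeightedAdjacency G a)
    (hreach : ∀ v, Relation.ReflTransGen G.Adj 0 v) : IsUnit (followerLaplacian a).det := by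
  rw [isUnit_iff_ne_zero]
  intro h
  obtain ⟨v, hv, hLv⟩ := Matrix.exists_mulVec_eq_zero_iff.2 h
  have := followerLaplacian_eigenvalue_re_pos hG hreach (v := fun i => (v i : ℂ)) (μ := 0)
    (fun h0 => hv (funext fun i => Complex.ofReal_eq_zero.1 (congrFun h0 i))) (by
      rw [zero_smul]
      funext i
      have := congrArg Complex.ofReal (congrFun hLv i)
      simpa [Matrix.mulVec, dotProduct] using this)
  simp at this

end Necessity

/-! ### Sufficiency of the spanning tree -/

section Sufficiency

open scoped Matrix.Norms.Operator

theorem exists_solvesCooperativeRegulation {N n m p q k : ℕ} (hq : 0 < q)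
    {P : MultiAgentSystem N n m p q} {G : Digraph (Fin (N + 1))}
    (hG : IsWeightedAdjacency G P.a) (hreach : ∀ v, Relation.ReflTransGen G.Adj 0 v)
    {G₁ : Matrix (Fin p × Fin k) (Fin p × Fin k) ℝ} {G₂ : Matrix (Fin p × Fin k) (Fin p) ℝ}
    (hIM : IsMinimalPCopyInternalModel P.S G₁ G₂)
    (h : IsCriticallyStabilizable (augmentedA P.A P.C G₁ G₂) (augmentedB p k P.B)) :
    ∃ (Kx : Matrix (Fin m) (Fin n) ℝ) (Kz : Matrix (Fin m) (Fin p × Fin k) ℝ),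
      P.SolvesCooperativeRegulation G₁ G₂ Kx Kz := by
  obtain ⟨Kx, Kz, T, hT, hlt⟩ := exists_gains hG hreach h
  exact ⟨Kx, Kz, nominalExponentiallyStable_of_norm_pow_lt_one hT hlt,
    robustlyRegulates_of_norm_pow_lt_one hq hIM (isUnit_det_followerLaplacian hG hreach)
      (isOpen_closedLoopMatrix_pow_lt_one P G₁ G₂ Kx Kz T) hlt
      fun w hw v x z u htr hv i => tendsto_internalState hT hw htr hv i⟩

end Sufficiency

end CoopReg

theorem theorem4p1 {N n m p q k : ℕ} (hp : 0 < p) (hq : 0 < q)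
    (P : MultiAgentSystem N n m p q)
    (G : Digraph (Fin (N + 1))) (hG : IsWeightedAdjacency G P.a)
    (hAB : IsStabilizable P.A P.B)
    (hrank : ∀ μ ∈ complexSpectrum P.S, (rosenbrockMatrix P.A P.B P.C μ).rank = n + p)
    (hS : ∀ μ ∈ complexSpectrum P.S, ‖μ‖ = 1)
    (hA : ∀ μ ∈ complexSpectrum P.A, ‖μ‖ ≤ 1)
    (G₁ : Matrix (Fin p × Fin k) (Fin p × Fin k) ℝ) (G₂ : Matrix (Fin p × Fin k) (Fin p) ℝ)
    (hIM : IsMinimalPCopyInternalModel P.S G₁ G₂) :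
    (∃ (Kx : Matrix (Fin m) (Fin n) ℝ) (Kz : Matrix (Fin m) (Fin p × Fin k) ℝ),
      P.SolvesCooperativeRegulation G₁ G₂ Kx Kz) ↔
    HasDirectedSpanningTree G 0 := by
  rw [hasDirectedSpanningTree_iff]
  constructor
  · rintro ⟨Kx, Kz, hstab, -⟩
    obtain ⟨μ, hμ, y, hy, hGy⟩ := exists_eigenvector_internalModel hp hq hIM
    exact reachable_of_nominalExponentiallyStable hG hstab (hS μ hμ) hy hGy
  · intro hreach
    exact exists_solvesCooperativeRegulation hq hG hreach hIM
      (isCriticallyStabilizable_augmented hAB hrank hS hA hIM)
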